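/- Let $P$ be a disc with $n$ holes, let $H=P\times I$ be the handlebody of genus $n$, and let $a_1,\dots,a_n$ be the standard free generators of $\pi_1(H)$, where $a_i$ goes once over the $i$-th handle. Let $V(H)$ be the Kauffman bracket skein module of $H$ at $A=-1$: the complex vector space with basis the isotopy classes of framed links in $H$ (including the empty link $\emptyset$), modulo the relations $L+L_0+L_\infty=0$, whenever $L,L_0,L_\infty$ agree outside a ball in which $L$ has a crossing and $L_0,L_\infty$ are its two smoothings, and $L\amalg\bigcirc+2L=0$, where $\bigcirc$ is an unlinked $0$-framed unknot. Links are given by diagrams in $P$ with the blackboard framing, up to planar isotopy and framed Reidemeister moves. Let $\mathcal W$ be the quotient of $\pi_1(H)$ by $w\sim w^{-1}$ and $w\sim gwg^{-1}$; write $(w)$ for the class of $w$. Let $\Psi:\mathbb C[\mathcal W]\to V(H)$ be the map that sends a monomial $(w_1)\cdots(w_k)$ to $(-1)^k\,K_{w_1}\cup\dots\cup K_{w_k}$, where $K_w$ is any knot in $H$ in the free homotopy class of $w$ up to orientation (and $1$ to $\emptyset$). Let $S\subseteq\{a_1,\dots,a_n\}$ be a subset, let $\mathcal S_m$, $m=|S|$,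 be the group of permutations of $S$, and regard it as a subgroup of the group $\mathcal S_n$ of all permutations of $\{a_1,\dots,a_n\}$. For $S\subseteq T\subseteq\{a_1,\dots,a_n\}$ write a permutation of $T$ in cycle notation, including the trivial cycles $(a_i)$ with $a_i\in T$; reading each cycle $(a_{i_1}\cdots a_{i_r})$ as the class of the word $a_{i_1}\cdots a_{i_r}$ makes it a monomial in $\mathbb C[\mathcal W]$. Extending linearly, every element $q$ of the group algebra of the permutations of $T$ becomes a polynomial $q_T\in\mathbb C[\mathcal W]$. Let $p\in\mathbb C\mathcal S_m$. If $\Psi(p_S)=0$, then for every $\tau\in\mathcal S_n$ and every $T\supseteq S$ that contains all letters moved by $\tau$, $\Psi\bigl((\tau\cdot p)_T\bigr)=0$, where $\tau\cdot p$ is the product in the group algebra $\mathbb C\mathcal S_n$. -/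

import Mathlib

/-!
# The Kauffman bracket skein module of a handlebody and trace polynomials

`P` is the planar surface obtained from a horizontal strip (a disc) by removing `n` holes, numbered
`0, …, n - 1` and placed at increasing heights, and `H = P × I` is the handlebody of genus `n`.
Let the `j`-th cut be the horizontal arc in `P` joining the `j`-th hole to the left-hand side of
the strip.  Cutting `P` along the `n` cuts gives a disc, so `π₁(H)` is free on `a_0, …, a_{n-1}`,
where `a_j` crosses the `j`-th cut once upwards and meets no other cut (it goes once over the
`j`-th handle).

Framed links in `H = P × I` are given by link diagrams in `P` with the blackboard (vertical)
framing, up to isotopy of diagrams in `P` and the framed Reidemeister moves.  A generic diagram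
is recorded by reading it from the bottom to the top: it is a stack of slices, each of which
contains one crossing, one local extremum, or one hole of `P`, between vertical strands.
-/

noncomputable section

namespace HandlebodySkein

/-! ### Link diagrams in the planar surface -/

/-- What a slice of a diagram can contain: a local minimum, a local maximum, a crossing, or
the `j`-th hole of the surface. In `cross true` the strand that goes from the bottom left to the
top right passes over; in `cross false` it passes under. -/
inductive Piece (n : ℕ) : Type
  | cup : Piece n
  | cap : Piece n
  | cross (c : Bool) : Piece n
  | hole (j : Fin n) : Piece n

namespace Piece

/-- The number of strands of a piece at its bottom. -/
def src {n : ℕ} : Piece n → ℕ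
  | cup => 0
  | cap => 2
  | cross _ => 2
  | hole _ => 0

/-- The number of strands of a piece at its top. -/
def tgt {n : ℕ} : Piece n → ℕ
  | cup => 2
  | cap => 0
  | cross _ => 2
  | hole _ => 0

/-- The number of the hole, if the piece is a hole. -/
def hole? {n : ℕ} : Piece n → Option (Fin n)
  | hole j => some j
  | _ => none

end Piece

/-- A horizontal slice of a diagram: `left` vertical strands, then the piece, then `right`
vertical strands. -/
structure Slice (n : ℕ) : Type where
  left : ℕ
  piece : Piece n
  right : ℕ

/-- `IsTangle k w m`: the slices of `w`, stacked upwards, fit together to a diagram with `k`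
endpoints at the bottom and `m` endpoints at the top. -/
def IsTangle {n : ℕ} : ℕ → List (Slice n) → ℕ → Prop
  | k, [], m => k = m
  | k, s :: w, m => k = s.left + s.piece.src + s.right ∧
      IsTangle (s.left + s.piece.tgt + s.right) w m

/-- The holes met by a stack of slices, from the bottom to the top. -/
def holesOf {n : ℕ} (w : List (Slice n)) : List (Fin n) :=
  w.filterMap fun s => s.piece.hole?

/-- A link diagram in the strip with `n` holes: a stack of slices without endpoints in which every
hole occurs exactly once, in increasing order. -/
structure Diagram (n : ℕ) : Type where
  word : List (Slice n)
  closed : IsTangle 0 word 0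
  holes : holesOf word = List.finRange n

/-! ### Framed links -/

/-- The local moves: planar isotopy (cancelling a minimum against a maximum; changing the order
of the heights of two distant pieces, where two holes never change their order because that would
not give a diagram again; turning a crossing around an extremum) and the framed Reidemeister
moves (`r2`, `r3`, and `curl`, which exchanges the two curls with the same framing). -/
inductive Move {n : ℕ} : List (Slice n) → List (Slice n) → Prop
  | zigzag_left (l r : ℕ) : Move [⟨l, .cup, r + 1⟩, ⟨l + 1, .cap, r⟩] []
  | zigzag_right (l r : ℕ) : Move [⟨l + 1, .cup, r⟩, ⟨l, .cap, r + 1⟩] []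
  | interchange (g h : Piece n) (l m r : ℕ) :
      Move [⟨l, g, m + h.src + r⟩, ⟨l + g.tgt + m, h, r⟩]
        [⟨l + g.src + m, h, r⟩, ⟨l, g, m + h.tgt + r⟩]
  | turn_cap (c : Bool) (l r : ℕ) :
      Move [⟨l, .cross c, r + 1⟩, ⟨l + 1, .cap, r⟩] [⟨l + 1, .cross !c, r⟩, ⟨l, .cap, r + 1⟩]
  | turn_cup (c : Bool) (l r : ℕ) :
      Move [⟨l + 1, .cup, r⟩, ⟨l, .cross c, r + 1⟩] [⟨l, .cup, r + 1⟩, ⟨l + 1, .cross !c, r⟩]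
  | r2 (c : Bool) (l r : ℕ) : Move [⟨l, .cross c, r⟩, ⟨l, .cross !c, r⟩] []
  | r3 (c : Bool) (l r : ℕ) :
      Move [⟨l, .cross c, r + 1⟩, ⟨l + 1, .cross c, r⟩, ⟨l, .cross c, r + 1⟩]
        [⟨l + 1, .cross c, r⟩, ⟨l, .cross c, r + 1⟩, ⟨l + 1, .cross c, r⟩]
  | curl (c : Bool) (l r : ℕ) :
      Move [⟨l + 1, .cup, r⟩, ⟨l, .cross c, r + 1⟩, ⟨l + 1, .cap, r⟩]
        [⟨l, .cup, r + 1⟩, ⟨l + 1, .cross c, r⟩, ⟨l, .cap, r + 1⟩]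

/-- Two diagrams differ by one local move. -/
def Diagram.Step {n : ℕ} (D D' : Diagram n) : Prop :=
  ∃ A B u v : List (Slice n), Move u v ∧ D.word = A ++ u ++ B ∧ D'.word = A ++ v ++ B

/-- Framed links in the handlebody `H = P × I`, up to isotopy (the empty link included):
diagrams modulo the equivalence relation generated by the local moves. -/
def FramedLink (n : ℕ) : Type := Quot (Diagram.Step (n := n))

/-- The framed link of a diagram. -/
def Diagram.link {n : ℕ} (D : Diagram n) : FramedLink n := Quot.mk _ D

/-! ### The skein module -/

/-- Diagrams `D`, `D₀`, `D∞` that agree except in a disc, where `D` has a crossing and `D₀`, `D∞`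
are its two smoothings; for `cross true`, `D₀` has two vertical strands and `D∞` a maximum
below a minimum, and for `cross false` it is the other way round (the same picture turned by a
right angle). -/
def SkeinRelated {n : ℕ} (D D₀ D' : Diagram n) : Prop :=
  ∃ (A B : List (Slice n)) (l r : ℕ),
    (D.word = A ++ [⟨l, .cross true, r⟩] ++ B ∧ D₀.word = A ++ B ∧
      D'.word = A ++ [⟨l, .cap, r⟩, ⟨l, .cup, r⟩] ++ B) ∨
    (D.word = A ++ [⟨l, .cross false, r⟩] ++ B ∧
      D₀.word = A ++ [⟨l, .cap, r⟩, ⟨l, .cup, r⟩] ++ B ∧ D'.word = A ++ B)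

/-- `D'` is `D` together with a small circle without crossings that bounds a disc in the
surface, i.e. with an unlinked `0`-framed unknot. -/
def AddsUnknot {n : ℕ} (D D' : Diagram n) : Prop :=
  ∃ (A B : List (Slice n)) (l r : ℕ),
    D.word = A ++ B ∧ D'.word = A ++ [⟨l, .cup, r⟩, ⟨l, .cap, r⟩] ++ B

/-- The subspace spanned by the skein relations `L - A L₀ - A⁻¹ L∞` and the framing relations
`L ⨿ ○ + (A² + A⁻²) L`, for a complex number `A ≠ 0`. -/
def skeinSubmodule (n : ℕ) (A : ℂ) : Submodule ℂ (FramedLink n →₀ ℂ) :=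
  Submodule.span ℂ
    ({x | ∃ D D₀ D' : Diagram n, SkeinRelated D D₀ D' ∧
        x = Finsupp.single D.link 1 - A • Finsupp.single D₀.link 1
          - A⁻¹ • Finsupp.single D'.link 1} ∪
     {x | ∃ D D' : Diagram n, AddsUnknot D D' ∧
        x = Finsupp.single D'.link 1 + (A ^ 2 + A⁻¹ ^ 2) • Finsupp.single D.link 1})

/-- The specialization `V(H)` of the Kauffman bracket skein module of the handlebody at `A = -1`. -/
abbrev V (n : ℕ) : Type := (FramedLink n →₀ ℂ) ⧸ skeinSubmodule n (-1)

/-- The class of a link diagram in `V(H)`. -/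
def Diagram.toV {n : ℕ} (D : Diagram n) : V n :=
  (skeinSubmodule n (-1)).mkQ (Finsupp.single D.link 1)

/-! ### Free homotopy classes of unoriented loops -/

/-- Two words are equivalent if they are conjugate up to inversion. -/
def loopSetoid (n : ℕ) : Setoid (FreeGroup (Fin n)) where
  r w w' := IsConj w w' ∨ IsConj w⁻¹ w'
  iseqv := by
    have inv : ∀ {a b : FreeGroup (Fin n)}, IsConj a b → IsConj a⁻¹ b⁻¹ := by
      intro a b h
      obtain ⟨c, rfl⟩ := isConj_iff.1 h
      exact isConj_iff.2 ⟨c, by group⟩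
    refine ⟨fun _ => Or.inl (IsConj.refl _), ?_, ?_⟩
    · rintro a b (h | h)
      · exact Or.inl h.symm
      · exact Or.inr (by simpa using (inv h).symm)
    · rintro a b c (h | h) (k | k)
      · exact Or.inl (h.trans k)
      · exact Or.inr ((inv h).trans k)
      · exact Or.inr (h.trans k)
      · exact Or.inl (by simpa using (inv h).trans k)

/-- The set `𝒲` of elements of the free group `π₁(H)` modulo `w ∼ w⁻¹` and
`w ∼ g w g⁻¹`: free homotopy classes of unoriented loops in `H`. -/
def W (n : ℕ) : Type := Quotient (loopSetoid n)

/-- The class of a word. -/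
def loopClass {n : ℕ} (w : FreeGroup (Fin n)) : W n := Quotient.mk (loopSetoid n) w

/-! ### The components of a diagram and their homotopy classes -/

/-- The homotopical content of the part of a diagram below some level. The strands at this level
are numbered from the left, starting with `0`. The arc that enters this part downwards at the
strand `i` leaves it upwards at the strand `mate i`; `label i` is the word in the `a_j` read
off from the cuts that it crosses on the way. The components that lie entirely in this part are
collected in `loops` with their classes. (The values at numbers `i` that are not strands do not
matter.) -/
structure State (n : ℕ) : Type where
  mate : ℕ → ℕ
  label : ℕ → FreeGroup (Fin n)
  loops : Multiset (W n)

/-- The state below the bottom of the surface. -/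
def State.init (n : ℕ) : State n := ⟨id, 1, 0⟩

/-- The position to which a strand `i` moves when two strands are inserted at `l`. -/
def insertPos (l i : ℕ) : ℕ := if i < l then i else i + 2

/-- The position to which a strand `i` moves when the two strands `l`, `l + 1` are deleted. -/
def deletePos (l i : ℕ) : ℕ := if i < l then i else i - 2

/-- A minimum creates a new arc between the strands `l` and `l + 1`. -/
def State.cup {n : ℕ} (l : ℕ) (s : State n) : State n where
  mate i := if i = l then l + 1 else if i = l + 1 then l else insertPos l (s.mate (deletePos l i))
  label i := if i = l ∨ i = l + 1 then 1 else s.label (deletePos l i)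
  loops := s.loops

open Classical in
/-- A maximum joins the strands `l` and `l + 1`: it closes up a component if they belong to the
same arc, and otherwise it makes one arc of two. -/
def State.cap {n : ℕ} (l : ℕ) (s : State n) : State n where
  mate i :=
    let k := insertPos l i
    if s.mate k = l then deletePos l (s.mate (l + 1))
    else if s.mate k = l + 1 then deletePos l (s.mate l)
    else deletePos l (s.mate k)
  label i :=
    let k := insertPos l i
    if s.mate k = l then s.label k * s.label (l + 1)
    else if s.mate k = l + 1 then s.label k * s.label l
    else s.label k
  loops := if s.mate l = l + 1 then loopClass (s.label l) ::ₘ s.loops else s.loops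

/-- The effect of a permutation of the strands. -/
def State.permute {n : ℕ} (e : Equiv.Perm ℕ) (s : State n) : State n where
  mate i := e (s.mate (e.symm i))
  label i := s.label (e.symm i)
  loops := s.loops

/-- At the height of the `j`-th hole the strands on its left, i.e. the first `l` strands, cross the
`j`-th cut; upwards this contributes `a_j`, and downwards `a_j⁻¹`. -/
def State.hole {n : ℕ} (j : Fin n) (l : ℕ) (s : State n) : State n where
  mate := s.mate
  label i := (if i < l then FreeGroup.of j else 1)⁻¹ * s.label i *
    (if s.mate i < l then FreeGroup.of j else 1)
  loops := s.loops

/-- The effect of one more slice. -/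
def State.step {n : ℕ} (s : State n) (t : Slice n) : State n :=
  match t.piece with
  | .cup => s.cup t.left
  | .cap => s.cap t.left
  | .cross _ => s.permute (Equiv.swap t.left (t.left + 1))
  | .hole j => s.hole j t.left

/-- The homotopy classes of the components of a link diagram, with multiplicity. -/
def Diagram.components {n : ℕ} (D : Diagram n) : Multiset (W n) :=
  (D.word.foldl State.step (State.init n)).loops

/-! ### Every multiset of classes is the multiset of components of a link -/

theorem IsTangle.append {n : ℕ} {u v : List (Slice n)} {k m p : ℕ} (hu : IsTangle k u m)
    (hv : IsTangle m v p) : IsTangle k (u ++ v) p := by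
  induction u generalizing k with
  | nil => cases hu; exact hv
  | cons s u ih => exact ⟨hu.1, ih hu.2⟩

theorem holesOf_append {n : ℕ} (u v : List (Slice n)) :
    holesOf (u ++ v) = holesOf u ++ holesOf v := List.filterMap_append

/-- The permutations of the strands that can be realized, with their inverses, by crossings. -/
def Realizable (n m : ℕ) (e : Equiv.Perm ℕ) : Prop :=
  ∃ u u' : List (Slice n), IsTangle m u m ∧ IsTangle m u' m ∧ holesOf u = [] ∧ holesOf u' = [] ∧
    (∀ s : State n, u.foldl State.step s = s.permute e) ∧
    (∀ s : State n, u'.foldl State.step s = s.permute e.symm)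

theorem Realizable.one (n m : ℕ) : Realizable n m 1 :=
  ⟨[], [], rfl, rfl, rfl, rfl, fun _ => rfl, fun _ => rfl⟩

theorem Realizable.mul {n m : ℕ} {e f : Equiv.Perm ℕ} (he : Realizable n m e)
    (hf : Realizable n m f) : Realizable n m (e * f) := by
  obtain ⟨u, u', h1, h2, h3, h4, h5, h6⟩ := he
  obtain ⟨v, v', k1, k2, k3, k4, k5, k6⟩ := hf
  refine ⟨v ++ u, u' ++ v', k1.append h1, h2.append k2, by simp [holesOf_append, *],
    by simp [holesOf_append, *], fun s => ?_, fun s => ?_⟩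
  · rw [List.foldl_append, k5, h5]; rfl
  · rw [List.foldl_append, h6, k6]; rfl

theorem Realizable.swap (n : ℕ) {m l : ℕ} (h : l + 2 ≤ m) :
    Realizable n m (Equiv.swap l (l + 1)) := by
  have hT : IsTangle m [(⟨l, .cross true, m - (l + 2)⟩ : Slice n)] m := by
    simp only [IsTangle, Piece.src, Piece.tgt]; omega
  refine ⟨[⟨l, .cross true, m - (l + 2)⟩], [⟨l, .cross true, m - (l + 2)⟩], hT, hT, rfl, rfl,
    fun s => rfl, fun s => ?_⟩
  rw [Equiv.symm_swap]; rfl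

/-- The last of `m + 1` strands can be moved to the left end. -/
theorem exists_realizable_rotate (n M m : ℕ) (hm : m + 1 ≤ M) :
    ∃ e : Equiv.Perm ℕ, Realizable n M e ∧ e m = 0 ∧ (∀ i, i < m → e i = i + 1) ∧
      ∀ i, m < i → e i = i := by
  induction m with
  | zero => exact ⟨1, .one n M, rfl, fun i hi => by omega, fun i _ => rfl⟩
  | succ m ih =>
    obtain ⟨e, he, h0, h1, h2⟩ := ih (by omega)
    refine ⟨e * Equiv.swap m (m + 1), he.mul (.swap n (by omega)), ?_, fun i hi => ?_,
      fun i hi => ?_⟩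
    · simp [h0]
    · rcases Nat.lt_succ_iff_lt_or_eq.1 hi with h | rfl
      · rw [Equiv.Perm.mul_apply, Equiv.swap_apply_of_ne_of_ne (by omega) (by omega), h1 i h]
      · rw [Equiv.Perm.mul_apply, Equiv.swap_apply_left, h2 _ (by omega)]
    · rw [Equiv.Perm.mul_apply, Equiv.swap_apply_of_ne_of_ne (by omega) (by omega),
        h2 i (by omega)]

/-- Any set of strands can be moved to the left. -/
theorem exists_realizable_left (n M : ℕ) (U : ℕ → Prop) (m : ℕ) (hm : m ≤ M) :
    ∃ (e : Equiv.Perm ℕ) (k : ℕ), Realizable n M e ∧ k ≤ m ∧ (∀ i, m ≤ i → e i = i) ∧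
      ∀ i, i < m → (e i < k ↔ U i) := by
  induction m with
  | zero => exact ⟨1, 0, .one n M, le_rfl, fun i _ => rfl, fun i hi => by omega⟩
  | succ m ih =>
    obtain ⟨e, k, he, hk, h1, h2⟩ := ih (by omega)
    by_cases hU : U m
    · obtain ⟨f, hf, f0, f1, f2⟩ := exists_realizable_rotate n M m hm
      have hlt : ∀ i, i < m → e i < m := by
        intro i hi
        by_contra hc
        have := e.injective (h1 (e i) (by omega))
        omega
      refine ⟨f * e, k + 1, hf.mul he, by omega, fun i hi => ?_, fun i hi => ?_⟩
      · rw [Equiv.Perm.mul_apply, h1 i (by omega), f2 i (by omega)]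
      · rw [Equiv.Perm.mul_apply]
        rcases Nat.lt_succ_iff_lt_or_eq.1 hi with h | rfl
        · rw [f1 _ (hlt i h), ← h2 i h]; omega
        · rw [h1 i le_rfl, f0]; simp [hU]
    · refine ⟨e, k, he, by omega, fun i hi => h1 i (by omega), fun i hi => ?_⟩
      rcases Nat.lt_succ_iff_lt_or_eq.1 hi with h | rfl
      · exact h2 i h
      · rw [h1 i le_rfl]; simp only [hU, iff_false]; omega

/-- `s` is the state of a diagram with `m` endpoints at the top that meets the holes `hs`. -/
def Reach {n : ℕ} (hs : List (Fin n)) (m : ℕ) (s : State n) : Prop :=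
  ∃ w, IsTangle 0 w m ∧ holesOf w = hs ∧ w.foldl State.step (State.init n) = s

theorem Reach.append {n : ℕ} {hs hs' : List (Fin n)} {m p : ℕ} {s : State n}
    (h : Reach hs m s) (u : List (Slice n)) (hu : IsTangle m u p) (hh : holesOf u = hs') :
    Reach (hs ++ hs') p (u.foldl State.step s) := by
  obtain ⟨w, h1, h2, h3⟩ := h
  exact ⟨w ++ u, h1.append hu, by rw [holesOf_append, h2, hh], by rw [List.foldl_append, h3]⟩

open Classical in
theorem Reach.hole {n : ℕ} {hs : List (Fin n)} {m : ℕ} {s : State n} (h : Reach hs m s)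
    (j : Fin n) (U : ℕ → Prop) :
    ∃ s', Reach (hs ++ [j]) m s' ∧ s'.loops = s.loops ∧ s'.mate = s.mate ∧
      ∀ i, i < m → s.mate i < m → s'.label i = (if U i then FreeGroup.of j else 1)⁻¹ * s.label i *
        (if U (s.mate i) then FreeGroup.of j else 1) := by
  obtain ⟨e, k, ⟨u, u', h1, h2, h3, h4, h5, h6⟩, hk, -, hU⟩ := exists_realizable_left n m U m le_rfl
  have hT : IsTangle m (u ++ ([⟨k, .hole j, m - k⟩] ++ u')) m := by
    refine h1.append (.append (m := m) ?_ h2)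
    simp only [IsTangle, Piece.src, Piece.tgt]; omega
  refine ⟨_, h.append (hs' := [j]) _ hT ?_, ?_, ?_, ?_⟩
  · rw [holesOf_append, holesOf_append, h3, h4]; rfl
  · rw [List.foldl_append, List.foldl_append, h5, h6]; rfl
  · rw [List.foldl_append, List.foldl_append, h5, h6]
    funext i
    simp [State.permute, State.step, State.hole]
  · intro i hi hi'
    rw [List.foldl_append, List.foldl_append, h5, h6]
    simp [State.permute, State.step, State.hole, hU i hi, hU _ hi']

/-- The strands are joined in neighbouring pairs by arcs with the words `gs`. -/
def Paired {n : ℕ} (s : State n) (gs : List (FreeGroup (Fin n))) : Prop :=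
  ∀ (t : ℕ) (g : FreeGroup (Fin n)), gs[t]? = some g →
    s.mate (2 * t) = 2 * t + 1 ∧ s.mate (2 * t + 1) = 2 * t ∧
      s.label (2 * t) = g ∧ s.label (2 * t + 1) = g⁻¹

theorem exists_reach_cups (n k : ℕ) :
    ∃ s : State n, Reach [] (2 * k) s ∧ s.loops = 0 ∧ Paired s (List.replicate k 1) := by
  induction k with
  | zero => exact ⟨State.init n, ⟨[], rfl, rfl, rfl⟩, rfl, by simp [Paired]⟩
  | succ k ih =>
    obtain ⟨s, h1, h2, h3⟩ := ih
    refine ⟨_, h1.append (hs' := []) (p := 2 * (k + 1)) [⟨0, .cup, 2 * k⟩] ?_ rfl, h2, ?_⟩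
    · simp only [IsTangle, Piece.src, Piece.tgt]; omega
    · intro t g hg
      rcases t with _ | t
      · simp [List.replicate_succ] at hg
        simp [State.step, State.cup, ← hg]
      · rw [List.replicate_succ, List.getElem?_cons_succ] at hg
        obtain ⟨a, b, c, d⟩ := h3 t g hg
        have e1 : deletePos 0 (2 * (t + 1)) = 2 * t := by simp [deletePos]; omega
        have e2 : deletePos 0 (2 * (t + 1) + 1) = 2 * t + 1 := by simp [deletePos]; omega
        refine ⟨?_, ?_, ?_, ?_⟩ <;>
          simp [State.step, State.cup, e1, e2, a, b, c, d, insertPos] <;> omega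

open Classical in
/-- The value of a letter `a_j^{±1}` or `1` when only the holes `hs` are taken into account. -/
def letterVal {n : ℕ} (hs : List (Fin n)) : Option (Fin n × Bool) → FreeGroup (Fin n)
  | none => 1
  | some (j, b) => if j ∈ hs then (if b then FreeGroup.of j else (FreeGroup.of j)⁻¹) else 1

theorem exists_reach_letters {n : ℕ} (ls : List (Option (Fin n × Bool))) (hs : List (Fin n))
    (hn : hs.Nodup) :
    ∃ s : State n, Reach hs (2 * ls.length) s ∧ s.loops = 0 ∧
      Paired s (ls.map (letterVal hs)) := by
  classical
  induction hs using List.reverseRecOn with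
  | nil =>
    obtain ⟨s, h1, h2, h3⟩ := exists_reach_cups n ls.length
    refine ⟨s, h1, h2, ?_⟩
    have : ls.map (letterVal []) = List.replicate ls.length 1 := by
      rw [← List.map_const']
      refine List.map_congr_left fun x _ => ?_
      rcases x with _ | ⟨j, b⟩ <;> simp [letterVal]
    rwa [this]
  | append_singleton hs j ih =>
    rw [List.nodup_append] at hn
    have hj : j ∉ hs := fun hc => hn.2.2 j hc j (by simp) rfl
    obtain ⟨s, h1, h2, h3⟩ := ih hn.1
    obtain ⟨s', k1, k2, k3, k4⟩ := h1.hole j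
      (fun i => ls[i / 2]? = some (some (j, decide (i % 2 = 1))))
    refine ⟨s', k1, k2.trans h2, ?_⟩
    intro t g hg
    rw [List.getElem?_map] at hg
    obtain ⟨x, hx, rfl⟩ := Option.map_eq_some_iff.1 hg
    obtain ⟨a, b, c, d⟩ := h3 t (letterVal hs x) (by rw [List.getElem?_map, hx]; rfl)
    have ht : t < ls.length := (List.getElem?_eq_some_iff.1 hx).1
    have l1 := k4 (2 * t) (by omega) (by omega)
    have l2 := k4 (2 * t + 1) (by omega) (by omega)
    have e1 : 2 * t / 2 = t := by omega
    have e2 : (2 * t + 1) / 2 = t := by omega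
    have e3 : 2 * t % 2 = 0 := by omega
    have e4 : (2 * t + 1) % 2 = 1 := by omega
    rw [a, c] at l1
    rw [b, d] at l2
    simp only [e1, e2, e3, e4, hx] at l1 l2
    refine ⟨by rw [k3, a], by rw [k3, b], ?_, ?_⟩
    · rw [l1]
      rcases x with _ | ⟨i, _ | _⟩
      · simp [letterVal]
      all_goals by_cases hi : i = j <;> simp [letterVal, hi, hj]
    · rw [l2]
      rcases x with _ | ⟨i, _ | _⟩
      · simp [letterVal]
      all_goals by_cases hi : i = j <;> simp [letterVal, hi, hj]

theorem exists_reach_merge {n : ℕ} {hs : List (Fin n)} (x : FreeGroup (Fin n))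
    (xs rest : List (FreeGroup (Fin n))) {s : State n}
    (h : Reach hs (2 * ((x :: xs) ++ rest).length) s) (hp : Paired s ((x :: xs) ++ rest)) :
    ∃ s', Reach hs (2 * rest.length) s' ∧ Paired s' rest ∧
      s'.loops = loopClass (x :: xs).prod ::ₘ s.loops := by
  induction xs generalizing x s with
  | nil =>
    obtain ⟨a, b, c, d⟩ := hp 0 x rfl
    have hT : IsTangle (2 * ([x] ++ rest).length) [(⟨0, .cap, 2 * rest.length⟩ : Slice n)]
        (2 * rest.length) := by
      simp only [IsTangle, Piece.src, Piece.tgt, List.length_append, List.length_singleton]; omega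
    have h' := h.append (hs' := []) _ hT rfl
    rw [List.append_nil] at h'
    refine ⟨_, h', ?_, ?_⟩
    · intro t g hg
      obtain ⟨a, b, c, d⟩ := hp (t + 1) g (by simpa using hg)
      have e1 : insertPos 0 (2 * t) = 2 * (t + 1) := by simp [insertPos]; omega
      have e2 : insertPos 0 (2 * t + 1) = 2 * (t + 1) + 1 := by simp [insertPos]; omega
      refine ⟨?_, ?_, ?_, ?_⟩ <;>
        simp [State.step, State.cap, e1, e2, a, b, c, d, deletePos] <;> omega
    · simp at a c
      simp [State.step, State.cap, a, c]
  | cons y ys ih =>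
    obtain ⟨a, b, c, d⟩ := hp 0 x rfl
    obtain ⟨a', b', c', d'⟩ := hp 1 y rfl
    simp only [Nat.mul_zero, Nat.zero_add, Nat.mul_one, Nat.reduceAdd] at a b c d a' b' c' d'
    have hT : IsTangle (2 * ((x :: y :: ys) ++ rest).length)
        [(⟨1, .cap, 2 * (ys ++ rest).length + 1⟩ : Slice n)]
        (2 * (((x * y) :: ys) ++ rest).length) := by
      simp only [IsTangle, Piece.src, Piece.tgt, List.length_append, List.length_cons]; omega
    have h' := h.append (hs' := []) _ hT rfl
    rw [List.append_nil] at h'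
    have hq : ∃ s', Reach hs (2 * rest.length) s' ∧ Paired s' rest ∧ s'.loops =
        loopClass ((x * y) :: ys).prod ::ₘ
          (List.foldl State.step s [(⟨1, .cap, 2 * (ys ++ rest).length + 1⟩ : Slice n)]).loops := by
      refine ih (x * y) h' ?_
      intro t g hg
      rcases t with _ | t
      · have hg' : x * y = g := by simpa using hg
        subst hg'
        refine ⟨?_, ?_, ?_, ?_⟩ <;>
          simp [State.step, State.cap, insertPos, deletePos, a, b, c, d, a', b', c', d']
      · obtain ⟨a, b, c, d⟩ := hp (t + 2) g (by simpa using hg)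
        have e1 : insertPos 1 (2 * (t + 1)) = 2 * (t + 2) := by simp [insertPos]; omega
        have e2 : insertPos 1 (2 * (t + 1) + 1) = 2 * (t + 2) + 1 := by simp [insertPos]; omega
        refine ⟨?_, ?_, ?_, ?_⟩ <;>
          simp [State.step, State.cap, e1, e2, a, b, c, d, deletePos] <;> omega
    obtain ⟨s', k1, k2, k3⟩ := hq
    refine ⟨s', k1, k2, k3.trans ?_⟩
    simp [State.step, State.cap, a', b, mul_assoc]

theorem exists_reach_close {n : ℕ} {hs : List (Fin n)}
    (L : List (FreeGroup (Fin n) × List (FreeGroup (Fin n)))) {s : State n}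
    (h : Reach hs (2 * (L.map fun q => q.1 :: q.2).flatten.length) s)
    (hp : Paired s (L.map fun q => q.1 :: q.2).flatten) :
    ∃ s', Reach hs 0 s' ∧
      s'.loops = ((L.map fun q => loopClass (q.1 :: q.2).prod : List (W n)) : Multiset (W n))
        + s.loops := by
  induction L generalizing s with
  | nil => exact ⟨s, by simpa using h, by simp⟩
  | cons q L ih =>
    rw [List.map_cons, List.flatten_cons] at h hp
    obtain ⟨s', k1, k2, k3⟩ := exists_reach_merge _ _ _ h hp
    obtain ⟨s'', m1, m2⟩ := ih k1 k2
    refine ⟨s'', m1, ?_⟩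
    rw [m2, k3, List.map_cons, ← Multiset.cons_coe, Multiset.add_cons, Multiset.cons_add]

/-- Every finite multiset of homotopy classes is realized by a link. -/
theorem exists_components_eq {n : ℕ} (C : Multiset (W n)) :
    ∃ D : Diagram n, D.components = C := by
  classical
  let f : W n → List (Option (Fin n × Bool)) := fun c => (Quotient.out c).toWord.map some
  have hlet : ∀ p : Fin n × Bool, letterVal (List.finRange n) (some p) = FreeGroup.mk [p] := by
    rintro ⟨j, _ | _⟩ <;> simp [letterVal, FreeGroup.of, FreeGroup.inv_mk, FreeGroup.invRev]
  have hmk : ∀ l : List (Fin n × Bool),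
      (l.map fun p => letterVal (List.finRange n) (some p)).prod = FreeGroup.mk l := by
    intro l
    induction l with
    | nil => rfl
    | cons p l ih => rw [List.map_cons, List.prod_cons, ih, hlet, FreeGroup.mul_mk]; rfl
  let ls : List (Option (Fin n × Bool)) := (C.toList.map fun c => none :: f c).flatten
  obtain ⟨s, h1, h2, h3⟩ := exists_reach_letters ls (List.finRange n) (List.nodup_finRange n)
  let L : List (FreeGroup (Fin n) × List (FreeGroup (Fin n))) :=
    C.toList.map fun c => (1, (f c).map (letterVal (List.finRange n)))
  have hL : (L.map fun q => q.1 :: q.2).flatten = ls.map (letterVal (List.finRange n)) := by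
    simp only [L, ls, List.map_flatten, List.map_map]
    congr 1
  obtain ⟨s', ⟨w, k1, k2, k3⟩, k4⟩ := exists_reach_close (hs := List.finRange n) L (s := s)
    (by rw [hL, List.length_map]; exact h1) (by rw [hL]; exact h3)
  refine ⟨⟨w, k1, k2⟩, ?_⟩
  change (w.foldl State.step (State.init n)).loops = C
  rw [k3, k4, h2, add_zero]
  have : (L.map fun q => loopClass (q.1 :: q.2).prod) = C.toList := by
    simp only [L, List.map_map]
    conv_rhs => rw [← List.map_id C.toList]
    refine List.map_congr_left fun c _ => ?_
    simp only [Function.comp, f, List.map_map, List.prod_cons, one_mul, id]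
    have := hmk (Quotient.out c).toWord
    simp only [Function.comp_def]
    rw [this, FreeGroup.mk_toWord]
    exact Quotient.out_eq c
  rw [this, Multiset.coe_toList]

/-! ### The map from trace polynomials to the skein module -/

/-- A link whose components have the classes prescribed by the monomial `s = w₁ ⋯ w_k`, i.e. the
union `K_{w₁} ∪ ⋯ ∪ K_{w_k}` of knots in these classes, for some choice of such knots. -/
def linkOf {n : ℕ} (s : W n →₀ ℕ) : Diagram n :=
  (exists_components_eq (Finsupp.toMultiset s)).choose

/-- The map `Ψ : ℂ[𝒲] → V(H)` with `w ↦ -K_w`, where the product of links is their union: the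
monomial `w₁ ⋯ w_k` is sent to `(-1)^k (K_{w₁} ∪ ⋯ ∪ K_{w_k})`. -/
def Psi (n : ℕ) : MvPolynomial (W n) ℂ →ₗ[ℂ] V n :=
  (MvPolynomial.basisMonomials (W n) ℂ).constr ℂ fun s =>
    (-1 : ℂ) ^ Multiset.card (Finsupp.toMultiset s) • (linkOf s).toV

/-! ### Permutations of the generators as trace polynomials -/

/-- The word `a_i a_{σ(i)} a_{σ²(i)} ⋯` of the cycle of `σ` through `i`. -/
def cycleWord {n : ℕ} (σ : Equiv.Perm (Fin n)) (i : Fin n) : FreeGroup (Fin n) :=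
  ((List.range (Function.minimalPeriod σ i)).map fun k => FreeGroup.of ((σ ^ k) i)).prod

open Classical in
/-- A permutation `σ` of `{a_i : i ∈ T}` (extended by the identity), written in cycle notation with
the trivial cycles on `T` included, as a monomial in `ℂ[𝒲]`: the product of the classes of the words
of its cycles, each cycle being written from its smallest letter. -/
def cycleMonomial {n : ℕ} (T : Finset (Fin n)) (σ : Equiv.Perm (Fin n)) : MvPolynomial (W n) ℂ :=
  ∏ i ∈ T with ∀ j, σ.SameCycle i j → i ≤ j, MvPolynomial.X (loopClass (cycleWord σ i))

/-- The linear extension of `cycleMonomial T`: an element of the group algebra as an element of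
`ℂ[𝒲]`. -/
def cyclePoly {n : ℕ} (T : Finset (Fin n)) (p : MonoidAlgebra ℂ (Equiv.Perm (Fin n))) :
    MvPolynomial (W n) ℂ :=
  p.coeff.sum fun σ c => c • cycleMonomial T σ

/-- The inclusion `ℂ𝒮_m → ℂ𝒮_n` of group algebras, where `𝒮_m` is the group of permutations of
a subset `S` of the `n` generators. -/
def extend {n : ℕ} (S : Finset (Fin n)) :
    MonoidAlgebra ℂ (Equiv.Perm {i // i ∈ S}) →ₐ[ℂ] MonoidAlgebra ℂ (Equiv.Perm (Fin n)) :=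
  MonoidAlgebra.mapDomainAlgHom ℂ ℂ Equiv.Perm.ofSubtype

end HandlebodySkein

end

noncomputable section

namespace HandlebodySkein

/-! ### Tensors -/

/-! The kernel of `Psi` consists of exactly those polynomials in free homotopy classes that vanish
as functions of traces in SL₂(ℂ) (`Psi_eq_zero_iff`). Granted this, the theorem is linear algebra on
tensor powers of ℂ².

Evaluation. For a tuple `Y` in SL₂(ℂ), a diagram is evaluated as a tensor network: a minimum is the
antisymmetric form `eps`, a maximum is `-eps`, a crossing is minus the flip, and a hole acts by its
matrix on the strands to its left. The identity flip = 1 + cup ∘ cap (`crossT_eq`) is the skein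
relation at A = -1, a circle has the value -2, and determinant one lets extrema slide past holes. So
the evaluation descends to `V n`. Following arcs and components through a diagram shows that its
value is the product of minus the traces of its components (`exists_arcs`); these signs cancel the
sign in `Psi`.

Injectivity. That no nonzero skein is killed by all evaluations (`evalO_injective`) is proved for
open tangles by induction on the holes. Without holes, stacks of minima span, and their tensors are
unitriangular for the lexicographic order. For the last hole, a skein is a sum of two handles with
`k` and `k + 1` strands (`exists_eq_handle_add_handle`). As functions of the matrix of this hole
their values are homogeneous of degrees `k` and `k + 1`, so both vanish separately. By polarization
the symmetrization over the strands of each handle has value zero, hence is zero by induction; but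
permuting these strands on both sides of the handle does not change the skein, so a factorial
multiple of each handle is zero (`handle_eq_zero`).

Permutations. The product of the traces of the matrices `Z i` along the cycles of σ is the state sum
∑ over `f` of ∏ `Z i (f i) (f (σ i))` (`cyclesTrace_univ`), the trace of ⊗ `Z i` composed with σ
acting on the n-th tensor power of ℂ². It is multilinear, and SL₂(ℂ) spans all matrices. Hence a
linear combination of permutations whose trace polynomial vanishes on SL₂(ℂ) acts by zero on the
tensor power, and multiplying it by τ preserves this (`sum_mul_left_eq_zero`). Letters outside the
support are trivial cycles; they contribute factors that can be inserted, or set to 2 and cancelled.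
-/

/-- Tensors over `ℂ²` with infinitely many indices. -/
abbrev Tensor : Type := (ℕ → Fin 2) → ℂ

/-- `2 × 2` complex matrices. -/
abbrev Mat : Type := Matrix (Fin 2) (Fin 2) ℂ

/-- The sequence `v` with `a`, `b` inserted at the positions `l`, `l + 1`. -/
def insertTwo (l : ℕ) (a b : Fin 2) (v : ℕ → Fin 2) : ℕ → Fin 2 := fun i =>
  if i < l then v i else if i = l then a else if i = l + 1 then b else v (i - 2)

@[simp] theorem insertTwo_left (l : ℕ) (a b : Fin 2) (v : ℕ → Fin 2) :
    insertTwo l a b v l = a := by simp [insertTwo]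

@[simp] theorem insertTwo_right (l : ℕ) (a b : Fin 2) (v : ℕ → Fin 2) :
    insertTwo l a b v (l + 1) = b := by simp [insertTwo]

theorem insertTwo_of_lt {l i : ℕ} (a b : Fin 2) (v : ℕ → Fin 2) (h : i < l) :
    insertTwo l a b v i = v i := by simp [insertTwo, h]

theorem insertTwo_of_le {l i : ℕ} (a b : Fin 2) (v : ℕ → Fin 2) (h : l + 2 ≤ i) :
    insertTwo l a b v i = v (i - 2) := by
  simp [insertTwo, show ¬ i < l by omega, show ¬ i = l by omega, show ¬ i = l + 1 by omega]

@[simp] theorem insertTwo_insertPos (l : ℕ) (a b : Fin 2) (v : ℕ → Fin 2) (i : ℕ) :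
    insertTwo l a b v (insertPos l i) = v i := by
  unfold insertPos
  split_ifs with h
  · exact insertTwo_of_lt _ _ _ h
  · exact insertTwo_of_le _ _ _ (by omega)

theorem insertTwo_comp_insertPos (l : ℕ) (a b : Fin 2) (v : ℕ → Fin 2) :
    (fun i => insertTwo l a b v (insertPos l i)) = v := by
  funext i; simp

theorem insertTwo_self (l : ℕ) (v : ℕ → Fin 2) :
    insertTwo l (v l) (v (l + 1)) (fun i => v (insertPos l i)) = v := by
  funext i
  simp only [insertTwo, insertPos]
  split_ifs <;> first | rfl | (congr 1; omega)

theorem insertTwo_comm {l k : ℕ} (h : l ≤ k) (a b c d : Fin 2) (v : ℕ → Fin 2) :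
    insertTwo l a b (insertTwo k c d v) = insertTwo (k + 2) c d (insertTwo l a b v) := by
  funext i
  simp only [insertTwo]
  split_ifs <;> first | rfl | (congr 1; omega)

theorem insertPos_comm {l k : ℕ} (h : l ≤ k) (i : ℕ) :
    insertPos l (insertPos k i) = insertPos (k + 2) (insertPos l i) := by
  simp only [insertPos]
  split_ifs <;> omega

theorem insertTwo_comp_insertPos_of_le {l k : ℕ} (h : l ≤ k) (a b : Fin 2) (v : ℕ → Fin 2) :
    (fun i => insertTwo l a b v (insertPos (k + 2) i)) =
      insertTwo l a b (fun i => v (insertPos k i)) := by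
  funext i
  simp only [insertTwo, insertPos]
  split_ifs <;> first | rfl | (congr 1; omega)

theorem insertTwo_comp_insertPos_of_ge {l k : ℕ} (h : l ≤ k) (a b : Fin 2) (v : ℕ → Fin 2) :
    (fun i => insertTwo (k + 2) a b v (insertPos l i)) =
      insertTwo k a b (fun i => v (insertPos l i)) := by
  funext i
  simp only [insertTwo, insertPos]
  split_ifs <;> first | rfl | (congr 1; omega)

/-- The antisymmetric form on `ℂ²`. -/
def eps : Mat := !![0, 1; -1, 0]

theorem eps_mul_eps : eps * eps = -1 := by
  ext i j; fin_cases i <;> fin_cases j <;> simp [eps, Matrix.mul_apply, Fin.sum_univ_two]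

/-- Creation of two indices at `l`. -/
def cupT (l : ℕ) : Tensor →ₗ[ℂ] Tensor where
  toFun t v := eps (v l) (v (l + 1)) * t fun i => v (insertPos l i)
  map_add' s t := by funext v; simp [mul_add]
  map_smul' c t := by funext v; simp; ring

/-- Contraction of the indices `l`, `l + 1` with a bilinear form. -/
def contract (l : ℕ) : Mat →ₗ[ℂ] Module.End ℂ Tensor where
  toFun Z :=
    { toFun := fun t v => ∑ a, ∑ b, Z a b * t (insertTwo l a b v)
      map_add' := fun s t => by funext v; simp [mul_add, Finset.sum_add_distrib]
      map_smul' := fun c t => by funext v; simp; ring }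
  map_add' Z Z' := by ext t v; simp [add_mul]; ring
  map_smul' c Z := by ext t v; simp; ring

theorem contract_apply (l : ℕ) (Z : Mat) (t : Tensor) (v : ℕ → Fin 2) :
    contract l Z t v = ∑ a, ∑ b, Z a b * t (insertTwo l a b v) := rfl

/-- The value of a maximum. -/
def capT (l : ℕ) : Tensor →ₗ[ℂ] Tensor := contract l (-eps)

/-- The value of a crossing. -/
def crossT (l : ℕ) : Tensor →ₗ[ℂ] Tensor where
  toFun t v := -t fun i => v (Equiv.swap l (l + 1) i)
  map_add' s t := by funext v; simp; ring
  map_smul' c t := by funext v; simp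

/-- The action of a matrix on the index `i`. -/
def actT (Y : Mat) (i : ℕ) : Tensor →ₗ[ℂ] Tensor where
  toFun t v := ∑ a, Y (v i) a * t (Function.update v i a)
  map_add' s t := by funext v; simp [mul_add, Finset.sum_add_distrib]
  map_smul' c t := by funext v; simp; ring

/-- The action of a matrix on the first `l` indices. -/
def holeT (Y : Mat) : ℕ → Module.End ℂ Tensor
  | 0 => 1
  | l + 1 => actT Y l * holeT Y l

/-! ### Isotopy, skein relation and SL₂-invariance for the tensor operators -/

theorem cupT_apply (l : ℕ) (t : Tensor) (v : ℕ → Fin 2) :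
    cupT l t v = eps (v l) (v (l + 1)) * t fun i => v (insertPos l i) := rfl

theorem capT_apply (l : ℕ) (t : Tensor) (v : ℕ → Fin 2) :
    capT l t v = t (insertTwo l 1 0 v) - t (insertTwo l 0 1 v) := by
  simp [capT, contract_apply, eps]; ring

theorem crossT_apply (l : ℕ) (t : Tensor) (v : ℕ → Fin 2) :
    crossT l t v = -t fun i => v (Equiv.swap l (l + 1) i) := rfl

theorem actT_apply (Y : Mat) (i : ℕ) (t : Tensor) (v : ℕ → Fin 2) :
    actT Y i t v = ∑ a, Y (v i) a * t (Function.update v i a) := rfl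

/-- Since `eps * eps = -1`, zigzags straighten only if a maximum carries the form `-eps`. This sign
forces the value -2 of a circle, which is -A² - A⁻² at A = -1. -/
theorem capT_cupT_self (l : ℕ) (t : Tensor) : capT l (cupT l t) = (-2 : ℂ) • t := by
  funext v
  simp [capT_apply, cupT_apply, eps]
  ring

theorem capT_succ_cupT (l : ℕ) (t : Tensor) : capT (l + 1) (cupT l t) = t := by
  funext v
  have h : ∀ a b, (fun i => insertTwo (l + 1) a b v (insertPos l i)) = Function.update v l b := by
    intro a b
    funext i
    simp only [insertTwo, insertPos, Function.update_apply]
    split_ifs <;> first | rfl | (congr 1; omega)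
  simp only [capT_apply, cupT_apply, h, insertTwo_left, insertTwo_of_lt _ _ _ (Nat.lt_succ_self l)]
  obtain h | h : v l = 0 ∨ v l = 1 := by generalize v l = x; fin_cases x <;> simp
  · simp [h, eps]; rw [← h, Function.update_eq_self]
  · simp [h, eps]; rw [← h, Function.update_eq_self]

theorem capT_cupT_succ (l : ℕ) (t : Tensor) : capT l (cupT (l + 1) t) = t := by
  funext v
  have h : ∀ a b, (fun i => insertTwo l a b v (insertPos (l + 1) i)) = Function.update v l a := by
    intro a b
    funext i
    simp only [insertTwo, insertPos, Function.update_apply]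
    split_ifs <;> first | rfl | (congr 1; omega)
  have h2 : ∀ a b, insertTwo l a b v (l + 1 + 1) = v l := fun a b =>
    insertTwo_of_le _ _ _ (by omega)
  simp only [capT_apply, cupT_apply, h, insertTwo_right, h2]
  obtain h | h : v l = 0 ∨ v l = 1 := by generalize v l = x; fin_cases x <;> simp
  · simp [h, eps]; rw [← h, Function.update_eq_self]
  · simp [h, eps]; rw [← h, Function.update_eq_self]

/-- The difference of the flip and the identity on ℂ² ⊗ ℂ² has rank one and factors through the
antisymmetric form. With the minus sign in `crossT` this is L + L₀ + L∞ = 0, so every identity with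
crossings reduces to one between minima and maxima. -/
theorem crossT_eq (l : ℕ) (t : Tensor) : crossT l t = -t - cupT l (capT l t) := by
  funext v
  have h : (fun i => v (Equiv.swap l (l + 1) i)) =
      insertTwo l (v (l + 1)) (v l) (fun i => v (insertPos l i)) := by
    funext i
    simp only [insertTwo, insertPos, Equiv.swap_apply_def]
    split_ifs <;> first | rfl | omega | (congr 1; omega)
  have h' := insertTwo_self l v
  simp only [crossT_apply, h, Pi.sub_apply, Pi.neg_apply, cupT_apply, capT_apply]
  conv_rhs => enter [1, 1]; rw [← h']
  generalize (fun i => v (insertPos l i)) = u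
  generalize v l = x
  generalize v (l + 1) = y
  fin_cases x <;> fin_cases y <;> simp [eps] <;> ring

theorem crossT_crossT (l : ℕ) (t : Tensor) : crossT l (crossT l t) = t := by
  funext v; simp [crossT_apply]

theorem cupT_comm {l k : ℕ} (h : l ≤ k) (t : Tensor) :
    cupT (k + 2) (cupT l t) = cupT l (cupT k t) := by
  funext v
  simp only [cupT_apply, insertPos_comm h]
  have h1 : insertPos (k + 2) l = l := by simp [insertPos]; omega
  have h2 : insertPos (k + 2) (l + 1) = l + 1 := by simp [insertPos]; omega
  have h3 : insertPos l k = k + 2 := by simp [insertPos]; omega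
  have h4 : insertPos l (k + 1) = k + 2 + 1 := by simp [insertPos]; omega
  rw [h1, h2, h3, h4]; ring

theorem contract_comm {l k : ℕ} (h : l ≤ k) (Z Z' : Mat) (t : Tensor) :
    contract k Z (contract l Z' t) = contract l Z' (contract (k + 2) Z t) := by
  funext v
  simp only [contract_apply, insertTwo_comm h, Fin.sum_univ_two]
  ring

theorem contract_cupT_of_le {l k : ℕ} (h : l ≤ k) (Z : Mat) (t : Tensor) :
    contract (k + 2) Z (cupT l t) = cupT l (contract k Z t) := by
  funext v
  have h1 : ∀ a b, insertTwo (k + 2) a b v l = v l := fun a b => insertTwo_of_lt _ _ _ (by omega)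
  have h2 : ∀ a b, insertTwo (k + 2) a b v (l + 1) = v (l + 1) :=
    fun a b => insertTwo_of_lt _ _ _ (by omega)
  simp only [contract_apply, cupT_apply, insertTwo_comp_insertPos_of_ge h, h1, h2,
    Fin.sum_univ_two]
  ring

theorem contract_cupT_of_ge {l k : ℕ} (h : l ≤ k) (Z : Mat) (t : Tensor) :
    contract l Z (cupT (k + 2) t) = cupT k (contract l Z t) := by
  funext v
  have h1 : ∀ a b, insertTwo l a b v (k + 2) = v k := fun a b => insertTwo_of_le _ _ _ (by omega)
  have h2 : ∀ a b, insertTwo l a b v (k + 2 + 1) = v (k + 1) :=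
    fun a b => insertTwo_of_le _ _ _ (by omega)
  simp only [contract_apply, cupT_apply, insertTwo_comp_insertPos_of_le h, h1, h2,
    Fin.sum_univ_two]
  ring

theorem actT_comm {i j : ℕ} (h : i ≠ j) (Y Y' : Mat) (t : Tensor) :
    actT Y i (actT Y' j t) = actT Y' j (actT Y i t) := by
  funext v
  simp only [actT_apply, Fin.sum_univ_two, Function.update_of_ne h, Function.update_of_ne h.symm,
    Function.update_comm h.symm]
  ring

theorem actT_cupT_of_lt {l i : ℕ} (h : i < l) (Y : Mat) (t : Tensor) :
    actT Y i (cupT l t) = cupT l (actT Y i t) := by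
  funext v
  have h1 : ∀ a, (fun j => Function.update v i a (insertPos l j)) =
      Function.update (fun j => v (insertPos l j)) i a := by
    intro a; funext j
    simp only [Function.update_apply, insertPos]
    split_ifs <;> first | rfl | omega
  have h2 : insertPos l i = i := by simp [insertPos, h]
  simp only [actT_apply, cupT_apply, h1, Fin.sum_univ_two, h2,
    Function.update_of_ne (show l ≠ i by omega), Function.update_of_ne (show l + 1 ≠ i by omega)]
  ring

theorem actT_cupT_of_ge {l i : ℕ} (h : l ≤ i) (Y : Mat) (t : Tensor) :
    actT Y (i + 2) (cupT l t) = cupT l (actT Y i t) := by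
  funext v
  have h1 : ∀ a, (fun j => Function.update v (i + 2) a (insertPos l j)) =
      Function.update (fun j => v (insertPos l j)) i a := by
    intro a; funext j
    simp only [Function.update_apply, insertPos]
    split_ifs <;> first | rfl | omega
  have h2 : insertPos l i = i + 2 := by simp [insertPos]; omega
  simp only [actT_apply, cupT_apply, h1, Fin.sum_univ_two, h2,
    Function.update_of_ne (show l ≠ i + 2 by omega),
    Function.update_of_ne (show l + 1 ≠ i + 2 by omega)]
  ring

theorem actT_contract_of_lt {l i : ℕ} (h : i < l) (Y Z : Mat) (t : Tensor) :
    actT Y i (contract l Z t) = contract l Z (actT Y i t) := by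
  funext v
  have h1 : ∀ a b c, insertTwo l b c (Function.update v i a) =
      Function.update (insertTwo l b c v) i a := by
    intro a b c; funext j
    simp only [Function.update_apply, insertTwo]
    split_ifs <;> first | rfl | omega
  simp only [actT_apply, contract_apply, h1, Fin.sum_univ_two, insertTwo_of_lt _ _ _ h]
  ring

theorem actT_contract_of_ge {l i : ℕ} (h : l ≤ i) (Y Z : Mat) (t : Tensor) :
    actT Y i (contract l Z t) = contract l Z (actT Y (i + 2) t) := by
  funext v
  have h1 : ∀ a b c, insertTwo l b c (Function.update v i a) =
      Function.update (insertTwo l b c v) (i + 2) a := by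
    intro a b c; funext j
    simp only [Function.update_apply, insertTwo]
    split_ifs <;> first | rfl | omega
  have h2 : ∀ a b, insertTwo l a b v (i + 2) = v i := fun a b => insertTwo_of_le _ _ _ (by omega)
  simp only [actT_apply, contract_apply, h1, Fin.sum_univ_two, h2]
  ring

/-- `Y * eps * Yᵀ = det Y • eps`: the antisymmetric form is SL₂-invariant. Geometrically, a minimum
to the left of a hole can be pushed above the hole. The next lemma is the same for maxima. -/
theorem actT_actT_cupT {Y : Mat} (hY : Y.det = 1) (l : ℕ) (t : Tensor) :
    actT Y (l + 1) (actT Y l (cupT l t)) = cupT l t := by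
  funext v
  have h1 : ∀ a b, (fun j => Function.update (Function.update v (l + 1) a) l b (insertPos l j)) =
      fun j => v (insertPos l j) := by
    intro a b; funext j
    simp only [Function.update_apply, insertPos]
    split_ifs <;> first | rfl | omega
  rw [Matrix.det_fin_two] at hY
  simp only [actT_apply, cupT_apply, h1, Fin.sum_univ_two, Function.update_self,
    Function.update_of_ne (show l ≠ l + 1 by omega),
    Function.update_of_ne (show l + 1 ≠ l by omega)]
  generalize (t fun j => v (insertPos l j)) = c
  generalize v l = x
  generalize v (l + 1) = y
  fin_cases x <;> fin_cases y <;> simp [eps]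
  · ring
  · linear_combination c * hY
  · linear_combination -c * hY
  · ring

theorem capT_actT_actT {Y : Mat} (hY : Y.det = 1) (l : ℕ) (t : Tensor) :
    capT l (actT Y (l + 1) (actT Y l t)) = capT l t := by
  funext v
  have h1 : ∀ a b c d, (Function.update (Function.update (insertTwo l a b v) (l + 1) c) l d) =
      insertTwo l d c v := by
    intro a b c d; funext j
    simp only [Function.update_apply, insertTwo]
    split_ifs <;> first | rfl | omega
  rw [Matrix.det_fin_two] at hY
  simp only [actT_apply, capT_apply, h1, Fin.sum_univ_two, insertTwo_left, insertTwo_right,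
    Function.update_of_ne (show l ≠ l + 1 by omega)]
  linear_combination (t (insertTwo l 1 0 v) - t (insertTwo l 0 1 v)) * hY

theorem holeT_add_two (Y : Mat) (l : ℕ) (t : Tensor) :
    holeT Y (l + 2) t = actT Y (l + 1) (actT Y l (holeT Y l t)) := rfl

theorem holeT_succ (Y : Mat) (l : ℕ) (t : Tensor) :
    holeT Y (l + 1) t = actT Y l (holeT Y l t) := rfl

theorem holeT_cupT_of_le {l k : ℕ} (h : k ≤ l) (Y : Mat) (t : Tensor) :
    holeT Y k (cupT l t) = cupT l (holeT Y k t) := by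
  induction k with
  | zero => rfl
  | succ k ih => rw [holeT_succ, ih (by omega), actT_cupT_of_lt (by omega), holeT_succ]

theorem holeT_contract_of_le {l k : ℕ} (h : k ≤ l) (Y Z : Mat) (t : Tensor) :
    holeT Y k (contract l Z t) = contract l Z (holeT Y k t) := by
  induction k with
  | zero => rfl
  | succ k ih => rw [holeT_succ, ih (by omega), actT_contract_of_lt (by omega), holeT_succ]

theorem holeT_cupT_of_ge {Y : Mat} (hY : Y.det = 1) {l k : ℕ} (h : l ≤ k) (t : Tensor) :
    holeT Y (k + 2) (cupT l t) = cupT l (holeT Y k t) := by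
  induction k, h using Nat.le_induction with
  | base => rw [holeT_add_two, holeT_cupT_of_le le_rfl, actT_actT_cupT hY]
  | succ k h ih => rw [holeT_succ, ih, actT_cupT_of_ge h, holeT_succ]

theorem holeT_capT_of_ge {Y : Mat} (hY : Y.det = 1) {l k : ℕ} (h : l ≤ k) (t : Tensor) :
    holeT Y k (capT l t) = capT l (holeT Y (k + 2) t) := by
  induction k, h using Nat.le_induction with
  | base => rw [holeT_add_two, capT_actT_actT hY, capT, holeT_contract_of_le le_rfl]
  | succ k h ih => rw [holeT_succ, ih, capT, actT_contract_of_ge h, holeT_succ Y (k + 2)]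

theorem actT_holeT_of_le {i k : ℕ} (h : k ≤ i) (Y Y' : Mat) (t : Tensor) :
    actT Y' i (holeT Y k t) = holeT Y k (actT Y' i t) := by
  induction k with
  | zero => rfl
  | succ k ih => rw [holeT_succ, actT_comm (by omega), ih (by omega), holeT_succ]

theorem holeT_comm_of_le (Y : Mat) {k k' : ℕ} (h : k ≤ k') (t : Tensor) :
    holeT Y k (holeT Y k' t) = holeT Y k' (holeT Y k t) := by
  induction k', h using Nat.le_induction with
  | base => rfl
  | succ k' h ih => rw [holeT_succ, ← actT_holeT_of_le h, ih, holeT_succ]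

/-! ### The evaluation of a stack of slices -/

/-- The special linear group `SL₂(ℂ)`. -/
abbrev SL : Type := Matrix.SpecialLinearGroup (Fin 2) ℂ

/-- The value of the piece `g` with `l` strands on its left. -/
def pieceT {n : ℕ} (Y : Fin n → SL) (g : Piece n) (l : ℕ) : Tensor →ₗ[ℂ] Tensor :=
  match g with
  | .cup => cupT l
  | .cap => capT l
  | .cross _ => crossT l
  | .hole j => holeT (Y j).1 l

/-- The value of a stack of slices. -/
def wordT {n : ℕ} (Y : Fin n → SL) : List (Slice n) → Tensor →ₗ[ℂ] Tensor
  | [] => LinearMap.id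
  | s :: w => wordT Y w ∘ₗ pieceT Y s.piece s.left

theorem wordT_nil {n : ℕ} (Y : Fin n → SL) (t : Tensor) : wordT Y [] t = t := rfl

theorem wordT_cons {n : ℕ} (Y : Fin n → SL) (s : Slice n) (w : List (Slice n)) (t : Tensor) :
    wordT Y (s :: w) t = wordT Y w (pieceT Y s.piece s.left t) := rfl

theorem wordT_append {n : ℕ} (Y : Fin n → SL) (u v : List (Slice n)) (t : Tensor) :
    wordT Y (u ++ v) t = wordT Y v (wordT Y u t) := by
  induction u generalizing t with
  | nil => rfl
  | cons s u ih => exact ih _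

/-- Crossings are expanded by `crossT_eq`, so only minima, maxima and holes have to be commuted past
each other. Matrices of different holes need not commute; `hgh` excludes that case. -/
theorem pieceT_interchange {n : ℕ} (Y : Fin n → SL) (g h : Piece n) (l m : ℕ)
    (hgh : holesOf [⟨0, g, 0⟩, ⟨0, h, 0⟩] = holesOf [⟨0, h, 0⟩, ⟨0, g, 0⟩]) (t : Tensor) :
    pieceT Y h (l + g.tgt + m) (pieceT Y g l t) = pieceT Y g l (pieceT Y h (l + g.src + m) t) := by
  have hd : ∀ j, (Y j).1.det = 1 := fun j => (Y j).2
  have e (x : ℕ) : x + 2 + m = x + m + 2 := by omega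
  have le : l ≤ l + m := Nat.le_add_right l m
  have c1 (t) := cupT_comm le t
  have c2 (t) := contract_comm le (-eps) (-eps) t
  have c3 (t) := contract_cupT_of_le le (-eps) t
  have c4 (t) := contract_cupT_of_ge le (-eps) t
  cases g <;> cases h <;>
    simp only [pieceT, Piece.src, Piece.tgt, Nat.add_zero, e, crossT_eq, map_sub, map_neg]
  -- Here `hgh` forces the two holes to carry the same number, and the same matrix commutes with
  -- itself.
  case hole.hole j k =>
    have : k = j := by simpa [holesOf, Piece.hole?, eq_comm] using hgh
    subst this
    exact (holeT_comm_of_le _ le t).symm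
  all_goals (try simp only [holeT_cupT_of_ge (hd _) le, holeT_cupT_of_le le,
    holeT_capT_of_ge (hd _) le])
  all_goals (try unfold capT)
  all_goals (try simp only [c1, c2, c3, c4, holeT_contract_of_le le])
  all_goals abel

/-- After the crossings are resolved, the moves that turn crossings, the third Reidemeister move and
the curl move all follow from the zigzag identities and the circle value -2. -/
theorem wordT_move {n : ℕ} (Y : Fin n → SL) {u v : List (Slice n)} (h : Move u v)
    (hh : holesOf u = holesOf v) (t : Tensor) : wordT Y u t = wordT Y v t := by
  cases h with
  | zigzag_left l r => exact capT_succ_cupT l t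
  | zigzag_right l r => exact capT_cupT_succ l t
  | interchange g h l m r =>
    refine pieceT_interchange Y g h l m ?_ t
    cases g <;> cases h <;> first | rfl | exact hh
  | turn_cap c l r =>
    simp only [wordT_cons, wordT_nil, pieceT, crossT_eq, map_sub, map_neg, capT_succ_cupT,
      capT_cupT_succ]
    abel
  | turn_cup c l r =>
    simp only [wordT_cons, wordT_nil, pieceT, crossT_eq, map_sub, map_neg, capT_succ_cupT,
      capT_cupT_succ]
    abel
  | r2 c l r => exact crossT_crossT l t
  | r3 c l r =>
    simp only [wordT_cons, wordT_nil, pieceT, crossT_eq, map_sub, map_neg, capT_succ_cupT,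
      capT_cupT_succ, capT_cupT_self, map_smul]
    module
  | curl c l r =>
    simp only [wordT_cons, wordT_nil, pieceT, crossT_eq, map_sub, map_neg, capT_succ_cupT,
      capT_cupT_succ, capT_cupT_self, map_smul]

section

/-! ### The skein module of open tangles -/

/-- The local relations of the skein module at `A = -1`, as lists of terms. -/
inductive LocalRel {n : ℕ} : List (ℂ × List (Slice n)) → Prop
  | move {u v : List (Slice n)} (h : Move u v) : LocalRel [(1, u), (-1, v)]
  | cross (c : Bool) (l r : ℕ) :
      LocalRel [(1, [⟨l, .cross c, r⟩]), (1, []), (1, [⟨l, .cap, r⟩, ⟨l, .cup, r⟩])]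
  | circle (l r : ℕ) : LocalRel [(1, [⟨l, .cup, r⟩, ⟨l, .cap, r⟩]), (2, [])]

/-- `w` is a stack of slices from `0` to `m` endpoints which meets the holes `hs`. -/
def Valid {n : ℕ} (hs : List (Fin n)) (m : ℕ) (w : List (Slice n)) : Prop :=
  IsTangle 0 w m ∧ holesOf w = hs

/-- The relations between stacks of slices: a stack whose slices do not fit together is zero, and
local relations hold between stacks with the same endpoints and holes. -/
def openRelations (n : ℕ) : Submodule ℂ (List (Slice n) →₀ ℂ) :=
  Submodule.span ℂ
    ({x | ∃ w, (∀ m, ¬ IsTangle 0 w m) ∧ x = Finsupp.single w 1} ∪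
     {x | ∃ ts A B hs m, LocalRel ts ∧ (∀ q ∈ ts, Valid hs m (A ++ q.2 ++ B)) ∧
        x = (ts.map fun q => Finsupp.single (A ++ q.2 ++ B) q.1).sum})

/-- The skein module of open tangles. -/
abbrev OpenSkein (n : ℕ) : Type := (List (Slice n) →₀ ℂ) ⧸ openRelations n

/-- The class of a stack of slices. -/
def cls {n : ℕ} (w : List (Slice n)) : OpenSkein n :=
  (openRelations n).mkQ (Finsupp.single w 1)

theorem mkQ_single {n : ℕ} (w : List (Slice n)) (c : ℂ) :
    (openRelations n).mkQ (Finsupp.single w c) = c • cls w := by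
  rw [cls, ← map_smul, Finsupp.smul_single, smul_eq_mul, mul_one]

theorem cls_eq_zero {n : ℕ} {w : List (Slice n)} (h : ∀ m, ¬ IsTangle 0 w m) : cls w = 0 :=
  (Submodule.Quotient.mk_eq_zero _).2 (Submodule.subset_span (Or.inl ⟨w, h, rfl⟩))

theorem sum_cls_eq_zero {n : ℕ} {ts : List (ℂ × List (Slice n))} (h : LocalRel ts)
    {A B : List (Slice n)} {hs : List (Fin n)} {m : ℕ}
    (hv : ∀ q ∈ ts, Valid hs m (A ++ q.2 ++ B)) :
    (ts.map fun q => q.1 • cls (A ++ q.2 ++ B)).sum = 0 := by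
  have h0 : (openRelations n).mkQ
      ((ts.map fun q => Finsupp.single (A ++ q.2 ++ B) q.1).sum) = 0 :=
    (Submodule.Quotient.mk_eq_zero _).2
      (Submodule.subset_span (Or.inr ⟨ts, A, B, hs, m, h, hv, rfl⟩))
  rw [map_list_sum, List.map_map] at h0
  rw [← h0]
  congr 1
  exact List.map_congr_left fun q _ => (mkQ_single _ _).symm

/-- A linear map on open skeins is given by its values on stacks of slices. -/
def OpenSkein.lift {n : ℕ} {N : Type*} [AddCommGroup N] [Module ℂ N] (f : List (Slice n) → N)
    (h0 : ∀ w, (∀ m, ¬ IsTangle 0 w m) → f w = 0)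
    (h1 : ∀ ts A B hs m, LocalRel ts → (∀ q ∈ ts, Valid hs m (A ++ q.2 ++ B)) →
      (ts.map fun q => q.1 • f (A ++ q.2 ++ B)).sum = 0) : OpenSkein n →ₗ[ℂ] N :=
  (openRelations n).liftQ (Finsupp.linearCombination ℂ f) <| by
    rw [openRelations, Submodule.span_le]
    rintro x (⟨w, hw, rfl⟩ | ⟨ts, A, B, hs, m, h, hv, rfl⟩)
    · simp [h0 w hw]
    · rw [SetLike.mem_coe, LinearMap.mem_ker, map_list_sum, List.map_map,
        ← h1 ts A B hs m h hv]
      congr 1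
      refine List.map_congr_left fun q _ => ?_
      simp

@[simp] theorem OpenSkein.lift_cls {n : ℕ} {N : Type*} [AddCommGroup N] [Module ℂ N]
    (f : List (Slice n) → N) (h0) (h1) (w : List (Slice n)) :
    OpenSkein.lift f h0 h1 (cls w) = f w := by
  simp [OpenSkein.lift, cls]

theorem span_cls (n : ℕ) : Submodule.span ℂ (Set.range (cls (n := n))) = ⊤ := by
  rw [eq_top_iff]
  rintro x -
  obtain ⟨x, rfl⟩ := Submodule.mkQ_surjective _ x
  induction x using Finsupp.induction_linear with
  | zero => simp
  | add a b ha hb => rw [map_add]; exact add_mem ha hb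
  | single w c =>
    rw [mkQ_single]
    exact Submodule.smul_mem _ _ (Submodule.subset_span ⟨w, rfl⟩)

theorem OpenSkein.hom_ext {n : ℕ} {N : Type*} [AddCommGroup N] [Module ℂ N]
    {f g : OpenSkein n →ₗ[ℂ] N} (h : ∀ w, f (cls w) = g (cls w)) : f = g :=
  LinearMap.ext_on (span_cls n) (by rintro _ ⟨w, rfl⟩; exact h w)

/-- The number of endpoints at the top of a stack of slices. -/
def topWidth {n : ℕ} (w : List (Slice n)) : ℕ :=
  match w.getLast? with
  | none => 0
  | some s => s.left + s.piece.tgt + s.right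

theorem IsTangle.split {n : ℕ} {u v : List (Slice n)} {k p : ℕ} (h : IsTangle k (u ++ v) p) :
    ∃ m, IsTangle k u m ∧ IsTangle m v p := by
  induction u generalizing k with
  | nil => exact ⟨k, rfl, h⟩
  | cons s u ih =>
    obtain ⟨m, h1, h2⟩ := ih h.2
    exact ⟨m, ⟨h.1, h1⟩, h2⟩

@[simp] theorem topWidth_concat {n : ℕ} (w : List (Slice n)) (s : Slice n) :
    topWidth (w ++ [s]) = s.left + s.piece.tgt + s.right := by
  simp [topWidth]

theorem IsTangle.topWidth_eq {n : ℕ} {w : List (Slice n)} {m : ℕ} (h : IsTangle 0 w m) :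
    topWidth w = m := by
  induction w using List.reverseRecOn with
  | nil => exact h
  | append_singleton w s _ =>
    obtain ⟨k, -, h2⟩ := h.split
    rw [topWidth_concat]
    exact h2.2

/-- The slice that puts the piece `g` with `l` strands on its left on top of `w`. -/
def topSlice {n : ℕ} (g : Piece n) (l : ℕ) (w : List (Slice n)) : Slice n :=
  ⟨l, g, topWidth w - l - g.src⟩

theorem Valid.isTangle {n : ℕ} {hs : List (Fin n)} {m : ℕ} {w : List (Slice n)}
    (h : Valid hs m w) : IsTangle 0 w m := h.1

/-- The operator that puts the piece `g` with `l` strands on its left on top. -/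
def op {n : ℕ} (g : Piece n) (l : ℕ) : Module.End ℂ (OpenSkein n) :=
  OpenSkein.lift (fun w => cls (w ++ [topSlice g l w]))
    (fun w hw => cls_eq_zero fun m hm => by
      obtain ⟨k, h, -⟩ := hm.split
      exact hw k h)
    (fun ts A B hs m h hv => by
      have e : ∀ q ∈ ts, A ++ q.2 ++ B ++ [topSlice g l (A ++ q.2 ++ B)] =
          A ++ q.2 ++ (B ++ [⟨l, g, m - l - g.src⟩]) := fun q hq => by
        rw [topSlice, (hv q hq).isTangle.topWidth_eq, List.append_assoc]
      -- If the piece fits on top of width `m`, the relation persists with one more slice in the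
      -- upper context. Otherwise the truncated subtraction in the new slice leaves it ill-fitting,
      -- and each term is zero.
      by_cases hl : l + g.src ≤ m
      · rw [← sum_cls_eq_zero h (A := A) (B := B ++ [⟨l, g, m - l - g.src⟩])
          (hs := hs ++ holesOf [(⟨l, g, m - l - g.src⟩ : Slice n)])
          (m := l + g.tgt + (m - l - g.src))]
        · congr 1
          exact List.map_congr_left fun q hq => by rw [e q hq]
        · intro q hq
          obtain ⟨h1, h2⟩ := hv q hq
          rw [← List.append_assoc]
          refine ⟨h1.append ?_, by rw [holesOf_append, h2]⟩
          refine ⟨?_, rfl⟩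
          change m = l + g.src + (m - l - g.src)
          omega
      · refine List.sum_eq_zero fun x hx => ?_
        obtain ⟨q, hq, rfl⟩ := List.mem_map.1 hx
        rw [cls_eq_zero, smul_zero]
        intro p hp
        obtain ⟨k, h1, h2⟩ := hp.split
        have := h1.topWidth_eq
        rw [(hv q hq).isTangle.topWidth_eq] at this
        have h3 : k = l + g.src + (topWidth (A ++ q.2 ++ B) - l - g.src) := h2.1
        omega)

@[simp] theorem op_cls {n : ℕ} (g : Piece n) (l : ℕ) (w : List (Slice n)) :
    op g l (cls w) = cls (w ++ [topSlice g l w]) := OpenSkein.lift_cls _ _ _ _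

theorem op_cls_eq {n : ℕ} {g : Piece n} {l r : ℕ} {w : List (Slice n)}
    (h : topWidth w = l + g.src + r) : op g l (cls w) = cls (w ++ [⟨l, g, r⟩]) := by
  rw [op_cls, topSlice, h]
  congr 4
  omega

/-- The classes of tangles from `0` to `m` endpoints which meet the holes `hs`. -/
def tangles {n : ℕ} (hs : List (Fin n)) (m : ℕ) : Submodule ℂ (OpenSkein n) :=
  Submodule.span ℂ (cls '' {w | Valid hs m w})

theorem cls_mem_tangles {n : ℕ} {hs : List (Fin n)} {m : ℕ} {w : List (Slice n)}
    (h : Valid hs m w) : cls w ∈ tangles hs m := Submodule.subset_span ⟨w, h, rfl⟩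

theorem tangles_induction {n : ℕ} {hs : List (Fin n)} {m : ℕ} (P : Submodule ℂ (OpenSkein n))
    (h : ∀ w, Valid hs m w → cls w ∈ P) : tangles hs m ≤ P :=
  Submodule.span_le.2 (by rintro _ ⟨w, hw, rfl⟩; exact h w hw)

theorem eqOn_tangles {n : ℕ} {hs : List (Fin n)} {m : ℕ} {N : Type*} [AddCommGroup N]
    [Module ℂ N] {f g : OpenSkein n →ₗ[ℂ] N} (h : ∀ w, Valid hs m w → f (cls w) = g (cls w))
    {x : OpenSkein n} (hx : x ∈ tangles hs m) : f x = g x :=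
  LinearMap.eqOn_span (by rintro _ ⟨w, hw, rfl⟩; exact h w hw) hx

theorem Valid.concat {n : ℕ} {hs : List (Fin n)} {m : ℕ} {w : List (Slice n)}
    (h : Valid hs m w) (s : Slice n) (hl : m = s.left + s.piece.src + s.right) :
    Valid (hs ++ holesOf [s]) (s.left + s.piece.tgt + s.right) (w ++ [s]) :=
  ⟨h.1.append ⟨hl, rfl⟩, by rw [holesOf_append, h.2]⟩

theorem op_mem_tangles {n : ℕ} {hs : List (Fin n)} {m : ℕ} (g : Piece n) (l : ℕ)
    (hl : l + g.src ≤ m) {x : OpenSkein n} (hx : x ∈ tangles hs m) :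
    op g l x ∈ tangles (hs ++ holesOf [⟨0, g, 0⟩]) (m + g.tgt - g.src) := by
  refine tangles_induction ((tangles _ _).comap (op g l)) (fun w hw => ?_) hx
  rw [Submodule.mem_comap, op_cls]
  have := hw.concat (topSlice g l w)
    (by
      change m = l + g.src + (topWidth w - l - g.src)
      rw [hw.isTangle.topWidth_eq]; omega)
  convert cls_mem_tangles this using 2
  · simp only [holesOf, topSlice, List.filterMap_cons]
  change m + g.tgt - g.src = l + g.tgt + (topWidth w - l - g.src)
  rw [hw.isTangle.topWidth_eq]; omega

/-- Peels off the top slice; inductions over stacks then become statements about the operators `op`.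
-/
theorem cls_concat {n : ℕ} {hs : List (Fin n)} {m : ℕ} {w : List (Slice n)} {s : Slice n}
    (h : Valid hs m (w ++ [s])) : ∃ hs' m', Valid hs' m' w ∧ s.left + s.piece.src ≤ m' ∧
      m + s.piece.src = m' + s.piece.tgt ∧ hs = hs' ++ holesOf [s] ∧
      cls (w ++ [s]) = op s.piece s.left (cls w) := by
  obtain ⟨h1, h2⟩ := h
  obtain ⟨k, h3, h4, h5⟩ := h1.split
  have h6 : s.left + s.piece.tgt + s.right = m := h5
  refine ⟨holesOf w, k, ⟨h3, rfl⟩, by omega, by omega, by rw [← h2, holesOf_append], ?_⟩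
  rw [op_cls, topSlice, h3.topWidth_eq]
  congr 3
  obtain ⟨l, g, r⟩ := s
  simp only [Slice.mk.injEq, true_and] at h4 ⊢
  omega

/-- No bound on widths is needed: where the pieces do not fit, both sides are classes of ill-fitting
stacks and hence zero. This is what makes far commutation an identity of endomorphisms, whereas the
zigzag and circle identities below need a bound, because their right-hand sides would survive. -/
theorem op_interchange {n : ℕ} (g h : Piece n) (l d : ℕ)
    (hgh : holesOf [⟨0, g, 0⟩, ⟨0, h, 0⟩] = holesOf [⟨0, h, 0⟩, ⟨0, g, 0⟩]) :
    op h (l + g.tgt + d) * op g l = op g l * op h (l + g.src + d) := by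
  refine OpenSkein.hom_ext fun w => ?_
  simp only [Module.End.mul_apply, op_cls]
  have hw1 : topWidth (w ++ [topSlice g l w]) = l + g.tgt + (topWidth w - l - g.src) :=
    topWidth_concat _ _
  have hw2 : topWidth (w ++ [topSlice h (l + g.src + d) w]) =
      l + g.src + d + h.tgt + (topWidth w - (l + g.src + d) - h.src) :=
    topWidth_concat _ _
  by_cases hv : ∃ m, IsTangle 0 w m ∧ l + g.src + d + h.src ≤ m
  · obtain ⟨m, hm, hl⟩ := hv
    rw [hm.topWidth_eq] at hw1 hw2
    set r := m - (l + g.src + d + h.src) with hr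
    have e1 : topSlice g l w = ⟨l, g, d + h.src + r⟩ := by
      simp only [topSlice, hm.topWidth_eq, Slice.mk.injEq, true_and]; omega
    have e2 : topSlice h (l + g.tgt + d) (w ++ [topSlice g l w]) = ⟨l + g.tgt + d, h, r⟩ := by
      simp only [topSlice, topWidth_concat, hm.topWidth_eq, Slice.mk.injEq, true_and]; omega
    have e3 : topSlice h (l + g.src + d) w = ⟨l + g.src + d, h, r⟩ := by
      simp only [topSlice, hm.topWidth_eq, Slice.mk.injEq, true_and]; omega
    have e4 : topSlice g l (w ++ [topSlice h (l + g.src + d) w]) = ⟨l, g, d + h.tgt + r⟩ := by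
      simp only [topSlice, topWidth_concat, hm.topWidth_eq, Slice.mk.injEq, true_and]; omega
    rw [e2, e4, e1, e3]
    have := sum_cls_eq_zero (LocalRel.move (Move.interchange g h l d r)) (A := w) (B := [])
      (hs := holesOf w ++ holesOf [⟨0, g, 0⟩, ⟨0, h, 0⟩]) (m := l + g.tgt + d + h.tgt + r) (by
        intro q hq
        simp only [List.mem_cons, List.not_mem_nil, or_false] at hq
        rcases hq with rfl | rfl
        · refine ⟨?_, by simp only [holesOf_append]; cases g <;> cases h <;> simp [holesOf, Piece.hole?]⟩
          rw [List.append_nil]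
          refine hm.append ?_
          simp only [IsTangle, and_true]; omega
        · refine ⟨?_, by rw [hgh]; simp only [holesOf_append]; cases g <;> cases h <;> simp [holesOf, Piece.hole?]⟩
          rw [List.append_nil]
          refine hm.append ?_
          simp only [IsTangle]; omega)
    simp only [List.map_cons, List.map_nil, List.sum_cons, List.sum_nil, one_smul, neg_smul,
      add_zero, List.append_nil] at this
    simp only [List.append_assoc, List.singleton_append]
    exact sub_eq_zero.1 (by rw [sub_eq_add_neg]; exact this)
  · rw [cls_eq_zero, cls_eq_zero]
    · intro m hm
      obtain ⟨k, h1, h2⟩ := hm.split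
      obtain ⟨k', h3, h4⟩ := h1.split
      have hk' := h3.topWidth_eq
      simp only [IsTangle, topSlice, topWidth_concat] at h2 h4
      exact hv ⟨k', h3, by omega⟩
    · intro m hm
      obtain ⟨k, h1, h2⟩ := hm.split
      obtain ⟨k', h3, h4⟩ := h1.split
      have hk' := h3.topWidth_eq
      simp only [IsTangle, topSlice, topWidth_concat] at h2 h4
      exact hv ⟨k', h3, by omega⟩

/-- Gluing a minimum on top. -/
abbrev cupO {n : ℕ} (l : ℕ) : Module.End ℂ (OpenSkein n) := op .cup l
/-- Gluing a maximum on top. -/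
abbrev capO {n : ℕ} (l : ℕ) : Module.End ℂ (OpenSkein n) := op .cap l
/-- Gluing a hole on top. -/
abbrev holeO {n : ℕ} (j : Fin n) (l : ℕ) : Module.End ℂ (OpenSkein n) := op (.hole j) l

/-! ### Relations between the gluing operators -/

section operators

variable {n : ℕ} {hs : List (Fin n)} {m l k : ℕ} {x : OpenSkein n}

theorem cup_mem (hl : l ≤ m) (hx : x ∈ tangles hs m) : cupO l x ∈ tangles hs (m + 2) := by
  simpa [holesOf, Piece.hole?, Piece.tgt, Piece.src] using op_mem_tangles .cup l hl hx

theorem cap_mem (hl : l ≤ m) (hx : x ∈ tangles hs (m + 2)) : capO l x ∈ tangles hs m := by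
  simpa [holesOf, Piece.hole?, Piece.tgt, Piece.src] using
    op_mem_tangles .cap l (show l + 2 ≤ m + 2 by omega) hx

theorem hole_mem (j : Fin n) (hl : l ≤ m) (hx : x ∈ tangles hs m) :
    holeO j l x ∈ tangles (hs ++ [j]) m := by
  simpa [holesOf, Piece.hole?, Piece.tgt, Piece.src] using op_mem_tangles (.hole j) l hl hx

theorem cup_cup (h : l ≤ k) (x : OpenSkein n) :
    cupO (k + 2) (cupO l x) = cupO l (cupO k x) := by
  obtain ⟨d, rfl⟩ := Nat.exists_eq_add_of_le h
  have := LinearMap.congr_fun (op_interchange (n := n) .cup .cup l d rfl) x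
  simp only [Piece.src, Piece.tgt, Nat.add_zero, Module.End.mul_apply,
    Nat.add_right_comm l 2 d] at this
  exact this

theorem cap_cap (h : l ≤ k) (x : OpenSkein n) :
    capO k (capO l x) = capO l (capO (k + 2) x) := by
  obtain ⟨d, rfl⟩ := Nat.exists_eq_add_of_le h
  have := LinearMap.congr_fun (op_interchange (n := n) .cap .cap l d rfl) x
  simp only [Piece.src, Piece.tgt, Nat.add_zero, Module.End.mul_apply,
    Nat.add_right_comm l 2 d] at this
  exact this

theorem cap_cup_of_le (h : l ≤ k) (x : OpenSkein n) :
    capO (k + 2) (cupO l x) = cupO l (capO k x) := by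
  obtain ⟨d, rfl⟩ := Nat.exists_eq_add_of_le h
  have := LinearMap.congr_fun (op_interchange (n := n) .cup .cap l d rfl) x
  simp only [Piece.src, Piece.tgt, Nat.add_zero, Module.End.mul_apply,
    Nat.add_right_comm l 2 d] at this
  exact this

theorem cap_cup_of_ge (h : l ≤ k) (x : OpenSkein n) :
    capO l (cupO (k + 2) x) = cupO k (capO l x) := by
  obtain ⟨d, rfl⟩ := Nat.exists_eq_add_of_le h
  have := LinearMap.congr_fun (op_interchange (n := n) .cap .cup l d rfl) x
  simp only [Piece.src, Piece.tgt, Nat.add_zero, Module.End.mul_apply,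
    Nat.add_right_comm l 2 d] at this
  exact this.symm

theorem hole_cup_of_le (j : Fin n) (h : l ≤ k) (x : OpenSkein n) :
    holeO j (k + 2) (cupO l x) = cupO l (holeO j k x) := by
  obtain ⟨d, rfl⟩ := Nat.exists_eq_add_of_le h
  have := LinearMap.congr_fun (op_interchange (n := n) .cup (.hole j) l d rfl) x
  simp only [Piece.src, Piece.tgt, Nat.add_zero, Module.End.mul_apply,
    Nat.add_right_comm l 2 d] at this
  exact this

theorem hole_cap_of_le (j : Fin n) (h : l ≤ k) (x : OpenSkein n) :
    holeO j k (capO l x) = capO l (holeO j (k + 2) x) := by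
  obtain ⟨d, rfl⟩ := Nat.exists_eq_add_of_le h
  have := LinearMap.congr_fun (op_interchange (n := n) .cap (.hole j) l d rfl) x
  simp only [Piece.src, Piece.tgt, Nat.add_zero, Module.End.mul_apply,
    Nat.add_right_comm l 2 d] at this
  exact this

theorem hole_cup_of_ge (j : Fin n) (h : l ≤ k) (x : OpenSkein n) :
    holeO j l (cupO k x) = cupO k (holeO j l x) := by
  obtain ⟨d, rfl⟩ := Nat.exists_eq_add_of_le h
  have := LinearMap.congr_fun (op_interchange (n := n) (.hole j) .cup l d rfl) x
  simp only [Piece.src, Piece.tgt, Nat.add_zero, Module.End.mul_apply] at this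
  exact this.symm

theorem hole_cap_of_ge (j : Fin n) (h : l ≤ k) (x : OpenSkein n) :
    holeO j l (capO k x) = capO k (holeO j l x) := by
  obtain ⟨d, rfl⟩ := Nat.exists_eq_add_of_le h
  have := LinearMap.congr_fun (op_interchange (n := n) (.hole j) .cap l d rfl) x
  simp only [Piece.src, Piece.tgt, Nat.add_zero, Module.End.mul_apply] at this
  exact this.symm

theorem cap_succ_cup (hl : l + 1 ≤ m) (hx : x ∈ tangles hs m) : capO (l + 1) (cupO l x) = x := by
  refine eqOn_tangles (f := capO (l + 1) * cupO l) (g := 1) (fun w hw => ?_) hx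
  have hm := hw.isTangle
  obtain ⟨r, rfl⟩ := Nat.exists_eq_add_of_le hl
  have := sum_cls_eq_zero (LocalRel.move (Move.zigzag_left (n := n) l r)) (A := w) (B := [])
      (hs := hs) (m := l + 1 + r) (by
        intro q hq
        simp only [List.mem_cons, List.not_mem_nil, or_false] at hq
        rcases hq with rfl | rfl
        · refine ⟨?_, by simp [holesOf_append, hw.2]; simp [holesOf, Piece.hole?]⟩
          rw [List.append_nil]
          refine hm.append ?_
          simp only [IsTangle, Piece.src, Piece.tgt, and_true]; omega
        · simpa using hw)
  simp only [List.map_cons, List.map_nil, List.sum_cons, List.sum_nil, one_smul, neg_smul,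
      add_zero, List.append_nil] at this
  rw [Module.End.mul_apply, Module.End.one_apply, op_cls_eq (r := r + 1), op_cls_eq (r := r),
    List.append_assoc, List.singleton_append]
  · exact sub_eq_zero.1 (by rw [sub_eq_add_neg]; exact this)
  · simp only [topWidth_concat, Piece.src, Piece.tgt]; omega
  · simp only [hm.topWidth_eq, Piece.src]; omega

theorem cap_cup_succ (hl : l + 1 ≤ m) (hx : x ∈ tangles hs m) : capO l (cupO (l + 1) x) = x := by
  refine eqOn_tangles (f := capO l * cupO (l + 1)) (g := 1) (fun w hw => ?_) hx
  have hm := hw.isTangle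
  obtain ⟨r, rfl⟩ := Nat.exists_eq_add_of_le hl
  have := sum_cls_eq_zero (LocalRel.move (Move.zigzag_right (n := n) l r)) (A := w) (B := [])
      (hs := hs) (m := l + 1 + r) (by
        intro q hq
        simp only [List.mem_cons, List.not_mem_nil, or_false] at hq
        rcases hq with rfl | rfl
        · refine ⟨?_, by simp [holesOf_append, hw.2]; simp [holesOf, Piece.hole?]⟩
          rw [List.append_nil]
          refine hm.append ?_
          simp only [IsTangle, Piece.src, Piece.tgt, true_and]; omega
        · simpa using hw)
  simp only [List.map_cons, List.map_nil, List.sum_cons, List.sum_nil, one_smul, neg_smul,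
      add_zero, List.append_nil] at this
  rw [Module.End.mul_apply, Module.End.one_apply, op_cls_eq (r := r), op_cls_eq (r := r + 1),
    List.append_assoc, List.singleton_append]
  · exact sub_eq_zero.1 (by rw [sub_eq_add_neg]; exact this)
  · simp only [topWidth_concat, Piece.src, Piece.tgt]; omega
  · simp only [hm.topWidth_eq, Piece.src]

theorem cap_cup_self (hl : l ≤ m) (hx : x ∈ tangles hs m) :
    capO l (cupO l x) = (-2 : ℂ) • x := by
  refine eqOn_tangles (f := capO l * cupO l) (g := (-2 : ℂ) • 1) (fun w hw => ?_) hx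
  have hm := hw.isTangle
  obtain ⟨r, rfl⟩ := Nat.exists_eq_add_of_le hl
  have := sum_cls_eq_zero (LocalRel.circle (n := n) l r) (A := w) (B := [])
      (hs := hs) (m := l + r) (by
        intro q hq
        simp only [List.mem_cons, List.not_mem_nil, or_false] at hq
        rcases hq with rfl | rfl
        · refine ⟨?_, by simp [holesOf_append, hw.2]; simp [holesOf, Piece.hole?]⟩
          rw [List.append_nil]
          refine hm.append ?_
          simp only [IsTangle, Piece.src, Piece.tgt, true_and]; omega
        · simpa using hw)
  simp only [List.map_cons, List.map_nil, List.sum_cons, List.sum_nil, one_smul,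
      add_zero, List.append_nil] at this
  rw [Module.End.mul_apply, op_cls_eq (r := r), op_cls_eq (r := r), List.append_assoc,
    List.singleton_append, LinearMap.smul_apply, Module.End.one_apply, neg_smul]
  · exact eq_neg_of_add_eq_zero_left this
  · simp only [topWidth_concat, Piece.src, Piece.tgt]
  · simp only [hm.topWidth_eq, Piece.src]; omega

/-- At A = -1 both smoothings have the same coefficient, so over- and undercrossings have the same
class and crossings can be eliminated. -/
theorem cross_eq (c : Bool) (hl : l + 2 ≤ m) (hx : x ∈ tangles hs m) :
    op (.cross c) l x = -x - cupO l (capO l x) := by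
  refine eqOn_tangles (f := op (.cross c) l) (g := -1 - cupO l * capO l) (fun w hw => ?_) hx
  have hm := hw.isTangle
  obtain ⟨r, rfl⟩ := Nat.exists_eq_add_of_le hl
  have := sum_cls_eq_zero (LocalRel.cross (n := n) c l r) (A := w) (B := [])
      (hs := hs) (m := l + 2 + r) (by
        intro q hq
        simp only [List.mem_cons, List.not_mem_nil, or_false] at hq
        rcases hq with rfl | rfl | rfl
        · refine ⟨?_, by simp [holesOf_append, hw.2]; simp [holesOf, Piece.hole?]⟩
          rw [List.append_nil]
          refine hm.append ?_
          simp only [IsTangle, Piece.src, Piece.tgt, and_self]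
        · simpa using hw
        · refine ⟨?_, by simp [holesOf_append, hw.2]; simp [holesOf, Piece.hole?]⟩
          rw [List.append_nil]
          refine hm.append ?_
          simp only [IsTangle, Piece.src, Piece.tgt, and_self])
  simp only [List.map_cons, List.map_nil, List.sum_cons, List.sum_nil, one_smul,
      add_zero, List.append_nil] at this
  rw [LinearMap.sub_apply, LinearMap.neg_apply, Module.End.mul_apply, Module.End.one_apply,
    op_cls_eq (r := r), op_cls_eq (r := r), op_cls_eq (r := r), List.append_assoc,
    List.singleton_append, ← neg_add']
  · exact eq_neg_of_add_eq_zero_left this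
  · simp only [topWidth_concat, Piece.src, Piece.tgt]
  · simp only [hm.topWidth_eq, Piece.src]
  · simp only [hm.topWidth_eq, Piece.src]

end operators

end

section

/-! ### The evaluation of skeins -/

/-- A local relation is checked on the tensor produced by the lower context `A`; the upper context
`B` acts linearly on the result. Equality of the holes of all terms is what the interchange move
requires. -/
theorem sum_wordT_eq_zero {n : ℕ} (Y : Fin n → SL) {ts : List (ℂ × List (Slice n))}
    (h : LocalRel ts) {A B : List (Slice n)} {hs : List (Fin n)}
    (hv : ∀ q ∈ ts, holesOf (A ++ q.2 ++ B) = hs) (t : Tensor) :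
    (ts.map fun q => q.1 • wordT Y (A ++ q.2 ++ B) t).sum = 0 := by
  have key : (ts.map fun q => q.1 • wordT Y q.2 (wordT Y A t)).sum = 0 := by
    generalize wordT Y A t = t
    cases h with
    | @move u v h =>
      have e : holesOf u = holesOf v := by
        have h1 := hv (1, u) (by simp)
        have h2 := hv (-1, v) (by simp)
        rw [← h2] at h1
        simpa [holesOf_append] using h1
      simp [wordT_move Y h e]
    | cross c l r => simp [wordT_cons, wordT_nil, pieceT, crossT_eq]
    | circle l r => simp [wordT_cons, wordT_nil, pieceT, capT_cupT_self]
  rw [← map_zero (wordT Y B), ← key, map_list_sum, List.map_map]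
  congr 1
  refine List.map_congr_left fun q _ => ?_
  simp [wordT_append]

open Classical in
/-- The evaluation of open skeins. -/
def evalO {n : ℕ} (Y : Fin n → SL) : OpenSkein n →ₗ[ℂ] Tensor :=
  -- The constant tensor 1 is the value of the empty tangle. Indices that are not strands are
  -- dummies on which the value of a tangle does not depend.
  OpenSkein.lift (fun w => if ∃ m, IsTangle 0 w m then wordT Y w 1 else 0)
    (fun w hw => if_neg (by rintro ⟨m, h⟩; exact hw m h))
    (fun ts A B hs m h hv => by
      rw [← sum_wordT_eq_zero Y h (fun q hq => (hv q hq).2) 1]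
      congr 1
      refine List.map_congr_left fun q hq => ?_
      rw [if_pos ⟨m, (hv q hq).1⟩])

theorem evalO_cls {n : ℕ} (Y : Fin n → SL) {w : List (Slice n)} {m : ℕ} (h : IsTangle 0 w m) :
    evalO Y (cls w) = wordT Y w 1 := by
  rw [evalO, OpenSkein.lift_cls, if_pos ⟨m, h⟩]

theorem evalO_op {n : ℕ} (Y : Fin n → SL) {hs : List (Fin n)} {m : ℕ} (g : Piece n) (l : ℕ)
    (hl : l + g.src ≤ m) {x : OpenSkein n} (hx : x ∈ tangles hs m) :
    evalO Y (op g l x) = pieceT Y g l (evalO Y x) := by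
  refine eqOn_tangles (f := evalO Y ∘ₗ op g l) (g := pieceT Y g l ∘ₗ evalO Y)
    (fun w hw => ?_) hx
  have h2 : IsTangle m [(⟨l, g, m - (l + g.src)⟩ : Slice n)] (l + g.tgt + (m - (l + g.src))) := by
    refine ⟨?_, rfl⟩
    change m = l + g.src + (m - (l + g.src)); omega
  rw [LinearMap.comp_apply, LinearMap.comp_apply, evalO_cls Y hw.1,
    op_cls_eq (r := m - (l + g.src)) (by rw [hw.1.topWidth_eq]; omega),
    evalO_cls Y (hw.1.append h2), wordT_append]
  rfl

section

variable {n : ℕ} (Y : Fin n → SL) {hs : List (Fin n)} {m l : ℕ} {x : OpenSkein n}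

theorem evalO_cup (hl : l ≤ m) (hx : x ∈ tangles hs m) :
    evalO Y (cupO l x) = cupT l (evalO Y x) := evalO_op Y .cup l hl hx

theorem evalO_cap (hl : l ≤ m) (hx : x ∈ tangles hs (m + 2)) :
    evalO Y (capO l x) = capT l (evalO Y x) :=
  evalO_op Y .cap l (show l + 2 ≤ m + 2 by omega) hx

theorem evalO_hole (j : Fin n) (hl : l ≤ m) (hx : x ∈ tangles hs m) :
    evalO Y (holeO j l x) = holeT (Y j).1 l (evalO Y x) := evalO_op Y (.hole j) l hl hx

end

theorem pieceT_congr {n : ℕ} {Y Y' : Fin n → SL} {s : Slice n}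
    (h : ∀ j ∈ holesOf [s], Y j = Y' j) : pieceT Y s.piece s.left = pieceT Y' s.piece s.left := by
  obtain ⟨l, g, r⟩ := s
  cases g with
  | hole j => simp only [pieceT]; rw [h j (by simp [holesOf, Piece.hole?])]
  | _ => rfl

theorem wordT_congr {n : ℕ} {Y Y' : Fin n → SL} {w : List (Slice n)}
    (h : ∀ j ∈ holesOf w, Y j = Y' j) : wordT Y w = wordT Y' w := by
  induction w with
  | nil => rfl
  | cons s w ih =>
    have e : holesOf (s :: w) = holesOf [s] ++ holesOf w := holesOf_append [s] w
    rw [e] at h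
    rw [wordT, wordT, ih fun j hj => h j (List.mem_append_right _ hj),
      pieceT_congr fun j hj => h j (List.mem_append_left _ hj)]

/-- This allows the matrix of the last hole to vary freely while the values of the tangles below it
stay fixed. -/
theorem evalO_congr {n : ℕ} {Y Y' : Fin n → SL} {hs : List (Fin n)} {m : ℕ}
    (h : ∀ j ∈ hs, Y j = Y' j) {x : OpenSkein n} (hx : x ∈ tangles hs m) :
    evalO Y x = evalO Y' x :=
  eqOn_tangles (fun w hw => by
    rw [evalO_cls Y hw.1, evalO_cls Y' hw.1, wordT_congr fun j hj => h j (hw.2 ▸ hj)]) hx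

/-! ### Closed skeins -/

/-- The value of a link diagram. -/
def Diagram.eval {n : ℕ} (Y : Fin n → SL) (D : Diagram n) : ℂ := wordT Y D.word 1 0

theorem Diagram.eval_step {n : ℕ} (Y : Fin n → SL) {D D' : Diagram n} (h : D.Step D') :
    D.eval Y = D'.eval Y := by
  obtain ⟨A, B, u, v, hm, h1, h2⟩ := h
  have := congr_fun (sum_wordT_eq_zero Y (LocalRel.move hm) (A := A) (B := B)
    (hs := List.finRange n) (by
      intro q hq
      simp only [List.mem_cons, List.not_mem_nil, or_false] at hq
      rcases hq with rfl | rfl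
      · exact h1 ▸ D.holes
      · exact h2 ▸ D'.holes) 1) 0
  simp only [List.map_cons, List.map_nil, List.sum_cons, List.sum_nil, one_smul, neg_smul,
    add_zero, Pi.add_apply, Pi.neg_apply, Pi.zero_apply] at this
  rw [Diagram.eval, Diagram.eval, h1, h2]
  exact sub_eq_zero.1 (by rw [sub_eq_add_neg]; exact this)

/-- Forgets which smoothing is L₀ and which is L∞; this is harmless at A = -1. -/
theorem SkeinRelated.localRel {n : ℕ} {D D₀ D' : Diagram n} (h : SkeinRelated D D₀ D') :
    ∃ A B l r c, D.word = A ++ [⟨l, .cross c, r⟩] ++ B ∧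
      (D₀.word = A ++ [] ++ B ∧ D'.word = A ++ [⟨l, .cap, r⟩, ⟨l, .cup, r⟩] ++ B ∨
        D'.word = A ++ [] ++ B ∧ D₀.word = A ++ [⟨l, .cap, r⟩, ⟨l, .cup, r⟩] ++ B) := by
  obtain ⟨A, B, l, r, ⟨h1, h2, h3⟩ | ⟨h1, h2, h3⟩⟩ := h
  · exact ⟨A, B, l, r, true, h1, Or.inl ⟨by simpa using h2, h3⟩⟩
  · exact ⟨A, B, l, r, false, h1, Or.inr ⟨by simpa using h3, h2⟩⟩

/-- The value of a framed link. -/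
def FramedLink.eval {n : ℕ} (Y : Fin n → SL) : FramedLink n → ℂ :=
  Quot.lift (Diagram.eval Y) fun _ _ h => Diagram.eval_step Y h

theorem FramedLink.eval_link {n : ℕ} (Y : Fin n → SL) (D : Diagram n) :
    D.link.eval Y = D.eval Y := rfl

/-- The evaluation of the skein module of the handlebody. -/
def evalV {n : ℕ} (Y : Fin n → SL) : V n →ₗ[ℂ] ℂ :=
  (skeinSubmodule n (-1)).liftQ
    (Finsupp.linearCombination ℂ (FramedLink.eval Y))
    (by
      rw [skeinSubmodule, Submodule.span_le]
      rintro x (⟨D, D₀, D', h, rfl⟩ | ⟨D, D', ⟨A, B, l, r, h1, h2⟩, rfl⟩)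
      · obtain ⟨A, B, l, r, c, h1, h⟩ := h.localRel
        have key : D.eval Y + D₀.eval Y + D'.eval Y = 0 := by
          have hD := D.holes
          rw [h1] at hD
          have := congr_fun (sum_wordT_eq_zero Y (LocalRel.cross c l r) (A := A) (B := B)
            (hs := List.finRange n) (by
              intro q hq
              simp only [List.mem_cons, List.not_mem_nil, or_false] at hq
              rw [← hD]
              rcases hq with rfl | rfl | rfl <;> simp [holesOf, Piece.hole?]) 1) 0
          simp only [List.map_cons, List.map_nil, List.sum_cons, List.sum_nil, one_smul,
            add_zero, Pi.add_apply, Pi.zero_apply] at this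
          simp only [Diagram.eval, h1]
          rcases h with ⟨h2, h3⟩ | ⟨h2, h3⟩ <;> rw [h2, h3]
          · rw [add_assoc]; exact this
          · rw [add_assoc, add_comm (wordT Y (A ++ [_, _] ++ B) 1 0)]; exact this
        simp only [SetLike.mem_coe, LinearMap.mem_ker, map_sub, map_smul,
          Finsupp.linearCombination_single, FramedLink.eval_link, smul_eq_mul]
        rw [show (-1 : ℂ)⁻¹ = -1 by norm_num]
        linear_combination key
      · have key : D'.eval Y + 2 * D.eval Y = 0 := by
          have hD := D'.holes
          rw [h2] at hD
          have := congr_fun (sum_wordT_eq_zero Y (LocalRel.circle l r) (A := A) (B := B)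
            (hs := List.finRange n) (by
              intro q hq
              simp only [List.mem_cons, List.not_mem_nil, or_false] at hq
              rw [← hD]
              rcases hq with rfl | rfl <;> simp [holesOf, Piece.hole?]) 1) 0
          simp only [List.map_cons, List.map_nil, List.sum_cons, List.sum_nil, one_smul,
            add_zero, Pi.add_apply, Pi.zero_apply, Pi.smul_apply, smul_eq_mul,
            List.append_nil] at this
          simp only [Diagram.eval, h1, h2]
          exact this
        simp only [SetLike.mem_coe, LinearMap.mem_ker, map_add, map_smul,
          Finsupp.linearCombination_single, FramedLink.eval_link, smul_eq_mul]
        rw [show (-1 : ℂ)⁻¹ = -1 by norm_num]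
        linear_combination key)

@[simp] theorem evalV_toV {n : ℕ} (Y : Fin n → SL) (D : Diagram n) :
    evalV Y D.toV = D.eval Y := by
  simp [evalV, Diagram.toV, FramedLink.eval_link]

theorem toV_eq_of_step {n : ℕ} {D D' : Diagram n} (h : D.Step D') : D.toV = D'.toV := by
  rw [Diagram.toV, Diagram.toV, show D.link = D'.link from Quot.sound h]

theorem toV_skein {n : ℕ} {D D₀ D' : Diagram n} (h : SkeinRelated D D₀ D') :
    D.toV + D₀.toV + D'.toV = 0 := by
  have : (skeinSubmodule n (-1)).mkQ (Finsupp.single D.link 1 - (-1 : ℂ) • Finsupp.single D₀.link 1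
          - (-1 : ℂ)⁻¹ • Finsupp.single D'.link 1) = 0 :=
    (Submodule.Quotient.mk_eq_zero _).2 (Submodule.subset_span (Or.inl ⟨D, D₀, D', h, rfl⟩))
  rw [map_sub, map_sub, map_smul, map_smul, show (-1 : ℂ)⁻¹ = -1 by norm_num] at this
  rw [← this]
  simp only [Diagram.toV]
  module

theorem toV_circle {n : ℕ} {D D' : Diagram n} (h : AddsUnknot D D') :
    D'.toV + (2 : ℂ) • D.toV = 0 := by
  have : (skeinSubmodule n (-1)).mkQ (Finsupp.single D'.link 1 +
      ((-1 : ℂ) ^ 2 + (-1 : ℂ)⁻¹ ^ 2) • Finsupp.single D.link 1) = 0 :=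
    (Submodule.Quotient.mk_eq_zero _).2 (Submodule.subset_span (Or.inr ⟨D, D', h, rfl⟩))
  rw [map_add, map_smul, show (-1 : ℂ) ^ 2 + (-1 : ℂ)⁻¹ ^ 2 = 2 by norm_num] at this
  exact this

open Classical in
/-- The class in `V(H)` of a stack of slices, which is zero if this is not a diagram. -/
def wordV {n : ℕ} (w : List (Slice n)) : V n :=
  if h : Valid (List.finRange n) 0 w then Diagram.toV ⟨w, h.1, h.2⟩ else 0

theorem wordV_word {n : ℕ} (D : Diagram n) : wordV D.word = D.toV :=
  dif_pos (show Valid _ _ _ from ⟨D.closed, D.holes⟩)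

theorem wordV_eq_zero {n : ℕ} {w : List (Slice n)} (h : ¬ Valid (List.finRange n) 0 w) :
    wordV w = 0 := dif_neg h

/-- The map from open skeins to the skein module of the handlebody. -/
def closedSkein (n : ℕ) : OpenSkein n →ₗ[ℂ] V n :=
  OpenSkein.lift wordV
    (fun w hw => wordV_eq_zero fun h => hw 0 h.1)
    (fun ts A B hs m h hv => by
      -- A relation involves actual diagrams only if its terms have no endpoints and meet all holes
      -- in order; in any other case every term is sent to zero.
      by_cases hc : hs = List.finRange n ∧ m = 0
      · obtain ⟨rfl, rfl⟩ := hc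
        have hD : ∀ q ∈ ts, ∃ D : Diagram n, D.word = A ++ q.2 ++ B := fun q hq =>
          ⟨⟨_, (hv q hq).1, (hv q hq).2⟩, rfl⟩
        cases h with
        | @move u v h =>
          obtain ⟨D, h1⟩ := hD (1, u) (by simp)
          obtain ⟨D', h2⟩ := hD (-1, v) (by simp)
          simp only [List.map_cons, List.map_nil, List.sum_cons, List.sum_nil, ← h1, ← h2,
            wordV_word, toV_eq_of_step ⟨A, B, u, v, h, h1, h2⟩]
          simp
        | cross c l r =>
          obtain ⟨D, h1⟩ := hD (1, [⟨l, .cross c, r⟩]) (by simp)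
          obtain ⟨D₀, h2⟩ := hD (1, []) (by simp)
          obtain ⟨D', h3⟩ := hD (1, [⟨l, .cap, r⟩, ⟨l, .cup, r⟩]) (by simp)
          simp only [List.map_cons, List.map_nil, List.sum_cons, List.sum_nil, ← h1, ← h2, ← h3,
            wordV_word, one_smul, add_zero]
          cases c with
          | true =>
            rw [← add_assoc]
            exact toV_skein ⟨A, B, l, r, Or.inl ⟨h1, by simpa using h2, h3⟩⟩
          | false =>
            rw [add_comm D₀.toV, ← add_assoc]
            exact toV_skein ⟨A, B, l, r, Or.inr ⟨h1, h3, by simpa using h2⟩⟩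
        | circle l r =>
          obtain ⟨D', h1⟩ := hD (1, [⟨l, .cup, r⟩, ⟨l, .cap, r⟩]) (by simp)
          obtain ⟨D, h2⟩ := hD (2, []) (by simp)
          simp only [List.map_cons, List.map_nil, List.sum_cons, List.sum_nil, ← h1, ← h2,
            wordV_word, one_smul, add_zero]
          exact toV_circle ⟨A, B, l, r, by simpa using h2, h1⟩
      · refine List.sum_eq_zero fun x hx => ?_
        obtain ⟨q, hq, rfl⟩ := List.mem_map.1 hx
        rw [wordV_eq_zero, smul_zero]
        rintro ⟨h1, h2⟩
        exact hc ⟨(hv q hq).2.symm.trans h2,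
          (hv q hq).1.topWidth_eq.symm.trans h1.topWidth_eq⟩)

theorem closedSkein_cls {n : ℕ} (D : Diagram n) : closedSkein n (cls D.word) = D.toV := by
  rw [closedSkein, OpenSkein.lift_cls, wordV_word]

end

section

/-! ### Tangles without holes -/

/-- `CupSkein m β x`: `x` is the class of a stack of minima with `m` endpoints, and `β` is `0` at the
left and `1` at the right ends of its arcs. -/
inductive CupSkein {n : ℕ} : ℕ → (ℕ → Fin 2) → OpenSkein n → Prop
  | nil : CupSkein 0 0 (cls [])
  | cup {m : ℕ} {β : ℕ → Fin 2} {x : OpenSkein n} (h : CupSkein m β x) (l : ℕ) (hl : l ≤ m) :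
      CupSkein (m + 2) (insertTwo l 0 1 β) (cupO l x)

/-- The span of the stacks of minima with `m` endpoints. -/
def cupSpan (n m : ℕ) : Submodule ℂ (OpenSkein n) :=
  Submodule.span ℂ {x | ∃ β, CupSkein m β x}

variable {n : ℕ}

theorem CupSkein.mem_tangles {m : ℕ} {β : ℕ → Fin 2} {x : OpenSkein n} (h : CupSkein m β x) :
    x ∈ tangles [] m := by
  induction h with
  | nil => exact cls_mem_tangles ⟨rfl, rfl⟩
  | cup h l hl ih => exact cup_mem hl ih

theorem CupSkein.mem_cupSpan {m : ℕ} {β : ℕ → Fin 2} {x : OpenSkein n} (h : CupSkein m β x) :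
    x ∈ cupSpan n m := Submodule.subset_span ⟨β, h⟩

theorem cup_mem_cupSpan {m l : ℕ} {x : OpenSkein n} (hx : x ∈ cupSpan n m) (hl : l ≤ m) :
    cupO l x ∈ cupSpan n (m + 2) := by
  have : cupSpan n m ≤ (cupSpan n (m + 2)).comap (cupO l) :=
    Submodule.span_le.2 (by rintro x ⟨β, h⟩; exact (h.cup l hl).mem_cupSpan)
  exact this hx

/-- The maximum meets the topmost minimum. If they share both strands a circle is removed, if they
share one strand a zigzag is straightened, and otherwise the maximum slides below the minimum and
the induction applies. -/
theorem CupSkein.cap_mem {m : ℕ} {β : ℕ → Fin 2} {x : OpenSkein n} (h : CupSkein m β x) :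
    ∀ l, l + 2 ≤ m → capO l x ∈ cupSpan n (m - 2) := by
  induction h with
  | nil => intro l hl; omega
  | @cup m β x h j hj ih =>
    intro l hl
    rw [Nat.add_sub_cancel]
    have hx := h.mem_tangles
    rcases Nat.lt_trichotomy l j with hlt | rfl | hlt
    · obtain ⟨d, rfl⟩ := Nat.exists_eq_add_of_lt hlt
      rcases d with _ | d
      · rw [Nat.add_zero, cap_cup_succ (by omega) hx]
        exact h.mem_cupSpan
      · have e : l + (d + 1) + 1 = l + d + 2 := by omega
        rw [e, cap_cup_of_ge (Nat.le_add_right l d)]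
        have := cup_mem_cupSpan (ih l (by omega)) (l := l + d) (by omega)
        rwa [show m - 2 + 2 = m by omega] at this
    · rw [cap_cup_self hj hx]
      exact Submodule.smul_mem _ _ h.mem_cupSpan
    · obtain ⟨d, rfl⟩ := Nat.exists_eq_add_of_lt hlt
      rcases d with _ | d
      · rw [Nat.add_zero, cap_succ_cup (by omega) hx]
        exact h.mem_cupSpan
      · have e : j + (d + 1) + 1 = j + d + 2 := by omega
        rw [e, cap_cup_of_le (Nat.le_add_right j d)]
        have := cup_mem_cupSpan (ih (j + d) (by omega)) (l := j) (by omega)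
        rwa [show m - 2 + 2 = m by omega] at this

theorem cap_mem_cupSpan {m l : ℕ} {x : OpenSkein n} (hx : x ∈ cupSpan n (m + 2)) (hl : l ≤ m) :
    capO l x ∈ cupSpan n m := by
  have : cupSpan n (m + 2) ≤ (cupSpan n m).comap (capO l) :=
    Submodule.span_le.2 (by rintro x ⟨β, h⟩; exact h.cap_mem l (by omega))
  exact this hx

/-- Crossings are resolved and maxima absorbed by the minima below them, so a planar matching
without closed components remains. -/
theorem tangles_nil_le_cupSpan (m : ℕ) : tangles (n := n) [] m ≤ cupSpan n m := by
  refine tangles_induction _ fun w hw => ?_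
  induction w using List.reverseRecOn generalizing m with
  | nil =>
    obtain ⟨h1, -⟩ := hw
    obtain rfl : 0 = m := h1
    exact CupSkein.nil.mem_cupSpan
  | append_singleton w s ih =>
    obtain ⟨hs', m', h1, h2, h3, h4, h5⟩ := cls_concat hw
    obtain ⟨h6, h7⟩ := List.append_eq_nil_iff.1 h4.symm
    subst h6
    have hx := ih m' h1
    rw [h5]
    obtain ⟨l, g, r⟩ := s
    cases g with
    | cup =>
      obtain rfl : m = m' + 2 := h3
      exact cup_mem_cupSpan hx h2
    | cap =>
      obtain rfl : m + 2 = m' := h3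
      exact cap_mem_cupSpan hx (Nat.le_of_add_le_add_right (show l + 2 ≤ m + 2 from h2))
    | cross c =>
      simp only [Piece.src, Piece.tgt] at h2 h3
      obtain rfl : m = m' := by omega
      rw [cross_eq c h2 (cls_mem_tangles h1)]
      obtain ⟨k, rfl⟩ := Nat.exists_eq_add_of_le' (show 2 ≤ m by omega)
      exact sub_mem (neg_mem hx) (cup_mem_cupSpan (cap_mem_cupSpan hx (by omega)) (by omega))
    | hole j => simp [holesOf, Piece.hole?] at h7

/-- `β` is a balanced bracket word, and an opening bracket next to a closing one is an arc between
neighbouring strands. Nothing separates its ends, so far commutation brings its minimum to the top.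
-/
theorem CupSkein.exists_eq_cup {m : ℕ} {β : ℕ → Fin 2} {x : OpenSkein n} (h : CupSkein m β x) :
    ∀ i, i + 2 ≤ m → β i = 0 → β (i + 1) = 1 →
      ∃ z, CupSkein (m - 2) (fun k => β (insertPos i k)) z ∧ x = cupO i z := by
  induction h with
  | nil => intro i hi; omega
  | @cup m β x h j hj ih =>
    intro i hi h0 h1
    rw [Nat.add_sub_cancel]
    rcases Nat.lt_trichotomy i j with hlt | rfl | hlt
    · obtain ⟨d, rfl⟩ := Nat.exists_eq_add_of_lt hlt
      rcases d with _ | d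
      · simp at h1
      · have e : i + (d + 1) + 1 = i + d + 2 := by omega
        rw [e] at *
        rw [insertTwo_of_lt _ _ _ (by omega)] at h0 h1
        obtain ⟨z, hz, rfl⟩ := ih i (by omega) h0 h1
        refine ⟨cupO (i + d) z, ?_, cup_cup (Nat.le_add_right i d) z⟩
        rw [insertTwo_comp_insertPos_of_ge (Nat.le_add_right i d)]
        have := hz.cup (i + d) (by omega)
        rwa [show m - 2 + 2 = m by omega] at this
    · exact ⟨x, by rwa [insertTwo_comp_insertPos], rfl⟩
    · obtain ⟨d, rfl⟩ := Nat.exists_eq_add_of_lt hlt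
      rcases d with _ | d
      · simp at h0
      · have e : j + (d + 1) + 1 = j + d + 2 := by omega
        rw [e] at *
        rw [insertTwo_of_le _ _ _ (by omega)] at h0 h1
        obtain ⟨z, hz, rfl⟩ := ih (j + d) (by omega) h0 h1
        refine ⟨cupO j z, ?_, (cup_cup (Nat.le_add_right j d) z).symm⟩
        rw [insertTwo_comp_insertPos_of_le (Nat.le_add_right j d)]
        have := hz.cup j (by omega)
        rwa [show m - 2 + 2 = m by omega] at this

/-- The bracket word determines the planar matching, and the order in which the minima are stacked
does not matter. -/
theorem CupSkein.unique {m : ℕ} {β : ℕ → Fin 2} {x y : OpenSkein n} (hx : CupSkein m β x)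
    (hy : CupSkein m β y) : x = y := by
  induction hx generalizing y with
  | nil => cases hy; rfl
  | cup h l hl ih =>
    obtain ⟨z, hz, rfl⟩ := hy.exists_eq_cup l (by omega) (by simp) (by simp)
    rw [insertTwo_comp_insertPos, Nat.add_sub_cancel] at hz
    rw [ih hz]

theorem CupSkein.evalO_self (Y : Fin n → SL) {m : ℕ} {β : ℕ → Fin 2} {x : OpenSkein n}
    (h : CupSkein m β x) : evalO Y x β = 1 := by
  induction h with
  | nil => rw [evalO_cls Y (show IsTangle 0 ([] : List (Slice n)) 0 from rfl)]; rfl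
  | cup h l hl ih =>
    rw [evalO_cup Y hl h.mem_tangles, cupT_apply, insertTwo_comp_insertPos, ih]
    simp [eps]

theorem CupSkein.eq_zero_of_lt {m : ℕ} {β : ℕ → Fin 2} {x : OpenSkein n} (h : CupSkein m β x) :
    ∀ i, m ≤ i → β i = 0 := by
  induction h with
  | nil => intro i _; rfl
  | cup h l hl ih =>
    intro i hi
    rw [insertTwo_of_le _ _ _ (by omega)]
    exact ih _ (by omega)

/-- An arc contributes `eps` at its two ends, so a nonzero coordinate puts different values there.
The word `β` puts 0 at every left end; any other choice raises some left end to 1, and at the first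
place of difference it is therefore larger. Thus `β` is the lexicographically first nonzero
coordinate. -/
theorem CupSkein.lex_of_evalO_ne_zero (Y : Fin n → SL) {m : ℕ} {β : ℕ → Fin 2} {x : OpenSkein n}
    (h : CupSkein m β x) : ∀ v : ℕ → Fin 2, (∀ i, m ≤ i → v i = 0) → evalO Y x v ≠ 0 →
      v = β ∨ ∃ i, (∀ j < i, β j = v j) ∧ β i < v i := by
  induction h with
  | nil => exact fun v hv _ => Or.inl (funext fun i => hv i (Nat.zero_le i))
  | @cup m β x h l hl ih =>
    intro v hv hne
    rw [evalO_cup Y hl h.mem_tangles, cupT_apply] at hne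
    have h1 := left_ne_zero_of_mul hne
    have h2 := ih _ (fun i hi => hv _ (by simp only [insertPos]; split_ifs <;> omega))
      (right_ne_zero_of_mul hne)
    -- The topmost arc either carries its values in `β`, so that the comparison is inherited from
    -- the rest, or it has 1 at its left end, so that `v` exceeds `β` at `l` unless it already does
    -- so earlier.
    have hcases : (v l = 0 ∧ v (l + 1) = 1) ∨ v l = 1 := by
      revert h1
      generalize v l = a
      generalize v (l + 1) = b
      fin_cases a <;> fin_cases b <;> simp [eps]
    have hlow : ∀ j < l, insertPos l j = j := fun j hj => by simp [insertPos, hj]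
    rcases h2 with h2 | ⟨i, h2, h3⟩
    · rcases hcases with ⟨h4, h5⟩ | h4
      · left
        rw [← h2, ← h4, ← h5, insertTwo_self]
      · refine Or.inr ⟨l, fun j hj => ?_, by simp [h4]⟩
        rw [insertTwo_of_lt _ _ _ hj, ← h2]
        simp only [hlow j hj]
    · right
      by_cases hi : i < l
      · refine ⟨i, fun j hj => ?_, ?_⟩
        · rw [insertTwo_of_lt _ _ _ (hj.trans hi), h2 j hj, hlow j (hj.trans hi)]
        · rw [insertTwo_of_lt _ _ _ hi]
          rwa [hlow i hi] at h3
      · rcases hcases with ⟨h4, h5⟩ | h4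
        · refine ⟨i + 2, fun j hj => ?_, ?_⟩
          · rcases Nat.lt_trichotomy j l with hjl | rfl | hjl
            · rw [insertTwo_of_lt _ _ _ hjl, h2 j (by omega), hlow j hjl]
            · simp [h4]
            · by_cases hj2 : j = l + 1
              · simp [hj2, h5]
              · rw [insertTwo_of_le _ _ _ (by omega), h2 _ (by omega)]
                congr 1
                simp only [insertPos]; split_ifs <;> omega
          · rw [insertTwo_of_le _ _ _ (by omega)]
            have : insertPos l i = i + 2 := by simp [insertPos, hi]
            rwa [this] at h3
        · refine ⟨l, fun j hj => ?_, by simp [h4]⟩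
          rw [insertTwo_of_lt _ _ _ hj, h2 j (by omega), hlow j hj]

/-- Skeins of tangles without holes are determined by their values. -/
theorem evalO_injective_of_nil (Y : Fin n → SL) {m : ℕ} {x : OpenSkein n}
    (hx : x ∈ tangles [] m) (h : evalO Y x = 0) : x = 0 := by
  classical
  let B : Set (ℕ → Fin 2) := {β | ∃ x : OpenSkein n, CupSkein m β x}
  -- By `CupSkein.unique` a bracket word has only one class, so the spanning set may be indexed by
  -- words.
  let c : (ℕ → Fin 2) → OpenSkein n := fun β =>
    if hβ : ∃ x : OpenSkein n, CupSkein m β x then hβ.choose else 0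
  have hc : ∀ β ∈ B, CupSkein m β (c β) := fun β hβ => by
    simp only [c]
    rw [dif_pos (show ∃ x : OpenSkein n, CupSkein m β x from hβ)]
    exact Exists.choose_spec (show ∃ x : OpenSkein n, CupSkein m β x from hβ)
  have hspan : x ∈ Submodule.span ℂ (c '' B) := by
    refine Submodule.span_mono ?_ (tangles_nil_le_cupSpan m hx)
    rintro y ⟨β, hy⟩
    exact ⟨β, ⟨y, hy⟩, (hc β ⟨y, hy⟩).unique hy⟩
  obtain ⟨a, ha, rfl⟩ := (Finsupp.mem_span_image_iff_linearCombination ℂ).1 hspan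
  rw [Finsupp.mem_supported] at ha
  by_cases hne : a = 0
  · simp [hne]
  exfalso
  -- At the lexicographically smallest word of the support only the vector of that word has a
  -- nonzero coordinate, and this coordinate is 1. So its coefficient would have to vanish.
  obtain ⟨β, hβ, hmin⟩ := a.support.exists_min_image toLex (Finsupp.support_nonempty_iff.2 hne)
  have h0 := congr_fun h β
  rw [Finsupp.linearCombination_apply, Finsupp.sum, map_sum, Finset.sum_apply,
    Finset.sum_eq_single β] at h0
  · rw [map_smul, Pi.smul_apply, (hc β (ha hβ)).evalO_self Y] at h0
    simp at h0
    exact (Finsupp.mem_support_iff.1 hβ) h0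
  · intro γ hγ hne'
    rw [map_smul, Pi.smul_apply]
    by_contra hcon
    have h1 : evalO Y (c γ) β ≠ 0 := fun h => hcon (by rw [h, smul_zero])
    rcases (hc γ (ha hγ)).lex_of_evalO_ne_zero Y β (hc β (ha hβ)).eq_zero_of_lt h1 with h2 | ⟨i, h2, h3⟩
    · exact hne' h2.symm
    · have : toLex γ < toLex β := ⟨i, h2, h3⟩
      exact absurd (hmin γ hγ) (not_le.2 this)
  · exact fun h' => absurd hβ h'

end

section

/-! ### Handles -/

variable {n : ℕ} {hs : List (Fin n)} {m p k l : ℕ} {x : OpenSkein n}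

/-- `k` nested maxima, with `p` strands on the left. -/
def nestCaps (p : ℕ) : ℕ → Module.End ℂ (OpenSkein n)
  | 0 => 1
  | k + 1 => nestCaps p k * capO (p + k)

theorem nestCaps_succ (p k : ℕ) (x : OpenSkein n) :
    nestCaps p (k + 1) x = nestCaps p k (capO (p + k) x) := rfl

theorem nestCaps_succ_left (p k : ℕ) (x : OpenSkein n) :
    nestCaps p (k + 1) x = capO p (nestCaps (p + 1) k x) := by
  induction k generalizing x with
  | zero => rfl
  | succ k ih => rw [nestCaps_succ, ih, nestCaps_succ, add_right_comm, add_assoc p k 1]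

theorem nestCaps_mem (hp : p ≤ m) (hx : x ∈ tangles hs (m + 2 * k)) :
    nestCaps p k x ∈ tangles hs m := by
  induction k generalizing x with
  | zero => exact hx
  | succ k ih => exact ih (cap_mem (by omega) (by rwa [mul_add, ← add_assoc] at hx))

/-- `k` strands run over the `j`-th handle and return on the right of the hole, while `p` other
strands pass on its left. -/
def handle (j : Fin n) (p k : ℕ) : Module.End ℂ (OpenSkein n) := nestCaps p k * holeO j (p + k)

theorem handle_apply (j : Fin n) (p k : ℕ) (x : OpenSkein n) :
    handle j p k x = nestCaps p k (holeO j (p + k) x) := rfl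

theorem handle_mem (j : Fin n) (hp : p ≤ m) (hx : x ∈ tangles hs (m + 2 * k)) :
    handle j p k x ∈ tangles (hs ++ [j]) m :=
  nestCaps_mem hp (hole_mem j (by omega) hx)

theorem cup_nestCaps_of_le {i : ℕ} (h : i ≤ p) (x : OpenSkein n) :
    cupO i (nestCaps p k x) = nestCaps (p + 2) k (cupO i x) := by
  induction k generalizing x with
  | zero => rfl
  | succ k ih =>
    rw [nestCaps_succ, nestCaps_succ, ih, add_right_comm p 2 k, cap_cup_of_le (by omega)]

theorem cup_nestCaps_of_ge {i : ℕ} (h : p ≤ i) (x : OpenSkein n) :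
    cupO i (nestCaps p k x) = nestCaps p k (cupO (i + 2 * k) x) := by
  induction k generalizing x with
  | zero => rfl
  | succ k ih =>
    rw [nestCaps_succ, nestCaps_succ, ih, mul_add, ← add_assoc, mul_one,
      cap_cup_of_ge (by omega)]

theorem cap_nestCaps_of_ge {i : ℕ} (h : p ≤ i) (x : OpenSkein n) :
    capO i (nestCaps p k x) = nestCaps p k (capO (i + 2 * k) x) := by
  induction k generalizing x with
  | zero => rfl
  | succ k ih =>
    rw [nestCaps_succ, nestCaps_succ, ih, mul_add, ← add_assoc, mul_one,
      cap_cap (show p + k ≤ i + 2 * k by omega)]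

theorem cup_handle_of_le (j : Fin n) {i : ℕ} (h : i ≤ p) (x : OpenSkein n) :
    cupO i (handle j p k x) = handle j (p + 2) k (cupO i x) := by
  rw [handle_apply, handle_apply, cup_nestCaps_of_le h, add_right_comm p 2 k,
    hole_cup_of_le j (by omega)]

theorem cup_handle_of_ge (j : Fin n) {i : ℕ} (h : p ≤ i) (x : OpenSkein n) :
    cupO i (handle j p k x) = handle j p k (cupO (i + 2 * k) x) := by
  rw [handle_apply, handle_apply, cup_nestCaps_of_ge h, hole_cup_of_ge j (by omega)]

theorem cap_handle_of_ge (j : Fin n) {i : ℕ} (h : p ≤ i) (x : OpenSkein n) :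
    capO i (handle j p k x) = handle j p k (capO (i + 2 * k) x) := by
  rw [handle_apply, handle_apply, cap_nestCaps_of_ge h, hole_cap_of_ge j (by omega)]

/-- The skeins for which `k` strands run over the `j`-th handle, and no other strand passes on the
left of the hole. -/
def handleRange (hs : List (Fin n)) (j : Fin n) (m k : ℕ) : Submodule ℂ (OpenSkein n) :=
  (tangles hs (m + 2 * k)).map (handle j 0 k)

/-- A strand that passes on the left of the hole can be bent: it runs over the handle, comes down on
the right of the hole and turns up again. Doing this for all `p` strands leaves none passing on the
left. -/
theorem handle_mem_handleRange (j : Fin n) (hp : p ≤ m) (hx : x ∈ tangles hs (m + 2 * k)) :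
    handle j p k x ∈ handleRange hs j m (k + p) := by
  induction p generalizing k x with
  | zero => exact ⟨x, hx, rfl⟩
  | succ p ih =>
    -- A zigzag is inserted by `cap_cup_succ`. Its minimum slides below the handle, which shifts it
    -- past the `2 * k` strands of the maxima, and its maximum becomes the outermost of `k + 1`
    -- nested maxima.
    have e : handle j (p + 1) k x = handle j p (k + 1) (cupO (p + 1 + 2 * k) x) := by
      rw [handle_apply j p, nestCaps_succ_left, ← add_assoc p k 1, add_right_comm p k 1,
        ← handle_apply, ← cup_handle_of_ge j le_rfl,
        cap_cup_succ hp (handle_mem j hp hx)]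
    rw [e, ← add_assoc, add_right_comm]
    refine ih (by omega) ?_
    rw [mul_add, ← add_assoc]
    exact cup_mem (by omega) hx

/-- A circle has the nonzero value -2, so a skein is a multiple of itself with a circle added.
Stretching the circle past the left of the hole and bending both of its strands adds two strands to
the handle. -/
theorem handleRange_le_add_two (hs : List (Fin n)) (j : Fin n) (m k : ℕ) :
    handleRange hs j m k ≤ handleRange hs j m (k + 2) := by
  rintro _ ⟨x, hx, rfl⟩
  have h1 : cupO 0 x ∈ tangles hs (m + 2 + 2 * k) := by
    rw [add_right_comm]; exact cup_mem (Nat.zero_le _) hx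
  obtain ⟨z, hz, h2⟩ := handle_mem_handleRange j (show 2 ≤ m + 2 by omega) h1
  have h3 : (-2 : ℂ) • handle j 0 k x = handle j 0 (k + 2) (capO (0 + 2 * (k + 2)) z) := by
    rw [← cap_handle_of_ge j le_rfl, h2, ← Nat.zero_add 2, ← cup_handle_of_le j le_rfl,
      cap_cup_self (Nat.zero_le _) (handle_mem j (Nat.zero_le _) hx)]
  have h4 : handle j 0 k x = (-2 : ℂ)⁻¹ • handle j 0 (k + 2) (capO (0 + 2 * (k + 2)) z) := by
    rw [← h3, smul_smul, inv_mul_cancel₀ (by norm_num), one_smul]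
  rw [h4]
  refine Submodule.smul_mem _ _ ⟨_, ?_, rfl⟩
  exact cap_mem (by omega) (by rwa [add_right_comm] at hz)

/-- Whatever lies above the last hole slides below it on the right of the handle. The slice of the
hole itself is a handle without returning strands, and the strands on its left are bent over by
`handle_mem_handleRange`. -/
theorem tangles_concat_le (hs : List (Fin n)) (j : Fin n) (m : ℕ) :
    tangles (hs ++ [j]) m ≤ ⨆ k, handleRange hs j m k := by
  refine tangles_induction _ fun w hw => ?_
  induction w using List.reverseRecOn generalizing m with
  | nil =>
    have := hw.2
    simp [holesOf] at this
  | append_singleton w s ih =>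
    obtain ⟨hs', m', h1, h2, h3, h4, h5⟩ := cls_concat hw
    rw [h5]
    obtain ⟨l, g, r⟩ := s
    have hx : holesOf [(⟨l, g, r⟩ : Slice n)] = [] →
        cls w ∈ ⨆ k, handleRange hs j m' k := fun h => by
      rw [h, List.append_nil] at h4
      exact ih m' (by rwa [h4])
    have hlift : ∀ (f : Module.End ℂ (OpenSkein n)), holesOf [(⟨l, g, r⟩ : Slice n)] = [] →
        (∀ k, ∀ y ∈ tangles hs (m' + 2 * k), f (handle j 0 k y) ∈ handleRange hs j m k) →
        f (cls w) ∈ ⨆ k, handleRange hs j m k := by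
      intro f h hf
      have : ⨆ k, handleRange hs j m' k ≤ (⨆ k, handleRange hs j m k).comap f := by
        refine iSup_le fun k => ?_
        rintro _ ⟨y, hy, rfl⟩
        exact Submodule.mem_iSup_of_mem k (hf k y hy)
      exact this (hx h)
    have hcup : ∀ (l m k : ℕ), l ≤ m → ∀ y ∈ tangles hs (m + 2 * k),
        cupO l (handle j 0 k y) ∈ handleRange hs j (m + 2) k := by
      intro l m k hl y hy
      rw [cup_handle_of_ge j (Nat.zero_le _)]
      refine ⟨_, ?_, rfl⟩
      rw [add_right_comm]
      exact cup_mem (by omega) hy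
    have hcap : ∀ (l m k : ℕ), l ≤ m → ∀ y ∈ tangles hs (m + 2 + 2 * k),
        capO l (handle j 0 k y) ∈ handleRange hs j m k := by
      intro l m k hl y hy
      rw [cap_handle_of_ge j (Nat.zero_le _)]
      refine ⟨_, ?_, rfl⟩
      exact cap_mem (by omega) (by rwa [add_right_comm] at hy)
    cases g with
    | cup =>
      obtain rfl : m = m' + 2 := h3
      exact hlift _ rfl fun k y hy => hcup l m' k h2 y hy
    | cap =>
      obtain rfl : m + 2 = m' := h3
      exact hlift _ rfl fun k y hy =>
        hcap l m k (Nat.le_of_add_le_add_right (show l + 2 ≤ m + 2 from h2)) y hy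
    | cross c =>
      simp only [Piece.src, Piece.tgt] at h2 h3
      obtain rfl : m = m' := by omega
      refine hlift _ rfl fun k y hy => ?_
      rw [cross_eq c h2 (handle_mem j (Nat.zero_le _) hy)]
      obtain ⟨m, rfl⟩ := Nat.exists_eq_add_of_le' (show 2 ≤ m by omega)
      obtain ⟨z, hz, h⟩ := hcap l m k (by omega) y hy
      refine sub_mem (neg_mem ⟨y, hy, rfl⟩) ?_
      rw [← h]
      exact hcup l m k (by omega) z hz
    | hole i =>
      have h4' : hs ++ [j] = hs' ++ [i] := h4
      obtain ⟨rfl, h6⟩ := List.append_inj' h4' rfl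
      obtain rfl : j = i := by simpa using h6
      obtain rfl : m = m' := h3
      exact Submodule.mem_iSup_of_mem _ (handle_mem_handleRange (k := 0) j h2 (cls_mem_tangles h1))

/-- For `k` of fixed parity the ranges increase, so a finite sum lies in a single even one plus the
next odd one. Two consecutive degrees are what the sign argument of `nestMulti_parity` can separate.
-/
theorem exists_eq_handle_add_handle {j : Fin n} (hx : x ∈ tangles (hs ++ [j]) m) :
    ∃ k, ∃ y ∈ tangles hs (m + 2 * k), ∃ z ∈ tangles hs (m + 2 * (k + 1)),
      x = handle j 0 k y + handle j 0 (k + 1) z := by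
  have h1 := tangles_concat_le hs j m hx
  have hmono : Monotone fun k => handleRange hs j m (2 * k) ⊔ handleRange hs j m (2 * k + 1) := by
    refine monotone_nat_of_le_succ fun k => sup_le_sup ?_ ?_
    · exact handleRange_le_add_two hs j m _
    · exact handleRange_le_add_two hs j m _
  have h2 : ⨆ k, handleRange hs j m k ≤
      ⨆ k, (handleRange hs j m (2 * k) ⊔ handleRange hs j m (2 * k + 1)) := by
    refine iSup_le fun k => ?_
    rcases Nat.even_or_odd' k with ⟨d, rfl | rfl⟩
    · exact le_sup_left.trans (le_iSup (fun k => handleRange hs j m (2 * k) ⊔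
        handleRange hs j m (2 * k + 1)) d)
    · exact le_sup_right.trans (le_iSup (fun k => handleRange hs j m (2 * k) ⊔
        handleRange hs j m (2 * k + 1)) d)
  obtain ⟨k, hk⟩ := (Submodule.mem_iSup_of_directed _ hmono.directed_le).1 (h2 h1)
  obtain ⟨_, ⟨y, hy, rfl⟩, _, ⟨z, hz, rfl⟩, h⟩ := Submodule.mem_sup.1 hk
  exact ⟨2 * k, y, hy, z, hz, h.symm⟩

/-! ### Permutations of the strands of a handle -/

/-- A crossing of the strands `i`, `i + 1`, resolved. -/
def crossO (i : ℕ) : Module.End ℂ (OpenSkein n) := -1 - cupO i * capO i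

theorem crossO_apply (i : ℕ) (x : OpenSkein n) : crossO i x = -x - cupO i (capO i x) := rfl

theorem crossO_mem {i : ℕ} (hi : i + 2 ≤ m) (hx : x ∈ tangles hs m) :
    crossO i x ∈ tangles hs m := by
  obtain ⟨m, rfl⟩ := Nat.exists_eq_add_of_le' (show 2 ≤ m by omega)
  exact sub_mem (neg_mem hx) (cup_mem (by omega) (cap_mem (by omega) hx))

theorem crossO_crossO {i : ℕ} (hi : i + 2 ≤ m) (hx : x ∈ tangles hs m) :
    crossO i (crossO i x) = x := by
  obtain ⟨m, rfl⟩ := Nat.exists_eq_add_of_le' (show 2 ≤ m by omega)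
  simp only [crossO_apply, map_sub, map_neg,
    cap_cup_self (show i ≤ m by omega) (cap_mem (show i ≤ m by omega) hx), map_smul]
  module

theorem evalO_crossO (Y : Fin n → SL) {i : ℕ} (hi : i + 2 ≤ m) (hx : x ∈ tangles hs m) :
    evalO Y (crossO i x) = crossT i (evalO Y x) := by
  obtain ⟨m, rfl⟩ := Nat.exists_eq_add_of_le' (show 2 ≤ m by omega)
  rw [crossO_apply, map_sub, map_neg, evalO_cup Y (show i ≤ m by omega) (cap_mem (by omega) hx),
    evalO_cap Y (by omega) hx, crossT_eq]

/-- The nested maxima join strand `i` to strand `2 * k - 1 - i`. So a turnback at `i`, `i + 1`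
slides through them to the mirror position, whose left strand is `2 * k - 2 - i`. -/
theorem nestCaps_cup_cap {i : ℕ} (hi : i + 2 ≤ k) (hx : x ∈ tangles hs (m + 2 * k)) :
    nestCaps 0 k (cupO i (capO i x)) =
      nestCaps 0 k (cupO (2 * k - 2 - i) (capO (2 * k - 2 - i) x)) := by
  induction k generalizing x with
  | zero => omega
  | succ k ih =>
    rw [mul_add, ← add_assoc] at hx
    rw [nestCaps_succ, nestCaps_succ, Nat.zero_add]
    rcases Nat.lt_or_ge k (i + 2) with h | h
    · obtain rfl : k = i + 1 := by omega
      have e : 2 * (i + 1 + 1) - 2 - i = i + 1 + 1 := by omega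
      rw [e, cap_succ_cup (m := m + 2 * (i + 1)) (by omega) (cap_mem (by omega) hx),
        cap_cup_succ (m := m + 2 * (i + 1)) (by omega) (cap_mem (by omega) hx),
        nestCaps_succ, nestCaps_succ, Nat.zero_add, cap_cap le_rfl]
    · obtain ⟨d, rfl⟩ := Nat.exists_eq_add_of_le' (show 2 ≤ k by omega)
      have e : 2 * (d + 2 + 1) - 2 - i = 2 * (d + 2) - 2 - i + 2 := by omega
      rw [cap_cup_of_le (show i ≤ d by omega), cap_cap (show i ≤ d by omega), e,
        cap_cup_of_ge (show d + 2 ≤ 2 * (d + 2) - 2 - i by omega),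
        ← cap_cap (show d + 2 ≤ 2 * (d + 2) - 2 - i by omega)]
      exact ih h (cap_mem (by omega) hx)

/-- The crossing on the left legs slides past the hole and through the nested maxima to its mirror
image on the right legs, where it cancels the other crossing because resolved crossings are
involutions. -/
theorem handle_crossO {i : ℕ} (j : Fin n) (hi : i + 2 ≤ k) (hx : x ∈ tangles hs (m + 2 * k)) :
    handle j 0 k (crossO i (crossO (2 * k - 2 - i) x)) = handle j 0 k x := by
  have h1 : ∀ y : OpenSkein n, holeO j k (crossO i y) = crossO i (holeO j k y) := fun y => by
    obtain ⟨d, rfl⟩ := Nat.exists_eq_add_of_le' (show 2 ≤ k by omega)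
    rw [crossO_apply, crossO_apply, map_sub, map_neg, hole_cup_of_le j (by omega),
      hole_cap_of_le j (by omega)]
  have h2 : ∀ y : OpenSkein n, holeO j k (crossO (2 * k - 2 - i) y) =
      crossO (2 * k - 2 - i) (holeO j k y) := fun y => by
    rw [crossO_apply, crossO_apply, map_sub, map_neg, hole_cup_of_ge j (by omega),
      hole_cap_of_ge j (by omega)]
  have h3 := hole_mem j (show k ≤ m + 2 * k by omega) hx
  rw [handle_apply, handle_apply, Nat.zero_add, h1, h2]
  have h4 := crossO_mem (show 2 * k - 2 - i + 2 ≤ m + 2 * k by omega) h3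
  rw [crossO_apply i, map_sub, nestCaps_cup_cap hi h4, ← map_sub, ← crossO_apply,
    crossO_crossO (by omega) h3]

end

section

/-! ### Polarization -/

/-- Polarization: `G` on the diagonal at ∑ c_j z_j is a polynomial in the c_j which vanishes
identically, and the sum over permutations is its coefficient at the squarefree monomial ∏ c_j. -/
theorem sum_perm_eq_zero_of_diagonal {ι E : Type*} [Fintype ι] [DecidableEq ι] [AddCommGroup E]
    [Module ℂ E] (G : MultilinearMap ℂ (fun _ : ι => E) ℂ) (h : ∀ z, G (fun _ => z) = 0)
    (z : ι → E) : ∑ s : Equiv.Perm ι, G (fun i => z (s i)) = 0 := by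
  let P : MvPolynomial ι ℂ :=
    ∑ r : ι → ι, MvPolynomial.monomial (∑ i, Finsupp.single (r i) 1) (G fun i => z (r i))
  have hP : P = 0 := by
    refine MvPolynomial.funext fun c => ?_
    rw [map_zero, ← h (∑ j, c j • z j), G.map_sum (fun _ j => c j • z j)]
    rw [map_sum]
    refine Finset.sum_congr rfl fun r _ => ?_
    rw [G.map_smul_univ (fun i => c (r i)) (fun i => z (r i)), MvPolynomial.eval_monomial,
      smul_eq_mul, mul_comm]
    congr 1
    rw [← Finsupp.prod_finsetSum_index (by simp) (by intros; rw [pow_add])]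
    simp
  have hc : MvPolynomial.coeff (∑ i, Finsupp.single i 1) P = 0 := by rw [hP, MvPolynomial.coeff_zero]
  rw [← hc, MvPolynomial.coeff_sum]
  simp only [MvPolynomial.coeff_monomial]
  rw [← Finset.sum_filter]
  refine Finset.sum_bij (fun s _ => (s : ι → ι)) ?_ ?_ ?_ ?_
  · intro s _
    rw [Finset.mem_filter]
    exact ⟨Finset.mem_univ _, Equiv.sum_comp s fun i => Finsupp.single i 1⟩
  · intro s _ s' _ h; exact DFunLike.coe_injective h
  · intro r hr
    have hr := (Finset.mem_filter.1 hr).2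
    -- An index map contributes to ∏ c_j only if it hits every index, and then it is a permutation.
    have hsurj : Function.Surjective r := by
      intro j
      by_contra hj
      have := DFunLike.congr_fun hr j
      rw [Finsupp.finsetSum_apply, Finsupp.finsetSum_apply] at this
      rw [Finset.sum_eq_zero fun i _ => Finsupp.single_eq_of_ne' fun h => hj ⟨i, h⟩] at this
      simp [Finsupp.single_apply] at this
    exact ⟨Equiv.ofBijective r (Finite.injective_iff_surjective.2 hsurj |>.bijective_of_finite), Finset.mem_univ _, rfl⟩
  · intro s _; rfl

/-- The function is homogeneous, so dividing `Z` by a square root of its determinant treats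
invertible `Z`. In general, the determinant of `Z + t • 1` is a nonzero polynomial in `t`, so
vanishing at invertible matrices of this line forces vanishing at `t = 0`. -/
theorem diagonal_eq_zero_of_det {ι : Type*} [Fintype ι] [DecidableEq ι]
    (G : MultilinearMap ℂ (fun _ : ι => Mat) ℂ)
    (h : ∀ Z : Mat, Z.det = 1 → G (fun _ => Z) = 0) (Z : Mat) : G (fun _ => Z) = 0 := by
  have h1 : ∀ Z : Mat, Z.det ≠ 0 → G (fun _ => Z) = 0 := by
    intro Z hZ
    obtain ⟨c, hc⟩ := IsAlgClosed.exists_pow_nat_eq Z.det two_pos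
    have hc0 : c ≠ 0 := by rintro rfl; simp [← hc] at hZ
    have e : Z = c • (c⁻¹ • Z) := by rw [smul_smul, mul_inv_cancel₀ hc0, one_smul]
    rw [e, G.map_smul_univ (fun _ => c) fun _ => c⁻¹ • Z, h, smul_zero]
    rw [Matrix.det_smul, ← hc, Fintype.card_fin, ← mul_pow, inv_mul_cancel₀ hc0, one_pow]
  let W : Fin 2 → Mat := ![Z, 1]
  let P : Polynomial ℂ := ∑ r : ι → Fin 2,
    (∏ i, (![1, Polynomial.X] : Fin 2 → Polynomial ℂ) (r i)) * Polynomial.C (G fun i => W (r i))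
  have hPe : ∀ t, P.eval t = G (fun _ => Z + t • (1 : Mat)) := by
    intro t
    have e : Z + t • (1 : Mat) = ∑ j : Fin 2, (![1, t] : Fin 2 → ℂ) j • W j := by
      simp [Fin.sum_univ_two, W]
    rw [e, G.map_sum (fun _ j => (![1, t] : Fin 2 → ℂ) j • W j), Polynomial.eval_finsetSum]
    refine Finset.sum_congr rfl fun r _ => ?_
    rw [G.map_smul_univ (fun i => (![1, t] : Fin 2 → ℂ) (r i)) fun i => W (r i),
      Polynomial.eval_mul, Polynomial.eval_prod, Polynomial.eval_C, smul_eq_mul]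
    congr 1
    refine Finset.prod_congr rfl fun i _ => ?_
    generalize r i = a
    fin_cases a <;> simp
  let D : Polynomial ℂ := (Polynomial.C (Z 0 0) + Polynomial.X) * (Polynomial.C (Z 1 1) + Polynomial.X)
    - Polynomial.C (Z 0 1 * Z 1 0)
  have hDe : ∀ t, D.eval t = (Z + t • (1 : Mat)).det := by
    intro t; simp [D, Matrix.det_fin_two]
  have hD : D ≠ 0 := by
    intro h0
    have := congr_arg (fun p : Polynomial ℂ => p.coeff 2) h0
    simp [D, add_mul, mul_add, Polynomial.coeff_X] at this
  -- At each `t` one factor vanishes: the determinant `D`, or else the value `P` at an invertible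
  -- matrix.
  have hPD : P * D = 0 := by
    refine Polynomial.funext fun t => ?_
    rw [Polynomial.eval_mul, hPe, hDe, Polynomial.eval_zero]
    by_cases hd : (Z + t • (1 : Mat)).det = 0
    · rw [hd, mul_zero]
    · rw [h1 _ hd, zero_mul]
  have hP := (mul_eq_zero.1 hPD).resolve_right hD
  have := hPe 0
  rw [hP, zero_smul, add_zero] at this
  simpa using this.symm

/-! ### Nested contractions -/

/-- Nested contractions of `k` pairs of neighbouring indices with given forms. -/
def nestContract (Z : ℕ → Mat) : ℕ → Module.End ℂ Tensor
  | 0 => 1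
  | k + 1 => nestContract Z k * contract k (Z k)

theorem nestContract_succ (Z : ℕ → Mat) (k : ℕ) (t : Tensor) :
    nestContract Z (k + 1) t = nestContract Z k (contract k (Z k) t) := rfl

theorem nestContract_congr {Z Z' : ℕ → Mat} {k : ℕ} (h : ∀ i < k, Z i = Z' i) :
    nestContract Z k = nestContract Z' k := by
  induction k with
  | zero => rfl
  | succ k ih =>
    rw [nestContract, nestContract, ih fun i hi => h i (by omega), h k (Nat.lt_succ_self k)]

/-- Nested contractions as a multilinear map. -/
def nestMulti (k : ℕ) : MultilinearMap ℂ (fun _ : Fin k => Mat) (Module.End ℂ Tensor) :=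
  (MultilinearMap.mkPiAlgebraFin ℂ k (Module.End ℂ Tensor)).compLinearMap fun i => contract i

theorem nestMulti_eq (k : ℕ) (Z : ℕ → Mat) :
    nestMulti k (fun i => Z i) = nestContract Z k := by
  induction k with
  | zero => simp [nestMulti, nestContract]
  | succ k ih =>
    rw [nestContract, ← ih]
    simp only [nestMulti, MultilinearMap.compLinearMap_apply, MultilinearMap.mkPiAlgebraFin_apply,
      List.ofFn_succ', List.concat_eq_append, List.prod_append, List.prod_singleton,
      Fin.val_castSucc, Fin.val_last]

theorem contract_crossT_of_le {l k : ℕ} (h : l ≤ k) (Z : Mat) (t : Tensor) :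
    contract (k + 2) Z (crossT l t) = crossT l (contract (k + 2) Z t) := by
  rw [crossT_eq, crossT_eq, map_sub, map_neg, contract_cupT_of_le h, capT, contract_comm h]

theorem contract_crossT_of_ge {l k : ℕ} (h : l ≤ k) (Z : Mat) (t : Tensor) :
    contract l Z (crossT (k + 2) t) = crossT k (contract l Z t) := by
  rw [crossT_eq, crossT_eq, map_sub, map_neg, contract_cupT_of_ge h, capT, capT,
    ← contract_comm h]

theorem contract_crossT_comm {l k : ℕ} (h : l + 2 ≤ k) (Z : Mat) (t : Tensor) :
    contract k Z (crossT l t) = crossT l (contract k Z t) := by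
  obtain ⟨k, rfl⟩ := Nat.exists_eq_add_of_le' (show 2 ≤ k by omega)
  exact contract_crossT_of_le (by omega) Z t

/-- Exchanging both pairs of indices exchanges the two pairs that are contracted, hence the two
forms; the two signs in `crossT` cancel. -/
theorem contract_contract_crossT (i : ℕ) (Z Z' : Mat) (t : Tensor) :
    contract i Z (contract (i + 1) Z' (crossT i (crossT (i + 2) t))) =
      contract i Z' (contract (i + 1) Z t) := by
  funext v
  have h : ∀ a b c d, (fun x => insertTwo (i + 1) c d (insertTwo i a b v)
      (Equiv.swap i (i + 1) (Equiv.swap (i + 2) (i + 2 + 1) x))) =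
      insertTwo (i + 1) a b (insertTwo i c d v) := by
    intro a b c d
    funext x
    have hx : x = i ∨ x = i + 1 ∨ x = i + 2 ∨ x = i + 3 ∨ x < i ∨ i + 4 ≤ x := by omega
    have e : ∀ y, (x = i ∧ y = i + 1 ∨ x = i + 1 ∧ y = i ∨ x = i + 2 ∧ y = i + 3 ∨
        x = i + 3 ∧ y = i + 2 ∨ (x < i ∨ i + 4 ≤ x) ∧ y = x) →
        Equiv.swap i (i + 1) (Equiv.swap (i + 2) (i + 2 + 1) x) = y := by
      intro y hy
      simp only [Equiv.swap_apply_def]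
      split_ifs <;> omega
    rcases hx with hx | hx | hx | hx | hx | hx
    · rw [e (i + 1) (by omega), hx]; simp [insertTwo]
    · rw [e i (by omega), hx]; simp [insertTwo]
    · rw [e (i + 3) (by omega), hx]; simp [insertTwo]
    · rw [e (i + 2) (by omega), hx]; simp [insertTwo]
    · rw [e x (by omega)]; simp [insertTwo, hx, show x < i + 1 by omega]
    · rw [e x (by omega)]
      simp only [insertTwo_of_le _ _ _ (show i + 1 + 2 ≤ x by omega),
        insertTwo_of_le _ _ _ (show i + 2 ≤ x - 2 by omega)]
  simp only [contract_apply, crossT_apply, h, Fin.sum_univ_two]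
  ring

/-- The tensor version of `handle_crossO`. With different forms on the nested pairs the double
crossing is no longer invisible: it permutes the forms. -/
theorem nestContract_crossT (Z : ℕ → Mat) {i k : ℕ} (hi : i + 2 ≤ k) (t : Tensor) :
    nestContract Z k (crossT i (crossT (2 * k - 2 - i) t)) =
      nestContract (fun x => Z (Equiv.swap i (i + 1) x)) k t := by
  induction k generalizing t with
  | zero => omega
  | succ k ih =>
    rcases Nat.lt_or_ge k (i + 2) with h | h
    · obtain rfl : k = i + 1 := by omega
      have e : 2 * (i + 1 + 1) - 2 - i = i + 2 := by omega
      rw [e]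
      simp only [nestContract_succ, contract_contract_crossT, Equiv.swap_apply_left,
        Equiv.swap_apply_right]
      rw [nestContract_congr fun x hx => ?_]
      rw [Equiv.swap_apply_of_ne_of_ne (by omega) (by omega)]
    · obtain ⟨d, rfl⟩ := Nat.exists_eq_add_of_le' (show 2 ≤ k by omega)
      have e : 2 * (d + 2 + 1) - 2 - i = 2 * (d + 2) - 2 - i + 2 := by omega
      rw [nestContract_succ, e, contract_crossT_comm (show i + 2 ≤ d + 2 by omega),
        contract_crossT_of_ge (by omega), ih h, nestContract_succ _ (d + 2) t,
        Equiv.swap_apply_of_ne_of_ne (by omega) (by omega)]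

theorem nestMulti_crossT (k : ℕ) (Z : Fin (k + 1) → Mat) (i : Fin k) (t : Tensor) :
    nestMulti (k + 1) Z (crossT i (crossT (2 * (k + 1) - 2 - i) t)) =
      nestMulti (k + 1) (fun x => Z (Equiv.swap i.castSucc i.succ x)) t := by
  -- The default value is immaterial, since only indices below `k + 1` are contracted and the
  -- transposition preserves this range.
  let Z' : ℕ → Mat := fun x => if h : x < k + 1 then Z ⟨x, h⟩ else 0
  have e1 : Z = fun x : Fin (k + 1) => Z' x := by
    funext x
    exact (dif_pos (c := (x : ℕ) < k + 1) (t := fun h => Z ⟨x, h⟩) (e := fun _ => 0) x.2).symm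
  have e2 : (fun x => Z (Equiv.swap i.castSucc i.succ x)) =
      fun x : Fin (k + 1) => Z' (Equiv.swap (i : ℕ) (i + 1) x) := by
    funext x
    rw [e1]
    simp only [Equiv.swap_apply_def, Fin.ext_iff, Fin.val_castSucc, Fin.val_succ]
    split_ifs <;> simp
  rw [e2, nestMulti_eq (k + 1) fun x => Z' (Equiv.swap (i : ℕ) (i + 1) x), e1,
    nestMulti_eq (k + 1) Z', nestContract_crossT Z' (by omega)]

/-- Contraction with elementary matrices reads off single coordinates. -/
theorem eq_zero_of_nestContract {k : ℕ} {t : Tensor} (h : ∀ Z, nestContract Z k t = 0) : t = 0 := by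
  induction k generalizing t with
  | zero => exact h 0
  | succ k ih =>
    have h1 : ∀ W, contract k W t = 0 := by
      intro W
      refine ih fun Z => ?_
      have := h fun i => if i < k then Z i else W
      rw [nestContract_succ, if_neg (lt_irrefl k)] at this
      rw [← this]
      rw [nestContract_congr fun i hi => ?_]
      rw [if_pos hi]
    funext v
    have := congr_fun (h1 (Matrix.single (v k) (v (k + 1)) 1)) fun i => v (insertPos k i)
    rw [contract_apply, Finset.sum_eq_single (v k), Finset.sum_eq_single (v (k + 1)),
      insertTwo_self, Matrix.single_apply_same, one_mul] at this
    · exact this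
    · intro b _ hb; rw [Matrix.single_apply_of_col_ne _ _ hb.symm]; simp
    · simp
    · intro a _ ha
      refine Finset.sum_eq_zero fun b _ => ?_
      rw [Matrix.single_apply_of_row_ne ha.symm]; simp
    · simp

theorem nestMulti_perm_sum {k : ℕ} {t : Tensor}
    (h : ∀ Z : Mat, Z.det = 1 → nestMulti k (fun _ => Z) t = 0) (Z : Fin k → Mat) :
    ∑ s : Equiv.Perm (Fin k), nestMulti k (fun i => Z (s i)) t = 0 := by
  funext v
  let ev : Module.End ℂ Tensor →ₗ[ℂ] ℂ := LinearMap.proj v ∘ₗ LinearMap.applyₗ t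
  have := sum_perm_eq_zero_of_diagonal (ev.compMultilinearMap (nestMulti k))
    (diagonal_eq_zero_of_det _ fun Z hZ => congr_fun (h Z hZ) v) Z
  rw [Finset.sum_apply]
  exact this

/-- For 2 × 2 matrices `-Z` again has determinant one, and replacing `Z` by `-Z` changes the
relative sign of terms of consecutive degrees. -/
theorem nestMulti_parity {k : ℕ} {t t' : Tensor}
    (h : ∀ Z : Mat, Z.det = 1 →
      nestMulti k (fun _ => Z) t + nestMulti (k + 1) (fun _ => Z) t' = 0) :
    (∀ Z : Mat, Z.det = 1 → nestMulti k (fun _ => Z) t = 0) ∧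
      ∀ Z : Mat, Z.det = 1 → nestMulti (k + 1) (fun _ => Z) t' = 0 := by
  have hneg : ∀ (k : ℕ) (Z : Mat), nestMulti k (fun _ => -Z) =
      (-1 : ℂ) ^ k • nestMulti k (fun _ => Z) := fun k Z => by
    have := (nestMulti k).map_smul_univ (fun _ => (-1 : ℂ)) fun _ => Z
    simpa using this
  have key : ∀ Z : Mat, Z.det = 1 → nestMulti k (fun _ => Z) t = 0 := by
    intro Z hZ
    have h1 := h Z hZ
    have h2 := h (-Z) (by rw [Matrix.det_neg, hZ]; simp)
    rw [hneg, hneg, LinearMap.smul_apply, LinearMap.smul_apply, pow_succ, mul_smul, ← smul_add]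
      at h2
    have h3 := (smul_eq_zero.1 h2).resolve_left (pow_ne_zero _ (by norm_num))
    rw [neg_one_smul] at h3
    have h4 : (2 : ℂ) • nestMulti k (fun _ => Z) t = 0 := by
      rw [two_smul]
      have := congr_arg₂ (· + ·) h1 h3
      simp only [add_zero] at this
      rw [← this]; abel
    exact (smul_eq_zero.1 h4).resolve_left (by norm_num)
  refine ⟨key, fun Z hZ => ?_⟩
  have := h Z hZ
  rwa [key Z hZ, zero_add] at this

theorem capT_actT (Y : Mat) (l : ℕ) (t : Tensor) :
    capT l (actT Y l t) = contract l (-(Y.transpose * eps)) t := by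
  funext v
  have h : ∀ a b c, Function.update (insertTwo l a b v) l c = insertTwo l c b v := by
    intro a b c; funext j
    simp only [Function.update_apply, insertTwo]
    split_ifs <;> first | rfl | omega
  simp [capT_apply, contract_apply, actT_apply, h, Fin.sum_univ_two, eps, Matrix.mul_apply]
  ring

/-- Only the left legs of a handle pass on the left of the hole, so each maximum absorbs exactly one
copy of `Y` into its form. -/
theorem nestContract_holeT (Y : Mat) (k : ℕ) (t : Tensor) :
    nestContract (fun _ => -eps) k (holeT Y k t) =
      nestContract (fun _ => -(Y.transpose * eps)) k t := by
  induction k generalizing t with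
  | zero => rfl
  | succ k ih =>
    have := capT_actT Y k (holeT Y k t)
    rw [capT] at this
    rw [nestContract_succ, holeT_succ, this, ← holeT_contract_of_le le_rfl, ih, nestContract_succ]

/-! ### The evaluation is injective -/

variable {n : ℕ} {hs : List (Fin n)} {m k : ℕ} {x : OpenSkein n}

theorem evalO_nestCaps (Y : Fin n → SL) (hx : x ∈ tangles hs (m + 2 * k)) :
    evalO Y (nestCaps 0 k x) = nestContract (fun _ => -eps) k (evalO Y x) := by
  induction k generalizing x with
  | zero => rfl
  | succ k ih =>
    rw [mul_add, ← add_assoc] at hx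
    rw [nestCaps_succ, ih (cap_mem (by omega) hx), Nat.zero_add, evalO_cap Y (by omega) hx,
      nestContract_succ, capT]

theorem evalO_handle (Y : Fin n → SL) (j : Fin n) (hx : x ∈ tangles hs (m + 2 * k)) :
    evalO Y (handle j 0 k x) =
      nestMulti k (fun _ => -((Y j).1.transpose * eps)) (evalO Y x) := by
  rw [handle_apply, Nat.zero_add, evalO_nestCaps Y (hole_mem j (by omega) hx),
    evalO_hole Y j (by omega) hx, nestContract_holeT,
    nestMulti_eq k fun _ => -((Y j).1.transpose * eps)]

/-- A permutation of the strands of a handle does not change the skein. -/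
theorem exists_permute_handle (hs : List (Fin n)) (j : Fin n) (m k : ℕ)
    (s : Equiv.Perm (Fin k)) :
    ∃ P : Module.End ℂ (OpenSkein n), ∀ x ∈ tangles hs (m + 2 * k),
      P x ∈ tangles hs (m + 2 * k) ∧ handle j 0 k (P x) = handle j 0 k x ∧
      ∀ (Y : Fin n → SL) (Z : Fin k → Mat),
        nestMulti k Z (evalO Y (P x)) = nestMulti k (fun i => Z (s i)) (evalO Y x) := by
  rcases k with _ | k
  · refine ⟨1, fun x hx => ⟨hx, rfl, fun Y Z => ?_⟩⟩
    rw [Subsingleton.elim (fun i => Z (s i)) Z]; rfl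
  -- Adjacent transpositions generate the symmetric group. Each one is realized by crossing two
  -- neighbouring strands on both sides of the handle.
  have hs : s ∈ Submonoid.closure
      (Set.range fun i : Fin k ↦ Equiv.swap i.castSucc i.succ) := by
    rw [Equiv.Perm.mclosure_swap_castSucc_succ]; trivial
  induction hs using Submonoid.closure_induction with
  | mem s hs =>
    obtain ⟨i, rfl⟩ := hs
    have hi : (i : ℕ) + 2 ≤ k + 1 := by omega
    refine ⟨crossO i * crossO (2 * (k + 1) - 2 - i), fun x hx => ?_⟩
    have h1 := crossO_mem (show 2 * (k + 1) - 2 - (i : ℕ) + 2 ≤ m + 2 * (k + 1) by omega) hx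
    refine ⟨crossO_mem (by omega) h1, handle_crossO j hi hx, fun Y Z => ?_⟩
    rw [Module.End.mul_apply, evalO_crossO Y (by omega) h1, evalO_crossO Y (by omega) hx,
      nestMulti_crossT]
  | one => exact ⟨1, fun x hx => ⟨hx, rfl, fun Y Z => rfl⟩⟩
  | mul s s' _ _ ih ih' =>
    obtain ⟨P, hP⟩ := ih
    obtain ⟨P', hP'⟩ := ih'
    refine ⟨P * P', fun x hx => ?_⟩
    obtain ⟨a, b, c⟩ := hP' x hx
    obtain ⟨a', b', c'⟩ := hP _ a
    refine ⟨a', b'.trans b, fun Y Z => ?_⟩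
    rw [Module.End.mul_apply, c', c]
    rfl

/-- Polarization shows that the sum of all strand permutations `P s x` has value zero, so it is zero
by `ih`. All these permutations give the same handle, so `k!` times the handle is zero. -/
theorem handle_eq_zero (j : Fin n)
    (ih : ∀ y ∈ tangles hs (m + 2 * k), (∀ Y, evalO Y y = 0) → y = 0)
    (hx : x ∈ tangles hs (m + 2 * k))
    (h : ∀ (Y : Fin n → SL) (Z : Mat), Z.det = 1 → nestMulti k (fun _ => Z) (evalO Y x) = 0) :
    handle j 0 k x = 0 := by
  choose P hP using exists_permute_handle hs j m k
  have h1 : ∑ s, P s x = 0 := by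
    refine ih _ (sum_mem fun s _ => (hP s x hx).1) fun Y => ?_
    refine eq_zero_of_nestContract (k := k) fun Z => ?_
    rw [← nestMulti_eq, map_sum, map_sum,
      ← nestMulti_perm_sum (h Y) (fun i : Fin k => Z i)]
    exact Finset.sum_congr rfl fun s _ => (hP s x hx).2.2 Y fun i => Z i
  have h2 := congr_arg (handle j 0 k) h1
  rw [map_sum, map_zero, Finset.sum_congr rfl fun s _ => (hP s x hx).2.1, Finset.sum_const,
    ← Nat.cast_smul_eq_nsmul ℂ] at h2
  refine (smul_eq_zero.1 h2).resolve_left ?_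
  simp [Fintype.card_perm, Nat.factorial_ne_zero]

/-- Skeins of open tangles are determined by their values. -/
theorem evalO_injective {hs : List (Fin n)} (hn : hs.Nodup) {m : ℕ} {x : OpenSkein n}
    (hx : x ∈ tangles hs m) (h : ∀ Y, evalO Y x = 0) : x = 0 := by
  induction hs using List.reverseRecOn generalizing m x with
  | nil => exact evalO_injective_of_nil 1 hx (h 1)
  | append_singleton hs j ih =>
    rw [List.nodup_append] at hn
    have hj : j ∉ hs := fun hc => hn.2.2 j hc j (by simp) rfl
    obtain ⟨k, y, hy, z, hz, rfl⟩ := exists_eq_handle_add_handle hx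
    -- The tangles below the last hole do not see its matrix, so that matrix can be chosen to make
    -- the form of the handle any `Z` of determinant one. Because `eps * eps = -1`, the transpose of
    -- `Z * eps` does this.
    have key : ∀ (Y : Fin n → SL), (∀ Z : Mat, Z.det = 1 →
        nestMulti k (fun _ => Z) (evalO Y y) + nestMulti (k + 1) (fun _ => Z) (evalO Y z) = 0) := by
      intro Y Z hZ
      have hdet : ((Z * eps).transpose : Mat).det = 1 := by
        rw [Matrix.det_transpose, Matrix.det_mul, hZ]; simp [eps, Matrix.det_fin_two]
      let A : SL := ⟨(Z * eps).transpose, hdet⟩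
      let Y' : Fin n → SL := Function.update Y j A
      have hYj : -((Y' j).1.transpose * eps) = Z := by
        rw [show Y' j = A from Function.update_self ..]
        change -((Z * eps).transpose.transpose * eps) = Z
        rw [Matrix.transpose_transpose, Matrix.mul_assoc, eps_mul_eps]
        simp
      have hY : ∀ i ∈ hs, Y' i = Y i := fun i hi =>
        Function.update_of_ne (by rintro rfl; exact hj hi) _ _
      have := h Y'
      rwa [map_add, evalO_handle Y' j hy, evalO_handle Y' j hz, hYj, evalO_congr hY hy,
        evalO_congr hY hz] at this
    rw [handle_eq_zero j (fun y hy => ih hn.1 hy) hy fun Y => (nestMulti_parity (key Y)).1,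
      handle_eq_zero j (fun y hy => ih hn.1 hy) hz fun Y => (nestMulti_parity (key Y)).2, add_zero]

end

section

/-! ### Traces of loops -/

variable {n : ℕ}

/-- The representation of the free group for which `a_j` acts by the inverse of `Y j`. -/
def rho (Y : Fin n → SL) : FreeGroup (Fin n) →* SL := FreeGroup.lift fun j => (Y j)⁻¹

theorem trace_inv_SL (A : SL) : (A⁻¹).1.trace = A.1.trace := by
  have : (A⁻¹).1 = A.1.adjugate := rfl
  rw [this, Matrix.adjugate_fin_two, Matrix.trace_fin_two, Matrix.trace_fin_two]
  simp [add_comm]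

theorem trace_eq_of_isConj {A B : SL} (h : IsConj A B) : A.1.trace = B.1.trace := by
  obtain ⟨c, rfl⟩ := isConj_iff.1 h
  have : (c * A * c⁻¹).1 = c.1 * A.1 * (c⁻¹).1 := rfl
  rw [this, Matrix.trace_mul_comm, ← Matrix.mul_assoc]
  have h1 : (c⁻¹).1 * c.1 = 1 := congr_arg Subtype.val (inv_mul_cancel c)
  rw [h1, Matrix.one_mul]

/-- The trace of a free homotopy class. -/
def loopTrace (Y : Fin n → SL) : W n → ℂ :=
  Quotient.lift (fun w => (rho Y w).1.trace) <| by
    rintro a b (h | h)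
    · exact trace_eq_of_isConj ((rho Y).map_isConj h)
    · have := trace_eq_of_isConj ((rho Y).map_isConj h)
      rw [map_inv, trace_inv_SL] at this
      exact this

theorem loopTrace_loopClass (Y : Fin n → SL) (w : FreeGroup (Fin n)) :
    loopTrace Y (loopClass w) = (rho Y w).1.trace := rfl

/-- The value of an arc with the word `g`. -/
def arcVal (Y : Fin n → SL) (g : FreeGroup (Fin n)) : Mat := (rho Y g).1 * eps

theorem arcVal_one (Y : Fin n → SL) : arcVal Y 1 = eps := by
  rw [arcVal, map_one]; exact Matrix.one_mul _

/-- For `A` in SL₂, `A⁻¹ * eps` is minus the transpose of `A * eps`. Reading an arc from its other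
end thus costs a sign, which `listSign` compensates. -/
theorem arcVal_inv (Y : Fin n → SL) (g : FreeGroup (Fin n)) (a b : Fin 2) :
    arcVal Y g⁻¹ b a = -arcVal Y g a b := by
  rw [arcVal, arcVal, map_inv]
  generalize rho Y g = A
  have : (A⁻¹).1 = A.1.adjugate := rfl
  rw [this, Matrix.adjugate_fin_two]
  fin_cases a <;> fin_cases b <;> simp [Matrix.mul_apply, Fin.sum_univ_two, eps]

theorem arcVal_mul (Y : Fin n → SL) (g h : FreeGroup (Fin n)) :
    arcVal Y (g * h) = (rho Y g).1 * arcVal Y h := by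
  rw [arcVal, arcVal, map_mul, ← Matrix.mul_assoc]; rfl

theorem arcVal_join (Y : Fin n → SL) (g h : FreeGroup (Fin n)) (a b : Fin 2) :
    arcVal Y g a 1 * arcVal Y h 0 b - arcVal Y g a 0 * arcVal Y h 1 b = arcVal Y (g * h) a b := by
  rw [arcVal_mul]
  simp [Matrix.mul_apply, Fin.sum_univ_two, arcVal, eps]

/-- Contracting `A * eps` with `-eps` gives minus the trace of `A`: the origin of one sign per
component. -/
theorem arcVal_close (Y : Fin n → SL) (g : FreeGroup (Fin n)) :
    arcVal Y g 1 0 - arcVal Y g 0 1 = -loopTrace Y (loopClass g) := by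
  rw [loopTrace_loopClass, Matrix.trace_fin_two]
  simp [arcVal, Matrix.mul_apply, Fin.sum_univ_two, eps]
  ring

/-- A strand crossing the cut multiplies the word at its start by the inverse of `a_j`, while the
hole acts by `Y j`. This is why `rho` sends `a_j` to the inverse of `Y j`. -/
theorem arcVal_of_inv_mul (Y : Fin n → SL) (j : Fin n) (g : FreeGroup (Fin n)) (a b : Fin 2) :
    ∑ c, (Y j).1 a c * arcVal Y g c b = arcVal Y ((FreeGroup.of j)⁻¹ * g) a b := by
  rw [arcVal_mul, map_inv, rho, FreeGroup.lift_apply_of, inv_inv, Matrix.mul_apply]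

theorem arcVal_mul_of (Y : Fin n → SL) (j : Fin n) (g : FreeGroup (Fin n)) (a b : Fin 2) :
    ∑ c, (Y j).1 b c * arcVal Y g a c = arcVal Y (g * FreeGroup.of j) a b := by
  have h := arcVal_of_inv_mul Y j g⁻¹ b a
  rw [← inv_inv (g * FreeGroup.of j), mul_inv_rev, arcVal_inv, ← h, ← Finset.sum_neg_distrib]
  refine Finset.sum_congr rfl fun c _ => ?_
  rw [arcVal_inv]; ring

/-! ### Signs of lists -/

/-- The sign of the permutation that sorts a list. -/
def listSign : List ℕ → ℂ
  | [] => 1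
  | a :: l => (l.map fun b => if a < b then (1 : ℂ) else -1).prod * listSign l

theorem listSign_cons (a : ℕ) (l : List ℕ) :
    listSign (a :: l) = (l.map fun b => if a < b then (1 : ℂ) else -1).prod * listSign l := rfl

theorem listSign_map {f : ℕ → ℕ} {l : List ℕ}
    (hf : ∀ a ∈ l, ∀ b ∈ l, (f a < f b ↔ a < b)) : listSign (l.map f) = listSign l := by
  induction l with
  | nil => rfl
  | cons a l ih =>
    rw [List.map_cons, listSign, listSign,
      ih fun b hb c hc => hf b (List.mem_cons_of_mem _ hb) c (List.mem_cons_of_mem _ hc),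
      List.map_map]
    congr 2
    refine List.map_congr_left fun b hb => ?_
    simp only [Function.comp, hf a List.mem_cons_self b (List.mem_cons_of_mem _ hb)]

theorem listSign_cons_cons_eq {a b : ℕ} {l : List ℕ} (hab : a < b)
    (h : ∀ c ∈ l, (a < c ↔ b < c)) : listSign (a :: b :: l) = listSign l := by
  rw [listSign, listSign, List.map_cons, List.prod_cons, if_pos hab, one_mul, ← mul_assoc,
    ← List.prod_map_mul]
  rw [List.prod_eq_one, one_mul]
  intro x hx
  obtain ⟨c, hc, rfl⟩ := List.mem_map.1 hx
  have := h c hc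
  by_cases hb : b < c
  · simp [hb, this.2 hb]
  · simp [hb, mt this.1 hb]

theorem lt_sign_symm {a b : ℕ} (h : a ≠ b) :
    (if a < b then (1 : ℂ) else -1) = -(if b < a then (1 : ℂ) else -1) := by
  rcases Nat.lt_or_gt_of_ne h with h | h
  · rw [if_pos h, if_neg (by omega), neg_neg]
  · rw [if_neg (by omega), if_pos h]

theorem listSign_swap {a b : ℕ} (h : a ≠ b) (l : List ℕ) :
    listSign (b :: a :: l) = -listSign (a :: b :: l) := by
  simp only [listSign, List.map_cons, List.prod_cons, lt_sign_symm h.symm]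
  ring

theorem listSign_swap_cons {a b : ℕ} (x : ℕ) (h : a ≠ b) (l : List ℕ) :
    listSign (x :: b :: a :: l) = -listSign (x :: a :: b :: l) := by
  rw [listSign_cons x, listSign_swap h, listSign_cons x]
  simp only [List.map_cons, List.prod_cons]
  ring

/-! ### Collections of arcs -/

/-- The endpoints of a list of arcs. -/
def ends (L : List (ℕ × ℕ × FreeGroup (Fin n))) : List ℕ := L.flatMap fun q => [q.1, q.2.1]

@[simp] theorem ends_nil : ends ([] : List (ℕ × ℕ × FreeGroup (Fin n))) = [] := rfl

@[simp] theorem ends_cons (q : ℕ × ℕ × FreeGroup (Fin n)) (L : List (ℕ × ℕ × FreeGroup (Fin n))) :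
    ends (q :: L) = q.1 :: q.2.1 :: ends L := rfl

theorem mem_ends {L : List (ℕ × ℕ × FreeGroup (Fin n))} {i : ℕ} :
    i ∈ ends L ↔ ∃ q ∈ L, i = q.1 ∨ i = q.2.1 := by
  simp [ends]

/-- The list of arcs with renumbered endpoints. -/
def renumber (f : ℕ → ℕ) (L : List (ℕ × ℕ × FreeGroup (Fin n))) :
    List (ℕ × ℕ × FreeGroup (Fin n)) := L.map fun q => (f q.1, f q.2.1, q.2.2)

theorem ends_renumber (f : ℕ → ℕ) (L : List (ℕ × ℕ × FreeGroup (Fin n))) :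
    ends (renumber f L) = (ends L).map f := by
  induction L with
  | nil => rfl
  | cons q L ih =>
    change f q.1 :: f q.2.1 :: ends (renumber f L) = _
    rw [ih]; rfl

/-- The product of the values of the arcs. -/
def arcProd (Y : Fin n → SL) (L : List (ℕ × ℕ × FreeGroup (Fin n))) (v : ℕ → Fin 2) : ℂ :=
  (L.map fun q => arcVal Y q.2.2 (v q.1) (v q.2.1)).prod

theorem arcProd_cons (Y : Fin n → SL) (q : ℕ × ℕ × FreeGroup (Fin n))
    (L : List (ℕ × ℕ × FreeGroup (Fin n))) (v : ℕ → Fin 2) :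
    arcProd Y (q :: L) v = arcVal Y q.2.2 (v q.1) (v q.2.1) * arcProd Y L v := by
  simp [arcProd]

theorem arcProd_renumber (Y : Fin n → SL) (f : ℕ → ℕ) (L : List (ℕ × ℕ × FreeGroup (Fin n)))
    (v : ℕ → Fin 2) : arcProd Y (renumber f L) v = arcProd Y L fun i => v (f i) := by
  simp [arcProd, renumber, Function.comp_def]

theorem arcProd_congr (Y : Fin n → SL) {L : List (ℕ × ℕ × FreeGroup (Fin n))}
    {v v' : ℕ → Fin 2} (h : ∀ i ∈ ends L, v i = v' i) : arcProd Y L v = arcProd Y L v' := by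
  rw [arcProd, arcProd]
  congr 1
  refine List.map_congr_left fun q hq => ?_
  rw [h _ (mem_ends.2 ⟨q, hq, Or.inl rfl⟩), h _ (mem_ends.2 ⟨q, hq, Or.inr rfl⟩)]

/-- The value of a list of arcs. -/
def arcTensor (Y : Fin n → SL) (L : List (ℕ × ℕ × FreeGroup (Fin n))) : Tensor := fun v =>
  listSign (ends L) * arcProd Y L v

/-- `L` lists the arcs of the state `s` with `m` strands. -/
structure Arcs (s : State n) (m : ℕ) (L : List (ℕ × ℕ × FreeGroup (Fin n))) : Prop where
  nodup : (ends L).Nodup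
  mem : ∀ i, i ∈ ends L ↔ i < m
  arc : ∀ q ∈ L, s.mate q.1 = q.2.1 ∧ s.mate q.2.1 = q.1 ∧ s.label q.1 = q.2.2 ∧
    s.label q.2.1 = q.2.2⁻¹

theorem ends_perm {L L' : List (ℕ × ℕ × FreeGroup (Fin n))} (h : L.Perm L') :
    (ends L).Perm (ends L') := h.flatMap_right _

/-- Each arc has two endpoints, so exchanging two arcs produces four sign changes. -/
theorem listSign_ends_perm {L L' : List (ℕ × ℕ × FreeGroup (Fin n))} (h : L.Perm L')
    (hn : (ends L).Nodup) : listSign (ends L) = listSign (ends L') := by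
  induction h with
  | nil => rfl
  | @cons q L L' h ih =>
    rw [ends_cons] at hn
    have hp := ends_perm h
    rw [ends_cons, ends_cons, listSign, listSign, listSign, listSign, ih hn.of_cons.of_cons,
      (hp.map _).prod_eq, ((hp.cons _).map _).prod_eq]
  | swap q q' L =>
    obtain ⟨a, b, g⟩ := q
    obtain ⟨c, d, g'⟩ := q'
    simp only [ends_cons, List.nodup_cons, List.mem_cons, not_or] at hn
    simp only [ends_cons, listSign, List.map_cons, List.prod_cons,
      lt_sign_symm (show c ≠ a by tauto), lt_sign_symm (show d ≠ a by tauto),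
      lt_sign_symm (show c ≠ b by tauto), lt_sign_symm (show d ≠ b by tauto)]
    ring
  | trans h h' ih ih' => rw [ih hn, ih' ((ends_perm h).nodup_iff.1 hn)]

theorem Arcs.perm {s : State n} {m : ℕ} {L L' : List (ℕ × ℕ × FreeGroup (Fin n))}
    (h : Arcs s m L) (hp : L.Perm L') (Y : Fin n → SL) :
    Arcs s m L' ∧ arcTensor Y L = arcTensor Y L' := by
  refine ⟨⟨(ends_perm hp).nodup_iff.1 h.nodup,
    fun i => (ends_perm hp).mem_iff.symm.trans (h.mem i),
    fun q hq => h.arc q (hp.mem_iff.2 hq)⟩, ?_⟩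
  funext v
  rw [arcTensor, arcTensor, listSign_ends_perm hp h.nodup, arcProd, arcProd, (hp.map _).prod_eq]

/-- The sign from reversing the word cancels the one from exchanging the endpoints in the list. -/
theorem Arcs.flip {s : State n} {m a b : ℕ} {g : FreeGroup (Fin n)}
    {L : List (ℕ × ℕ × FreeGroup (Fin n))} (h : Arcs s m ((a, b, g) :: L)) (Y : Fin n → SL) :
    Arcs s m ((b, a, g⁻¹) :: L) ∧ arcTensor Y ((a, b, g) :: L) = arcTensor Y ((b, a, g⁻¹) :: L) := by
  have hp : (ends ((a, b, g) :: L)).Perm (ends ((b, a, g⁻¹) :: L)) := List.Perm.swap _ _ _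
  refine ⟨⟨hp.nodup_iff.1 h.nodup, fun i => hp.mem_iff.symm.trans (h.mem i), ?_⟩, ?_⟩
  · intro q hq
    rcases List.mem_cons.1 hq with rfl | hq
    · obtain ⟨h1, h2, h3, h4⟩ := h.arc _ List.mem_cons_self
      exact ⟨h2, h1, h4, by rw [inv_inv]; exact h3⟩
    · exact h.arc q (List.mem_cons_of_mem _ hq)
  · have hab : a ≠ b := by
      have := h.nodup
      simp only [ends_cons, List.nodup_cons, List.mem_cons, not_or] at this
      exact this.1.1
    funext v
    simp only [arcTensor, ends_cons, arcProd_cons, arcVal_inv Y g (v a) (v b), listSign_swap hab]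
    ring

theorem exists_perm_cons_of_mem {α : Type*} {a : α} {l : List α} (h : a ∈ l) :
    ∃ l', l.Perm (a :: l') := by
  obtain ⟨s, t, rfl⟩ := List.append_of_mem h
  exact ⟨s ++ t, List.perm_middle⟩

theorem Arcs.exists_head {s : State n} {m i : ℕ} {L : List (ℕ × ℕ × FreeGroup (Fin n))}
    (h : Arcs s m L) (hi : i < m) (Y : Fin n → SL) :
    ∃ x g L', Arcs s m ((x, i, g) :: L') ∧ arcTensor Y L = arcTensor Y ((x, i, g) :: L') := by
  obtain ⟨⟨a, b, g⟩, hq, hq'⟩ := mem_ends.1 ((h.mem i).2 hi)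
  obtain ⟨L', hp⟩ := exists_perm_cons_of_mem hq
  obtain ⟨h1, h2⟩ := h.perm hp Y
  rcases hq' with rfl | rfl
  · obtain ⟨h3, h4⟩ := h1.flip Y
    exact ⟨b, g⁻¹, L', h3, h2.trans h4⟩
  · exact ⟨a, g, L', h1, h2⟩

/-- Arcs may be reordered and reversed at no cost. So the two strands on which a crossing or a
maximum acts either bound one arc or can be made consecutive in the list of endpoints. -/
theorem Arcs.exists_adjacent {s : State n} {m l : ℕ} {L : List (ℕ × ℕ × FreeGroup (Fin n))}
    (h : Arcs s m L) (hl : l + 2 ≤ m) (Y : Fin n → SL) :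
    (∃ g L', Arcs s m ((l, l + 1, g) :: L') ∧ arcTensor Y L = arcTensor Y ((l, l + 1, g) :: L')) ∨
    ∃ x y g h L', Arcs s m ((x, l, g) :: (l + 1, y, h) :: L') ∧
      arcTensor Y L = arcTensor Y ((x, l, g) :: (l + 1, y, h) :: L') := by
  obtain ⟨x, g, L', h1, h2⟩ := h.exists_head (show l < m by omega) Y
  have hl1 := (h1.mem (l + 1)).2 (by omega)
  obtain ⟨⟨a, b, k⟩, hq, hq'⟩ := mem_ends.1 hl1
  rcases List.mem_cons.1 hq with hq | hq
  · rw [Prod.mk.injEq, Prod.mk.injEq] at hq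
    obtain ⟨rfl, rfl, rfl⟩ := hq
    have ha : a = b + 1 := by
      rcases hq' with hq' | hq'
      · exact hq'.symm
      · simp at hq'
    subst ha
    obtain ⟨h3, h4⟩ := h1.flip Y
    exact Or.inl ⟨_, _, h3, h2.trans h4⟩
  · right
    obtain ⟨L'', hp⟩ := exists_perm_cons_of_mem hq
    rcases hq' with rfl | rfl
    · obtain ⟨h3, h4⟩ := h1.perm (hp.cons _) Y
      exact ⟨x, b, g, k, L'', h3, h2.trans h4⟩
    · obtain ⟨h3, h4⟩ := h1.perm ((hp.cons _).trans (List.Perm.swap _ _ _)) Y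
      obtain ⟨h5, h6⟩ := h3.flip Y
      obtain ⟨h7, h8⟩ := h5.perm (List.Perm.swap _ _ _) Y
      exact ⟨x, a, g, k⁻¹, L'', h7, h2.trans (h4.trans (h6.trans h8))⟩

/-! ### The value of a state -/

/-- The product of the values of the closed components. -/
def loopsVal (Y : Fin n → SL) (s : State n) : ℂ := (s.loops.map fun c => -loopTrace Y c).prod

theorem deletePos_insertPos (l i : ℕ) : deletePos l (insertPos l i) = i := by
  simp only [deletePos, insertPos]; split_ifs <;> omega

theorem insertPos_deletePos {l i : ℕ} (h : i ≠ l) (h' : i ≠ l + 1) :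
    insertPos l (deletePos l i) = i := by
  simp only [deletePos, insertPos]; split_ifs <;> omega

theorem insertPos_ne (l i : ℕ) : insertPos l i ≠ l ∧ insertPos l i ≠ l + 1 := by
  simp only [insertPos]; split_ifs <;> omega

theorem Arcs.cup {s : State n} {m l : ℕ} {L : List (ℕ × ℕ × FreeGroup (Fin n))}
    (h : Arcs s m L) (hl : l ≤ m) (Y : Fin n → SL) :
    Arcs (s.cup l) (m + 2) ((l, l + 1, 1) :: renumber (insertPos l) L) ∧
      cupT l (arcTensor Y L) = arcTensor Y ((l, l + 1, 1) :: renumber (insertPos l) L) := by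
  have hinj : Function.Injective (insertPos l) := fun a b hab => by
    rw [← deletePos_insertPos l a, hab, deletePos_insertPos]
  refine ⟨⟨?_, fun i => ?_, fun q hq => ?_⟩, ?_⟩
  · rw [ends_cons, ends_renumber, List.nodup_cons, List.nodup_cons]
    refine ⟨?_, ?_, h.nodup.map hinj⟩
    · simp only [List.mem_cons, List.mem_map, not_or, not_exists, not_and]
      exact ⟨by omega, fun i _ => (insertPos_ne l i).1⟩
    · simp only [List.mem_map, not_exists, not_and]
      exact fun i _ => (insertPos_ne l i).2
  · rw [ends_cons, ends_renumber]
    simp only [List.mem_cons, List.mem_map, h.mem]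
    constructor
    · rintro (rfl | rfl | ⟨a, ha, rfl⟩)
      · omega
      · omega
      · simp only [insertPos]; split_ifs <;> omega
    · intro hi
      by_cases h1 : i = l
      · exact Or.inl h1
      by_cases h2 : i = l + 1
      · exact Or.inr (Or.inl h2)
      refine Or.inr (Or.inr ⟨deletePos l i, ?_, insertPos_deletePos h1 h2⟩)
      simp only [deletePos]; split_ifs <;> omega
  · rcases List.mem_cons.1 hq with rfl | hq
    · simp [State.cup]
    · obtain ⟨q, hq₁, rfl⟩ := List.mem_map.1 hq
      obtain ⟨h1, h2, h3, h4⟩ := h.arc q hq₁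
      simp [State.cup, insertPos_ne, deletePos_insertPos, h1, h2, h3, h4]
  · funext v
    rw [cupT_apply]
    simp only [arcTensor, arcProd_cons, arcProd_renumber, ends_cons, ends_renumber, arcVal_one]
    rw [listSign_cons_cons_eq (Nat.lt_succ_self l), listSign_map]
    · ring
    · intro a _ b _
      simp only [insertPos]; split_ifs <;> omega
    · intro c hc
      obtain ⟨a, -, rfl⟩ := List.mem_map.1 hc
      have := insertPos_ne l a
      omega

theorem Arcs.tail_ne {s : State n} {m : ℕ} {q : ℕ × ℕ × FreeGroup (Fin n)}
    {L : List (ℕ × ℕ × FreeGroup (Fin n))} (h : Arcs s m (q :: L)) {i : ℕ} (hi : i ∈ ends L) :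
    i ≠ q.1 ∧ i ≠ q.2.1 := by
  have := h.nodup
  simp only [ends_cons, List.nodup_cons, List.mem_cons, not_or] at this
  exact ⟨by rintro rfl; exact this.1.2 hi, by rintro rfl; exact this.2.1 hi⟩

theorem crossT_arcTensor_adjacent (Y : Fin n → SL) {l : ℕ} {g : FreeGroup (Fin n)}
    {L : List (ℕ × ℕ × FreeGroup (Fin n))} (h : ∀ i ∈ ends L, i ≠ l ∧ i ≠ l + 1) :
    crossT l (arcTensor Y ((l, l + 1, g) :: L)) = arcTensor Y ((l, l + 1, g⁻¹) :: L) := by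
  funext v
  rw [crossT_apply]
  simp only [arcTensor, arcProd_cons, ends_cons, Equiv.swap_apply_left, Equiv.swap_apply_right,
    arcVal_inv Y g (v (l + 1)) (v l)]
  rw [arcProd_congr Y (v' := v) fun i hi => by
    rw [Equiv.swap_apply_of_ne_of_ne (h i hi).1 (h i hi).2]]
  ring

/-- The minus sign of `crossT` is absorbed by reversing the word if one arc joins both strands, and
otherwise by the transposition of the neighbouring entries `l`, `l + 1` in the list of endpoints. -/
theorem Arcs.cross {s : State n} {m l : ℕ} {L : List (ℕ × ℕ × FreeGroup (Fin n))}
    (h : Arcs s m L) (hl : l + 2 ≤ m) (Y : Fin n → SL) :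
    ∃ L', Arcs (s.permute (Equiv.swap l (l + 1))) m L' ∧
      crossT l (arcTensor Y L) = arcTensor Y L' := by
  rcases h.exists_adjacent hl Y with ⟨g, L, h1, h2⟩ | ⟨x, y, g, k, L, h1, h2⟩
  · have hne := fun i (hi : i ∈ ends L) => h1.tail_ne hi
    refine ⟨(l, l + 1, g⁻¹) :: L, ⟨h1.nodup, h1.mem, fun q hq => ?_⟩, ?_⟩
    · rcases List.mem_cons.1 hq with rfl | hq
      · obtain ⟨h3, h4, h5, h6⟩ := h1.arc _ List.mem_cons_self
        simp only at h3 h4 h5 h6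
        simp [State.permute, h3, h4, h5, h6]
      · obtain ⟨h3, h4, h5, h6⟩ := h1.arc q (List.mem_cons_of_mem _ hq)
        obtain ⟨n1, n2⟩ := hne q.1 (mem_ends.2 ⟨q, hq, Or.inl rfl⟩)
        obtain ⟨n3, n4⟩ := hne q.2.1 (mem_ends.2 ⟨q, hq, Or.inr rfl⟩)
        simp [State.permute, Equiv.swap_apply_of_ne_of_ne n1 n2,
          Equiv.swap_apply_of_ne_of_ne n3 n4, h3, h4, h5, h6]
    · rw [h2, crossT_arcTensor_adjacent Y hne]
  · have hnd := h1.nodup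
    simp only [ends_cons, List.nodup_cons, List.mem_cons, not_or] at hnd
    obtain ⟨⟨a1, a2, a3, a4⟩, ⟨a5, a6, a7⟩, ⟨a8, a9⟩, a10, a11⟩ := hnd
    have hne : ∀ i ∈ ends L, i ≠ l ∧ i ≠ l + 1 := fun i hi =>
      ⟨by rintro rfl; exact a7 hi, by rintro rfl; exact a9 hi⟩
    have hp : (ends ((x, l, g) :: (l + 1, y, k) :: L)).Perm
        (ends ((x, l + 1, g) :: (l, y, k) :: L)) := (List.Perm.swap _ _ _).cons _
    refine ⟨(x, l + 1, g) :: (l, y, k) :: L,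
      ⟨hp.nodup_iff.1 h1.nodup, fun i => hp.mem_iff.symm.trans (h1.mem i), fun q hq => ?_⟩, ?_⟩
    · rcases List.mem_cons.1 hq with rfl | hq
      · obtain ⟨h3, h4, h5, h6⟩ := h1.arc _ List.mem_cons_self
        simp only at h3 h4 h5 h6
        simp [State.permute, Equiv.swap_apply_of_ne_of_ne a1 a2, h3, h4, h5, h6]
      rcases List.mem_cons.1 hq with rfl | hq
      · obtain ⟨h3, h4, h5, h6⟩ := h1.arc _ (List.mem_cons_of_mem _ List.mem_cons_self)
        simp only at h3 h4 h5 h6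
        simp [State.permute, Equiv.swap_apply_of_ne_of_ne (Ne.symm a6) (Ne.symm a8), h3, h4, h5,
          h6]
      · obtain ⟨h3, h4, h5, h6⟩ :=
          h1.arc q (List.mem_cons_of_mem _ (List.mem_cons_of_mem _ hq))
        obtain ⟨n1, n2⟩ := hne q.1 (mem_ends.2 ⟨q, hq, Or.inl rfl⟩)
        obtain ⟨n3, n4⟩ := hne q.2.1 (mem_ends.2 ⟨q, hq, Or.inr rfl⟩)
        simp [State.permute, Equiv.swap_apply_of_ne_of_ne n1 n2,
          Equiv.swap_apply_of_ne_of_ne n3 n4, h3, h4, h5, h6]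
    · rw [h2]
      funext v
      rw [crossT_apply]
      simp only [arcTensor, arcProd_cons, ends_cons, Equiv.swap_apply_left,
        Equiv.swap_apply_right, Equiv.swap_apply_of_ne_of_ne a1 a2,
        Equiv.swap_apply_of_ne_of_ne (Ne.symm a6) (Ne.symm a8)]
      rw [arcProd_congr Y (v' := v) fun i hi => by
        rw [Equiv.swap_apply_of_ne_of_ne (hne i hi).1 (hne i hi).2],
        listSign_swap_cons x (show l ≠ l + 1 by omega)]
      ring

theorem deletePos_lt_iff {l i j : ℕ} (h1 : i ≠ l) (h2 : i ≠ l + 1) (h3 : j ≠ l)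
    (h4 : j ≠ l + 1) : deletePos l i < deletePos l j ↔ i < j := by
  simp only [deletePos]; split_ifs <;> omega

theorem insertTwo_deletePos {l i : ℕ} (h1 : i ≠ l) (h2 : i ≠ l + 1) (a b : Fin 2)
    (v : ℕ → Fin 2) : insertTwo l a b v i = v (deletePos l i) := by
  conv_lhs => rw [← insertPos_deletePos h1 h2]
  rw [insertTwo_insertPos]

theorem mem_map_deletePos {l m : ℕ} {E : List ℕ} (hm : ∀ i, i ∈ E ↔ i < m + 2 ∧ i ≠ l ∧ i ≠ l + 1)
    (hl : l ≤ m) (i : ℕ) : i ∈ E.map (deletePos l) ↔ i < m := by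
  simp only [List.mem_map, hm]
  constructor
  · rintro ⟨a, ⟨h1, h2, h3⟩, rfl⟩
    simp only [deletePos]; split_ifs <;> omega
  · intro hi
    exact ⟨insertPos l i, ⟨by simp only [insertPos]; split_ifs <;> omega, insertPos_ne l i⟩,
      deletePos_insertPos l i⟩

theorem nodup_map_deletePos {l : ℕ} {E : List ℕ} (hn : E.Nodup)
    (hm : ∀ i ∈ E, i ≠ l ∧ i ≠ l + 1) : (E.map (deletePos l)).Nodup := by
  refine List.Nodup.map_on (fun a ha b hb hab => ?_) hn
  rw [← insertPos_deletePos (hm a ha).1 (hm a ha).2, hab,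
    insertPos_deletePos (hm b hb).1 (hm b hb).2]

/-- A maximum over one arc closes a component and splits off minus its trace (`arcVal_close`); over
two arcs it multiplies their words (`arcVal_join`). -/
theorem Arcs.cap {s : State n} {m l : ℕ} {L : List (ℕ × ℕ × FreeGroup (Fin n))}
    (h : Arcs s (m + 2) L) (hl : l ≤ m) (Y : Fin n → SL) :
    ∃ L', Arcs (s.cap l) m L' ∧
      capT l (loopsVal Y s • arcTensor Y L) = loopsVal Y (s.cap l) • arcTensor Y L' := by
  rcases h.exists_adjacent (show l + 2 ≤ m + 2 by omega) Y with
    ⟨g, L, h1, h2⟩ | ⟨x, y, g, k, L, h1, h2⟩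
  · have hnd := h1.nodup
    simp only [ends_cons, List.nodup_cons, List.mem_cons, not_or] at hnd
    obtain ⟨⟨-, a1⟩, a2, a3⟩ := hnd
    have hne : ∀ i ∈ ends L, i ≠ l ∧ i ≠ l + 1 := fun i hi => h1.tail_ne hi
    obtain ⟨b1, b2, b3, b4⟩ := h1.arc _ List.mem_cons_self
    simp only at b1 b2 b3 b4
    refine ⟨renumber (deletePos l) L, ⟨?_, fun i => ?_, fun q hq => ?_⟩, ?_⟩
    · rw [ends_renumber]
      exact nodup_map_deletePos a3 hne
    · rw [ends_renumber]
      refine mem_map_deletePos (fun i => ?_) hl i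
      have := h1.mem i
      simp only [ends_cons, List.mem_cons] at this
      refine ⟨fun hi => ⟨this.1 (Or.inr (Or.inr hi)), hne i hi⟩, fun hi => ?_⟩
      exact ((this.2 hi.1).resolve_left hi.2.1).resolve_left hi.2.2
    · obtain ⟨q, hq₁, rfl⟩ := List.mem_map.1 hq
      obtain ⟨h3, h4, h5, h6⟩ := h1.arc q (List.mem_cons_of_mem _ hq₁)
      obtain ⟨n1, n2⟩ := hne q.1 (mem_ends.2 ⟨q, hq₁, Or.inl rfl⟩)
      obtain ⟨n3, n4⟩ := hne q.2.1 (mem_ends.2 ⟨q, hq₁, Or.inr rfl⟩)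
      simp [State.cap, insertPos_deletePos n1 n2, insertPos_deletePos n3 n4, h3, h4, h5, h6, n1,
        n2, n3, n4]
    · have hloops : loopsVal Y (s.cap l) = -loopTrace Y (loopClass g) * loopsVal Y s := by
        simp only [loopsVal, State.cap, if_pos b1, b3, Multiset.map_cons, Multiset.prod_cons]
      funext v
      rw [map_smul, h2, hloops, Pi.smul_apply, Pi.smul_apply, capT_apply, smul_eq_mul, smul_eq_mul,
        ← arcVal_close]
      simp only [arcTensor, arcProd_cons, ends_cons, insertTwo_left, insertTwo_right,
        arcProd_renumber, ends_renumber]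
      rw [listSign_cons_cons_eq (Nat.lt_succ_self l) (fun c hc => by
          have := hne c hc; omega),
        listSign_map fun a ha b hb => deletePos_lt_iff (hne a ha).1 (hne a ha).2 (hne b hb).1
          (hne b hb).2]
      have e : ∀ a b, arcProd Y L (insertTwo l a b v) = arcProd Y L fun i => v (deletePos l i) :=
        fun a b => arcProd_congr Y fun i hi => insertTwo_deletePos (hne i hi).1 (hne i hi).2 _ _ _
      rw [e, e]
      ring
  · have hnd := h1.nodup
    simp only [ends_cons, List.nodup_cons, List.mem_cons, not_or] at hnd
    obtain ⟨⟨a1, a2, a3, a4⟩, ⟨a5, a6, a7⟩, ⟨a8, a9⟩, a10, a11⟩ := hnd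
    have hne : ∀ i ∈ x :: y :: ends L, i ≠ l ∧ i ≠ l + 1 := by
      intro i hi
      rcases List.mem_cons.1 hi with rfl | hi
      · exact ⟨a1, a2⟩
      rcases List.mem_cons.1 hi with rfl | hi
      · exact ⟨Ne.symm a6, Ne.symm a8⟩
      · exact ⟨by rintro rfl; exact a7 hi, by rintro rfl; exact a9 hi⟩
    have hnd' : (x :: y :: ends L).Nodup := by
      simp only [List.nodup_cons, List.mem_cons, not_or]
      exact ⟨⟨a3, a4⟩, a10, a11⟩
    have hxy : y ≠ l ∧ y ≠ l + 1 := ⟨Ne.symm a6, Ne.symm a8⟩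
    obtain ⟨b1, b2, b3, b4⟩ := h1.arc _ List.mem_cons_self
    obtain ⟨c1, c2, c3, c4⟩ := h1.arc _ (List.mem_cons_of_mem _ List.mem_cons_self)
    simp only at b1 b2 b3 b4 c1 c2 c3 c4
    have he : ends ((deletePos l x, deletePos l y, g * k) :: renumber (deletePos l) L) =
        (x :: y :: ends L).map (deletePos l) := by
      rw [ends_cons, ends_renumber]; rfl
    refine ⟨(deletePos l x, deletePos l y, g * k) :: renumber (deletePos l) L,
      ⟨?_, fun i => ?_, fun q hq => ?_⟩, ?_⟩
    · rw [he]
      exact nodup_map_deletePos hnd' hne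
    · rw [he]
      refine mem_map_deletePos (fun i => ?_) hl i
      have := h1.mem i
      simp only [ends_cons, List.mem_cons] at this
      refine ⟨fun hi => ⟨this.1 ?_, hne i hi⟩, fun hi => ?_⟩
      · simp only [List.mem_cons] at hi; tauto
      · have := this.2 hi.1
        simp only [List.mem_cons]; tauto
    · rcases List.mem_cons.1 hq with rfl | hq
      · have : l + 1 ≠ l := by omega
        simp [State.cap, insertPos_deletePos a1 a2, insertPos_deletePos hxy.1 hxy.2, b1, b2, b3,
          b4, c1, c2, c3, c4]
      · obtain ⟨q, hq₁, rfl⟩ := List.mem_map.1 hq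
        obtain ⟨h3, h4, h5, h6⟩ := h1.arc q (List.mem_cons_of_mem _ (List.mem_cons_of_mem _ hq₁))
        have m1 : q.1 ∈ ends L := mem_ends.2 ⟨q, hq₁, Or.inl rfl⟩
        have m2 : q.2.1 ∈ ends L := mem_ends.2 ⟨q, hq₁, Or.inr rfl⟩
        obtain ⟨n1, n2⟩ := hne q.1 (List.mem_cons_of_mem _ (List.mem_cons_of_mem _ m1))
        obtain ⟨n3, n4⟩ := hne q.2.1 (List.mem_cons_of_mem _ (List.mem_cons_of_mem _ m2))
        simp [State.cap, insertPos_deletePos n1 n2, insertPos_deletePos n3 n4, h3, h4, h5, h6, n1,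
          n2, n3, n4]
    · have hloops : loopsVal Y (s.cap l) = loopsVal Y s := by
        simp only [loopsVal, State.cap, b2, if_neg a2]
      -- No other endpoint lies between `l` and `l + 1`, so each compares equally with both, and
      -- this pair contributes no sign.
      have hsign : listSign (x :: l :: (l + 1) :: y :: ends L) = listSign (x :: y :: ends L) := by
        rw [listSign_cons x, listSign_cons_cons_eq (Nat.lt_succ_self l) (fun c hc => by
          have := hne c (List.mem_cons_of_mem _ hc); omega), listSign]
        simp only [List.map_cons, List.prod_cons]
        rw [listSign_cons x, listSign_cons y]
        simp only [List.map_cons, List.prod_cons]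
        by_cases hx : x < l
        · rw [if_pos hx, if_pos (by omega)]; ring
        · rw [if_neg hx, if_neg (by omega)]; ring
      funext v
      rw [map_smul, h2, hloops, Pi.smul_apply, Pi.smul_apply, capT_apply]
      simp only [arcTensor, arcProd_cons, he, arcProd_renumber]
      simp only [ends_cons, insertTwo_left, insertTwo_right, insertTwo_deletePos a1 a2,
        insertTwo_deletePos hxy.1 hxy.2]
      rw [hsign, listSign_map fun a ha b hb => deletePos_lt_iff (hne a ha).1 (hne a ha).2
        (hne b hb).1 (hne b hb).2, ← arcVal_join]
      have e : ∀ a b, arcProd Y L (insertTwo l a b v) = arcProd Y L fun i => v (deletePos l i) :=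
        fun a b => arcProd_congr Y fun i hi => by
          have := hne i (List.mem_cons_of_mem _ (List.mem_cons_of_mem _ hi))
          exact insertTwo_deletePos this.1 this.2 _ _ _
      rw [e, e, smul_eq_mul, smul_eq_mul]
      ring

/-- The arcs after the strands in `U` have crossed the `j`-th cut. -/
def relabel (j : Fin n) (U : ℕ → Prop) [DecidablePred U] (L : List (ℕ × ℕ × FreeGroup (Fin n))) :
    List (ℕ × ℕ × FreeGroup (Fin n)) :=
  L.map fun q => (q.1, q.2.1, (if U q.1 then FreeGroup.of j else 1)⁻¹ * q.2.2 *
    (if U q.2.1 then FreeGroup.of j else 1))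

theorem ends_relabel (j : Fin n) (U : ℕ → Prop) [DecidablePred U]
    (L : List (ℕ × ℕ × FreeGroup (Fin n))) : ends (relabel j U L) = ends L := by
  induction L with
  | nil => rfl
  | cons q L ih =>
    change q.1 :: q.2.1 :: ends (relabel j U L) = _
    rw [ih]; rfl

theorem actT_mul (Z : Mat) (i : ℕ) (A B : Tensor) (hB : ∀ v a, B (Function.update v i a) = B v) :
    actT Z i (fun v => A v * B v) = fun v => actT Z i A v * B v := by
  funext v
  simp only [actT_apply, hB, Finset.sum_mul, mul_assoc]

/-- Only the arc ending at `i` depends on that index; the matrix multiplies its word on the left or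
on the right, according to which end `i` is. -/
theorem actT_arcProd (Y : Fin n → SL) (j : Fin n) {i : ℕ}
    {L : List (ℕ × ℕ × FreeGroup (Fin n))} (hn : (ends L).Nodup) (hi : i ∈ ends L) :
    actT (Y j).1 i (arcProd Y L) = arcProd Y (relabel j (fun x => x = i) L) := by
  induction L with
  | nil => simp at hi
  | cons q L ih =>
    obtain ⟨a, b, g⟩ := q
    have hn' := hn
    simp only [ends_cons, List.nodup_cons, List.mem_cons, not_or] at hn hi
    obtain ⟨⟨hab, ha⟩, hb, hL⟩ := hn
    have hcons : arcProd Y ((a, b, g) :: L) = fun v => arcVal Y g (v a) (v b) * arcProd Y L v :=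
      funext fun v => arcProd_cons Y _ L v
    have hrel : ∀ v, arcProd Y (relabel j (fun x => x = i) ((a, b, g) :: L)) v =
        arcVal Y ((if a = i then FreeGroup.of j else 1)⁻¹ * g *
          (if b = i then FreeGroup.of j else 1)) (v a) (v b) *
          arcProd Y (relabel j (fun x => x = i) L) v := fun v => arcProd_cons Y _ _ v
    by_cases hiL : i ∈ ends L
    · have hia : a ≠ i := by rintro rfl; exact ha hiL
      have hib : b ≠ i := by rintro rfl; exact hb hiL
      have : arcProd Y ((a, b, g) :: L) = fun v => arcProd Y L v * arcVal Y g (v a) (v b) := by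
        rw [hcons]; funext v; ring
      rw [this, actT_mul _ _ (arcProd Y L) (fun v => arcVal Y g (v a) (v b)) (fun v c => by
        rw [Function.update_of_ne hia, Function.update_of_ne hib]), ih hL hiL]
      funext v
      rw [hrel, if_neg hia, if_neg hib]
      simp [mul_comm]
    · have hrelL : relabel j (fun x => x = i) L = L := by
        conv_rhs => rw [← List.map_id L]
        refine List.map_congr_left fun q hq => ?_
        have h1 : q.1 ≠ i := by rintro rfl; exact hiL (mem_ends.2 ⟨q, hq, Or.inl rfl⟩)
        have h2 : q.2.1 ≠ i := by rintro rfl; exact hiL (mem_ends.2 ⟨q, hq, Or.inr rfl⟩)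
        simp [h1, h2]
      rw [hcons, actT_mul _ _ (fun v => arcVal Y g (v a) (v b)) (arcProd Y L) (fun v c =>
        arcProd_congr Y fun x hx => Function.update_of_ne (by rintro rfl; exact hiL hx) _ _)]
      funext v
      rw [hrel, hrelL]
      congr 1
      rw [actT_apply]
      rcases hi with rfl | rfl | hi
      · simp only [Function.update_self, Function.update_of_ne (Ne.symm hab)]
        rw [arcVal_of_inv_mul]
        simp [Ne.symm hab]
      · simp only [Function.update_self, Function.update_of_ne hab]
        rw [arcVal_mul_of]
        simp [hab]
      · exact absurd hi hiL

theorem holeT_arcTensor (Y : Fin n → SL) (j : Fin n) {l : ℕ}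
    {L : List (ℕ × ℕ × FreeGroup (Fin n))} (hn : (ends L).Nodup) (hl : ∀ i < l, i ∈ ends L) :
    holeT (Y j).1 l (arcTensor Y L) = arcTensor Y (relabel j (fun x => x < l) L) := by
  induction l with
  | zero =>
    have : relabel j (fun x => x < 0) L = L := by
      conv_rhs => rw [← List.map_id L]
      exact List.map_congr_left fun q hq => by simp
    rw [this]; rfl
  | succ l ih =>
    have hrel : relabel j (fun x => x = l) (relabel j (fun x => x < l) L) =
        relabel j (fun x => x < l + 1) L := by
      simp only [relabel, List.map_map]
      refine List.map_congr_left fun q _ => ?_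
      simp only [Function.comp, Prod.mk.injEq, true_and]
      have h : ∀ x : ℕ, (if x < l + 1 then FreeGroup.of j else 1) =
          (if x < l then FreeGroup.of j else 1) * (if x = l then FreeGroup.of j else 1) := by
        intro x
        rcases Nat.lt_trichotomy x l with hx | hx | hx
        · rw [if_pos (by omega), if_pos hx, if_neg (by omega), mul_one]
        · rw [if_pos (by omega), if_neg (by omega), if_pos hx, one_mul]
        · rw [if_neg (by omega), if_neg (by omega), if_neg (by omega), mul_one]
      rw [h, h, mul_inv_rev]
      group
    rw [holeT_succ, ih fun i hi => hl i (by omega), ← hrel]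
    have h1 : arcTensor Y (relabel j (fun x => x < l) L) =
        listSign (ends L) • arcProd Y (relabel j (fun x => x < l) L) := by
      funext v; rw [arcTensor, ends_relabel]; rfl
    rw [h1, map_smul, actT_arcProd Y j (by rwa [ends_relabel])
      (by rw [ends_relabel]; exact hl l (Nat.lt_succ_self l))]
    funext v
    rw [arcTensor, ends_relabel, ends_relabel]; rfl

theorem Arcs.hole {s : State n} {m l : ℕ} {L : List (ℕ × ℕ × FreeGroup (Fin n))}
    (h : Arcs s m L) (j : Fin n) (hl : l ≤ m) (Y : Fin n → SL) :
    Arcs (s.hole j l) m (relabel j (fun x => x < l) L) ∧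
      holeT (Y j).1 l (arcTensor Y L) = arcTensor Y (relabel j (fun x => x < l) L) := by
  refine ⟨⟨by rw [ends_relabel]; exact h.nodup, by rw [ends_relabel]; exact h.mem,
    fun q hq => ?_⟩, holeT_arcTensor Y j h.nodup fun i hi => (h.mem i).2 (by omega)⟩
  obtain ⟨q, hq₁, rfl⟩ := List.mem_map.1 hq
  obtain ⟨h1, h2, h3, h4⟩ := h.arc q hq₁
  simp only [State.hole, h1, h2, h3, h4, true_and]
  split_ifs <;> simp [mul_assoc]

/-- The value of a tangle is given by the classes of its components and the words of its arcs. -/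
theorem exists_arcs (Y : Fin n → SL) {w : List (Slice n)} {m : ℕ} (h : IsTangle 0 w m) :
    ∃ L, Arcs (w.foldl State.step (State.init n)) m L ∧
      wordT Y w 1 = loopsVal Y (w.foldl State.step (State.init n)) • arcTensor Y L := by
  induction w using List.reverseRecOn generalizing m with
  | nil =>
    obtain rfl : 0 = m := h
    refine ⟨[], ⟨by simp, by simp, by simp⟩, ?_⟩
    funext v
    simp [wordT_nil, loopsVal, arcTensor, arcProd, listSign, State.init]
  | append_singleton w s ih =>
    obtain ⟨k, h1, h2, h3⟩ := h.split
    obtain ⟨L, hL, hw⟩ := ih h1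
    obtain ⟨l, g, r⟩ := s
    rw [wordT_append, hw, List.foldl_append]
    set st := w.foldl State.step (State.init n)
    cases g with
    | cup =>
      simp only [IsTangle, Piece.src, Piece.tgt] at h2 h3
      obtain rfl : m = k + 2 := by omega
      obtain ⟨h4, h5⟩ := hL.cup (show l ≤ k by omega) Y
      refine ⟨_, h4, ?_⟩
      rw [← h5, ← map_smul]; rfl
    | cap =>
      simp only [IsTangle, Piece.src, Piece.tgt] at h2 h3
      obtain rfl : k = m + 2 := by omega
      exact hL.cap (show l ≤ m by omega) Y
    | cross c =>
      simp only [IsTangle, Piece.src, Piece.tgt] at h2 h3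
      obtain rfl : k = m := by omega
      obtain ⟨L', h4, h5⟩ := hL.cross (show l + 2 ≤ k by omega) Y
      refine ⟨L', h4, ?_⟩
      rw [← h5, ← map_smul]; rfl
    | hole j =>
      simp only [IsTangle, Piece.src, Piece.tgt] at h2 h3
      obtain rfl : k = m := by omega
      obtain ⟨h4, h5⟩ := hL.hole j (show l ≤ k by omega) Y
      refine ⟨_, h4, ?_⟩
      rw [← h5, ← map_smul]; rfl

theorem Diagram.wordT_eq (Y : Fin n → SL) (D : Diagram n) (v : ℕ → Fin 2) :
    wordT Y D.word 1 v = (D.components.map fun c => -loopTrace Y c).prod := by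
  obtain ⟨L, hL, h⟩ := exists_arcs Y D.closed
  have : L = [] := by
    rcases L with _ | ⟨q, L⟩
    · rfl
    · exact absurd ((hL.mem q.1).1 (by simp)) (Nat.not_lt_zero _)
  subst this
  rw [h]
  simp [arcTensor, arcProd, listSign, loopsVal, Diagram.components]

theorem Diagram.eval_eq (Y : Fin n → SL) (D : Diagram n) :
    D.eval Y = (D.components.map fun c => -loopTrace Y c).prod := D.wordT_eq Y 0

/-- The skein module of the handlebody is determined by evaluation. -/
theorem sum_toV_eq_zero {ι : Type*} (s : Finset ι) (c : ι → ℂ) (D : ι → Diagram n)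
    (h : ∀ Y, ∑ i ∈ s, c i * (D i).eval Y = 0) : ∑ i ∈ s, c i • (D i).toV = 0 := by
  -- The relation already holds among open tangles, where evaluations separate skeins; `closedSkein`
  -- then carries it to `V n`.
  have h1 : ∑ i ∈ s, c i • cls (D i).word = 0 := by
    refine evalO_injective (List.nodup_finRange n) (m := 0)
      (sum_mem fun i _ => Submodule.smul_mem _ _ (cls_mem_tangles ⟨(D i).closed, (D i).holes⟩))
      fun Y => ?_
    funext v
    rw [map_sum, Finset.sum_apply, Pi.zero_apply, ← h Y]
    refine Finset.sum_congr rfl fun i _ => ?_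
    rw [map_smul, evalO_cls Y (D i).closed, Pi.smul_apply, Diagram.wordT_eq, Diagram.eval_eq,
      smul_eq_mul]
  have h2 := congr_arg (closedSkein n) h1
  simpa [closedSkein_cls] using h2

end

section

open Matrix Finset

/-! ### Traces of products along cycles -/

/-- The entries of a matrix product are sums over paths of indices. The weight `G` on the two ends
makes the induction work and later closes the path to a trace. -/
theorem sum_prod_path (M : ℕ → Mat) (q : ℕ) (G : Fin 2 → Fin 2 → ℂ) :
    ∑ a, ∑ b, ((List.range q).map M).prod a b * G a b =
      ∑ g : Fin (q + 1) → Fin 2,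
        (∏ k : Fin q, M k (g k.castSucc) (g k.succ)) * G (g 0) (g (Fin.last q)) := by
  induction q generalizing G with
  | zero =>
    rw [← (Equiv.funUnique (Fin 1) (Fin 2)).symm.sum_comp]
    simp [Fin.sum_univ_two, Matrix.one_apply]
  | succ q ih =>
    have h : ∀ a, ∑ b, ((List.range (q + 1)).map M).prod a b * G a b =
        ∑ b, ((List.range q).map M).prod a b * ∑ c, M q b c * G a c := by
      intro a
      simp only [List.range_succ, List.map_append, List.prod_append, List.map_cons, List.map_nil,
        List.prod_cons, List.prod_nil, mul_one, Matrix.mul_apply, Finset.sum_mul, Finset.mul_sum]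
      rw [Finset.sum_comm]
      exact Finset.sum_congr rfl fun b _ => Finset.sum_congr rfl fun c _ => by ring
    rw [Finset.sum_congr rfl fun a _ => h a, ih fun a b => ∑ c, M q b c * G a c,
      ← (Fin.snocEquiv fun _ : Fin (q + 2) => Fin 2).sum_comp, Fintype.sum_prod_type,
      Finset.sum_comm]
    refine Finset.sum_congr rfl fun g _ => ?_
    rw [Finset.mul_sum]
    refine Finset.sum_congr rfl fun c _ => ?_
    simp only [Fin.snocEquiv, Equiv.coe_fn_mk, Fin.prod_univ_castSucc (n := q)]
    have h0 : (Fin.snoc (α := fun _ => Fin 2) g c : Fin (q + 2) → Fin 2) 0 = g 0 :=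
      Fin.snoc_castSucc (α := fun _ => Fin 2) c g 0
    have h1 : ∀ k : Fin q, (Fin.snoc (α := fun _ => Fin 2) g c : Fin (q + 2) → Fin 2)
        k.castSucc.succ = g k.succ := fun k => by
      rw [← Fin.castSucc_succ]; exact Fin.snoc_castSucc (α := fun _ => Fin 2) c g k.succ
    simp only [h0, h1, Fin.snoc_castSucc, Fin.snoc_last, Fin.succ_last, Fin.val_castSucc,
      Fin.val_last]
    ring

theorem trace_prod_range (M : ℕ → Mat) (q : ℕ) :
    ((List.range (q + 1)).map M).prod.trace =
      ∑ g : Fin (q + 1) → Fin 2, ∏ k : Fin (q + 1), M k (g k) (g (k + 1)) := by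
  have h := sum_prod_path M q fun a b => M q b a
  simp only [Fin.prod_univ_castSucc (n := q), Fin.coeSucc_eq_succ, Fin.last_add_one,
    Fin.val_castSucc, Fin.val_last]
  rw [← h]
  simp [List.range_succ, Matrix.trace, Matrix.mul_apply]

variable {n : ℕ}

/-- The trace of the product of the matrices `Z` along the cycle of `σ` through `i`. -/
def cycleTrace (Z : Fin n → Mat) (σ : Equiv.Perm (Fin n)) (i : Fin n) : ℂ :=
  ((List.range (Function.minimalPeriod σ i)).map fun k => Z ((σ ^ k) i)).prod.trace

open Classical in
/-- The product of the traces of the matrices `Z` along the cycles of `σ` on `T`. -/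
def cyclesTrace (T : Finset (Fin n)) (σ : Equiv.Perm (Fin n)) (Z : Fin n → Mat) : ℂ :=
  ∏ i ∈ T with ∀ j, σ.SameCycle i j → i ≤ j, cycleTrace Z σ i

theorem minimalPeriod_pos (σ : Equiv.Perm (Fin n)) (i : Fin n) :
    0 < Function.minimalPeriod σ i :=
  Function.minimalPeriod_pos_of_mem_periodicPts
    (σ.injective.mem_periodicPts i)

/-- The elements of a cycle of `σ`, as powers of `σ` applied to `i`. -/
def cycleEquiv (σ : Equiv.Perm (Fin n)) (i : Fin n) {q : ℕ}
    (hq : Function.minimalPeriod σ i = q + 1) :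
    Fin (q + 1) ≃ {j // (Quotient.mk (Equiv.Perm.SameCycle.setoid σ) j) = Quotient.mk _ i} :=
  Equiv.ofBijective (fun k => ⟨(σ ^ (k : ℕ)) i, Quotient.sound
    (Equiv.Perm.SameCycle.symm ⟨(k : ℕ), by simp⟩)⟩) (by
    constructor
    · intro a b hab
      have h : σ^[a] i = σ^[b] i := by
        simpa [← Equiv.Perm.iterate_eq_pow] using congrArg Subtype.val hab
      exact Fin.ext (Function.iterate_injOn_Iio_minimalPeriod
        (by simpa [hq] using a.2) (by simpa [hq] using b.2) h)
    · rintro ⟨j, hj⟩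
      obtain ⟨k, -, hk⟩ := (Equiv.Perm.SameCycle.symm (Quotient.exact hj)).exists_pow_eq'
      refine ⟨⟨k % (q + 1), Nat.mod_lt _ (Nat.succ_pos q)⟩, Subtype.ext ?_⟩
      change (σ ^ (k % (q + 1))) i = j
      rw [← hk, ← Equiv.Perm.iterate_eq_pow, ← Equiv.Perm.iterate_eq_pow, ← hq,
        Function.iterate_mod_minimalPeriod_eq])

theorem cycleEquiv_add_one (σ : Equiv.Perm (Fin n)) (i : Fin n) {q : ℕ}
    (hq : Function.minimalPeriod σ i = q + 1) (k : Fin (q + 1)) :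
    (cycleEquiv σ i hq (k + 1)).1 = σ (cycleEquiv σ i hq k).1 := by
  change (σ ^ ((k + 1 : Fin (q + 1)) : ℕ)) i = σ ((σ ^ (k : ℕ)) i)
  rw [← Equiv.Perm.mul_apply, ← pow_succ', ← Equiv.Perm.iterate_eq_pow,
    ← Equiv.Perm.iterate_eq_pow, Fin.val_add, Fin.val_one', Nat.add_mod_mod]
  conv_lhs => rw [show (k + 1 : ℕ) % (q + 1) = (k + 1 : ℕ) % Function.minimalPeriod σ i by rw [hq]]
  exact Function.iterate_mod_minimalPeriod_eq

theorem mk_apply_eq {σ : Equiv.Perm (Fin n)} {j : Fin n}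
    {c : Quotient (Equiv.Perm.SameCycle.setoid σ)} (h : Quotient.mk _ j = c) :
    Quotient.mk (Equiv.Perm.SameCycle.setoid σ) (σ j) = c :=
  h ▸ Quotient.sound (Equiv.Perm.sameCycle_apply_left.2 (Equiv.Perm.SameCycle.refl σ j))

open Classical in
-- The path of indices closes up along the cycle, so it is a labelling of the orbit. In this form
-- the starting point `i` no longer matters beyond its orbit.
theorem cycleTrace_eq (Z : Fin n → Mat) (σ : Equiv.Perm (Fin n)) (i : Fin n) :
    cycleTrace Z σ i =
      ∑ g : {j // (Quotient.mk (Equiv.Perm.SameCycle.setoid σ) j) = Quotient.mk _ i} → Fin 2,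
        ∏ j, Z j.1 (g j) (g ⟨σ j.1, mk_apply_eq j.2⟩) := by
  obtain ⟨q, hq⟩ : ∃ q, Function.minimalPeriod σ i = q + 1 :=
    ⟨_, (Nat.succ_pred_eq_of_pos (minimalPeriod_pos σ i)).symm⟩
  rw [cycleTrace, hq, trace_prod_range,
    ← (Equiv.arrowCongr (cycleEquiv σ i hq) (Equiv.refl (Fin 2))).sum_comp]
  refine Finset.sum_congr rfl fun g _ => ?_
  rw [← (cycleEquiv σ i hq).prod_comp]
  refine Finset.prod_congr rfl fun k _ => ?_
  have : (⟨σ (cycleEquiv σ i hq k).1, mk_apply_eq (cycleEquiv σ i hq k).2⟩ :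
      {j // (Quotient.mk (Equiv.Perm.SameCycle.setoid σ) j) = Quotient.mk _ i}) =
      cycleEquiv σ i hq (k + 1) := Subtype.ext (cycleEquiv_add_one σ i hq k).symm
  rw [this]
  simp only [Equiv.arrowCongr_apply, Function.comp, Equiv.symm_apply_apply, Equiv.refl_apply]
  rfl

/-- The traces along the cycles of a permutation as a state sum. -/
theorem cyclesTrace_univ (σ : Equiv.Perm (Fin n)) (Z : Fin n → Mat) :
    cyclesTrace univ σ Z = ∑ f : Fin n → Fin 2, ∏ i, Z i (f i) (f (σ i)) := by
  classical
  let Q := Quotient (Equiv.Perm.SameCycle.setoid σ)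
  let F : Q → ℂ := fun c => ∑ g : {j // (Quotient.mk (Equiv.Perm.SameCycle.setoid σ) j) = c} →
    Fin 2, ∏ j, Z j.1 (g j) (g ⟨σ j.1, mk_apply_eq j.2⟩)
  have h1 : cyclesTrace univ σ Z = ∏ c : Q, F c := by
    rw [cyclesTrace]
    -- Each orbit is represented by its smallest element, the letter from which `cycleMonomial`
    -- writes the cycle.
    refine Finset.prod_bij (fun i _ => Quotient.mk _ i) (fun _ _ => mem_univ _) ?_ ?_
      fun i _ => by convert cycleTrace_eq Z σ i
    · intro i hi j hj hij
      have h := Quotient.exact hij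
      exact le_antisymm ((mem_filter.1 hi).2 j h)
        ((mem_filter.1 hj).2 i (Equiv.Perm.SameCycle.symm h))
    · intro c _
      induction c using Quotient.inductionOn with
      | h i =>
      obtain ⟨j, hj, hmin⟩ := Finset.exists_min_image (univ.filter fun j => σ.SameCycle i j) id
        ⟨i, mem_filter.2 ⟨mem_univ _, Equiv.Perm.SameCycle.refl σ i⟩⟩
      have hj := (mem_filter.1 hj).2
      exact ⟨j, mem_filter.2 ⟨mem_univ _, fun k hk => hmin k
        (mem_filter.2 ⟨mem_univ _, hj.trans hk⟩)⟩, Quotient.sound (Equiv.Perm.SameCycle.symm hj)⟩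
  rw [h1, Finset.prod_univ_sum, Fintype.piFinset_univ]
  -- A labelling of all indices is a labelling of each orbit separately, so the state sum factors
  -- over the orbits.
  let e : (Fin n → Fin 2) ≃
      ((c : Q) → {j // (Quotient.mk (Equiv.Perm.SameCycle.setoid σ) j) = c} → Fin 2) :=
    { toFun := fun f c j => f j.1
      invFun := fun g i => g (Quotient.mk _ i) ⟨i, rfl⟩
      left_inv := fun f => rfl
      right_inv := fun g => by
        funext c ⟨j, hj⟩
        subst hj
        rfl }
  rw [← e.sum_comp]
  refine Finset.sum_congr rfl fun f _ => ?_
  rw [← Finset.prod_fiberwise univ (fun i => (Quotient.mk _ i : Q))]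
  refine Finset.prod_congr rfl fun c _ => ?_
  exact (Finset.prod_subtype (univ.filter fun i => (Quotient.mk _ i : Q) = c) (by simp)
    fun i => Z i (f i) (f (σ i))).symm

/-! ### Linear relations between traces -/

theorem span_SL : Submodule.span ℂ (Set.range fun A : SL => A.1) = ⊤ := by
  rw [eq_top_iff]
  rintro X -
  have hU : (!![1, 1; 0, 1] : Mat).det = 1 := by simp [Matrix.det_fin_two]
  have hL : (!![1, 0; 1, 1] : Mat).det = 1 := by simp [Matrix.det_fin_two]
  have hD : (!![2, 0; 0, 2⁻¹] : Mat).det = 1 := by simp [Matrix.det_fin_two]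
  have h : ∀ A : Mat, A.det = 1 → A ∈ Submodule.span ℂ (Set.range fun A : SL => A.1) :=
    fun A hA => Submodule.subset_span ⟨⟨A, hA⟩, rfl⟩
  have h1 := h 1 Matrix.det_one
  -- The unipotent matrices minus 1 are the off-diagonal elementary matrices. Subtracting half the
  -- identity from the diagonal matrix leaves 3/2 in the upper left corner, whence the factor 2/3.
  have : X = X 0 1 • (!![1, 1; 0, 1] - 1) + X 1 0 • (!![1, 0; 1, 1] - 1) +
      (X 0 0 - X 1 1) • ((2 / 3 : ℂ) • (!![2, 0; 0, 2⁻¹] - (2⁻¹ : ℂ) • 1)) + X 1 1 • (1 : Mat) := by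
    ext i j
    fin_cases i <;> fin_cases j <;> (simp; try ring)
  rw [this]
  exact add_mem (add_mem (add_mem (Submodule.smul_mem _ _ (sub_mem (h _ hU) h1))
    (Submodule.smul_mem _ _ (sub_mem (h _ hL) h1))) (Submodule.smul_mem _ _ (Submodule.smul_mem _ _
    (sub_mem (h _ hD) (Submodule.smul_mem _ _ h1))))) (Submodule.smul_mem _ _ h1)

/-- A multilinear function of matrices that vanishes on matrices of determinant one is zero. -/
theorem multilinear_eq_zero (Φ : MultilinearMap ℂ (fun _ : Fin n => Mat) ℂ)
    (h : ∀ Y : Fin n → SL, (Φ fun i => (Y i).1) = 0) (Z : Fin n → Mat) : Φ Z = 0 := by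
  -- The arguments are freed one at a time: in each of them the function is linear and vanishes on a
  -- spanning set.
  have key : ∀ (s : Finset (Fin n)) (Z : Fin n → Mat), (∀ i ∉ s, (Z i).det = 1) → Φ Z = 0 := by
    intro s
    induction s using Finset.induction_on with
    | empty => exact fun Z hZ => h fun i => ⟨Z i, hZ i (notMem_empty i)⟩
    | insert i s hi ih =>
      intro Z hZ
      have h1 : Φ.toLinearMap Z i = 0 := LinearMap.ext_on span_SL (by
        rintro _ ⟨A, rfl⟩
        refine ih _ fun j hj => ?_
        rcases eq_or_ne j i with rfl | hji
        · rw [Function.update_self]; exact A.2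
        · rw [Function.update_of_ne hji]
          exact hZ j (by simp [hji, hj]))
      have h2 := LinearMap.congr_fun h1 (Z i)
      simpa using h2
  exact key univ Z fun i hi => absurd (mem_univ i) hi

/-- The state sum of a permutation as a multilinear function of the matrices. -/
def stateSum (σ : Equiv.Perm (Fin n)) : MultilinearMap ℂ (fun _ : Fin n => Mat) ℂ :=
  ∑ f : Fin n → Fin 2, (MultilinearMap.mkPiAlgebra ℂ (Fin n) ℂ).compLinearMap
    fun i => Matrix.entryLinearMap ℂ ℂ (f i) (f (σ i))

theorem stateSum_apply (σ : Equiv.Perm (Fin n)) (Z : Fin n → Mat) :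
    stateSum σ Z = ∑ f : Fin n → Fin 2, ∏ i, Z i (f i) (f (σ i)) := by
  simp [stateSum]

open Classical in
/-- A linear relation between the permutations acting on a tensor power. -/
theorem sum_coeff_eq_zero (c : Equiv.Perm (Fin n) → ℂ)
    (h : ∀ Y : Fin n → SL, ∑ σ, c σ * stateSum σ (fun i => (Y i).1) = 0) (a b : Fin n → Fin 2) :
    ∑ σ ∈ univ.filter (fun σ : Equiv.Perm (Fin n) => a ∘ σ = b), c σ = 0 := by
  have h1 := multilinear_eq_zero (∑ σ, c σ • stateSum σ)
    (fun Y => by simpa [_root_.sum_apply] using h Y)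
    -- On elementary matrices only the labelling `f = a` survives, and the state sum becomes the
    -- matrix coefficient of σ on the tensor power between the basis vectors `a` and `b`.
    fun i => Matrix.single (a i) (b i) 1
  have h2 : ∀ σ : Equiv.Perm (Fin n), stateSum σ (fun i => Matrix.single (a i) (b i) 1) =
      if a ∘ σ = b then 1 else 0 := by
    intro σ
    rw [stateSum_apply, Finset.sum_eq_single a]
    · split_ifs with hab
      · subst hab
        simp
      · obtain ⟨i, hi⟩ := Function.ne_iff.1 hab
        exact Finset.prod_eq_zero (mem_univ i)
          (Matrix.single_apply_of_ne _ _ _ _ _ fun h => hi h.2.symm)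
    · intro f _ hf
      obtain ⟨i, hi⟩ := Function.ne_iff.1 hf
      exact Finset.prod_eq_zero (mem_univ i)
        (Matrix.single_apply_of_ne _ _ _ _ _ fun h => hi h.1.symm)
    · simp
  simpa [_root_.sum_apply, h2, Finset.sum_filter] using h1

/-- The combination acts by zero on the tensor power, hence so does its product with τ. Concretely,
for a fixed labelling `f` the summand depends on σ only through `(f ∘ τ) ∘ σ`, and the coefficients
with a given value of this composite sum to zero by `sum_coeff_eq_zero`. -/
theorem sum_mul_left_eq_zero (c : Equiv.Perm (Fin n) → ℂ)
    (h : ∀ Y : Fin n → SL, ∑ σ, c σ * stateSum σ (fun i => (Y i).1) = 0)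
    (τ : Equiv.Perm (Fin n)) (Z : Fin n → Mat) : ∑ σ, c σ * stateSum (τ * σ) Z = 0 := by
  classical
  simp only [stateSum_apply, Finset.mul_sum]
  rw [Finset.sum_comm]
  refine Finset.sum_eq_zero fun f _ => ?_
  rw [← Finset.sum_fiberwise univ fun σ : Equiv.Perm (Fin n) => (f ∘ τ) ∘ σ]
  refine Finset.sum_eq_zero fun b _ => ?_
  have : ∀ σ ∈ univ.filter fun σ : Equiv.Perm (Fin n) => (f ∘ τ) ∘ σ = b,
      c σ * ∏ i, Z i (f i) (f ((τ * σ) i)) = c σ * ∏ i, Z i (f i) (b i) := by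
    intro σ hσ
    rw [← (mem_filter.1 hσ).2]; rfl
  rw [Finset.sum_congr rfl this, ← Finset.sum_mul, sum_coeff_eq_zero c h, zero_mul]

/-! ### Permutations of a subset -/

theorem cyclesTrace_congr {T : Finset (Fin n)} {σ : Equiv.Perm (Fin n)}
    (hσ : ∀ i ∉ T, σ i = i) {Z Z' : Fin n → Mat} (h : ∀ i ∈ T, Z i = Z' i) :
    cyclesTrace T σ Z = cyclesTrace T σ Z' := by
  have h1 : ∀ i ∈ T, σ i ∈ T := fun i hi => by
    by_contra hi'
    rw [σ.injective (hσ _ hi')] at hi'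
    exact hi' hi
  have h2 : ∀ (k : ℕ), ∀ i ∈ T, (σ ^ k) i ∈ T := by
    intro k
    induction k with
    | zero => exact fun i hi => hi
    | succ k ih => exact fun i hi => ih _ (h1 i hi)
  refine Finset.prod_congr rfl fun i hi => ?_
  rw [cycleTrace, cycleTrace]
  congr 2
  exact List.map_congr_left fun k _ => h _ (h2 k i (mem_filter.1 hi).1)

theorem cyclesTrace_univ_eq {T : Finset (Fin n)} {σ : Equiv.Perm (Fin n)}
    (hσ : ∀ i ∉ T, σ i = i) (Z : Fin n → Mat) :
    cyclesTrace univ σ Z = cyclesTrace T σ Z * ∏ i ∈ Tᶜ, (Z i).trace := by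
  classical
  have h : ∀ i ∉ T, (if ∀ j, σ.SameCycle i j → i ≤ j then cycleTrace Z σ i else 1) =
      (Z i).trace := by
    intro i hi
    have h1 : Function.minimalPeriod σ i = 1 := Function.minimalPeriod_eq_one_iff_isFixedPt.2 (hσ i hi)
    rw [if_pos fun j hj => ?_]
    · simp [cycleTrace, h1]
    · obtain ⟨k, rfl⟩ := hj
      rw [Equiv.Perm.zpow_apply_eq_self_of_apply_eq_self (hσ i hi)]
  rw [cyclesTrace, cyclesTrace, Finset.prod_filter, Finset.prod_filter, ← Finset.prod_mul_prod_compl T]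
  congr 1
  refine Finset.prod_congr rfl fun i hi => ?_
  rw [← h i (mem_compl.1 hi)]

/-- The tensor power has one factor per generator. The relation on `S` is extended to all generators
by multiplying with the traces of the missing ones, multiplied by τ there, and restricted to `T`. -/
theorem sum_cyclesTrace_eq_zero {S T : Finset (Fin n)} (hST : S ⊆ T) {τ : Equiv.Perm (Fin n)}
    (hτ : ∀ i ∉ T, τ i = i) {c : Equiv.Perm (Fin n) → ℂ} (hc : ∀ σ, c σ ≠ 0 → ∀ i ∉ S, σ i = i)
    (h : ∀ Y : Fin n → SL, ∑ σ, c σ * cyclesTrace S σ (fun i => (Y i).1) = 0)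
    (Z : Fin n → Mat) : ∑ σ, c σ * cyclesTrace T (τ * σ) Z = 0 := by
  classical
  have h1 : ∀ Y : Fin n → SL, ∑ σ, c σ * stateSum σ (fun i => (Y i).1) = 0 := by
    intro Y
    rw [← zero_mul (∏ i ∈ Sᶜ, (Y i).1.trace), ← h Y, Finset.sum_mul]
    refine Finset.sum_congr rfl fun σ _ => ?_
    by_cases hσ : c σ = 0
    · simp [hσ]
    · rw [stateSum_apply, ← cyclesTrace_univ, cyclesTrace_univ_eq (hc σ hσ), mul_assoc]
  -- Identity matrices outside `T` turn each trivial cycle there into the factor 2, and the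
  -- resulting power of 2 can be cancelled.
  have h2 := sum_mul_left_eq_zero c h1 τ fun i => if i ∈ T then Z i else 1
  have h3 : ∀ σ, c σ * stateSum (τ * σ) (fun i => if i ∈ T then Z i else 1) =
      c σ * cyclesTrace T (τ * σ) Z * 2 ^ #Tᶜ := by
    intro σ
    by_cases hσ : c σ = 0
    · simp [hσ]
    have hfix : ∀ i ∉ T, (τ * σ) i = i := fun i hi => by
      rw [Equiv.Perm.mul_apply, hc σ hσ i fun hi' => hi (hST hi'), hτ i hi]
    rw [stateSum_apply, ← cyclesTrace_univ, cyclesTrace_univ_eq hfix, mul_assoc,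
      cyclesTrace_congr hfix (Z' := Z) fun i hi => if_pos hi, Finset.prod_eq_pow_card (b := 2)]
    intro i hi
    rw [if_neg (mem_compl.1 hi)]
    simp
  rw [Finset.sum_congr rfl fun σ _ => h3 σ, ← Finset.sum_mul] at h2
  exact (mul_eq_zero.1 h2).resolve_right (pow_ne_zero _ two_ne_zero)

/-! ### The kernel of the map to the skein module -/

/-- The sign of `Psi` cancels the signs of the component traces. Only the classes of the components
enter, so the choice of the link is irrelevant to its value. -/
theorem eval_linkOf (Y : Fin n → SL) (s : W n →₀ ℕ) :
    (-1 : ℂ) ^ Multiset.card (Finsupp.toMultiset s) * (linkOf s).eval Y =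
      s.prod fun w k => loopTrace Y w ^ k := by
  classical
  rw [Diagram.eval_eq, linkOf, (exists_components_eq _).choose_spec, Finsupp.prod]
  simp_rw [neg_eq_neg_one_mul (loopTrace Y _)]
  rw [Multiset.prod_map_mul, ← mul_assoc, Multiset.map_const', Multiset.prod_replicate, ← mul_pow,
    neg_one_mul, neg_neg, one_pow, one_mul, Finset.prod_multiset_map_count,
    Finsupp.toFinset_toMultiset]
  simp only [Finsupp.count_toMultiset]

theorem Psi_apply (q : MvPolynomial (W n) ℂ) :
    Psi n q = ∑ s ∈ q.support, (q.coeff s *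
      (-1 : ℂ) ^ Multiset.card (Finsupp.toMultiset s)) • (linkOf s).toV := by
  rw [Psi, Module.Basis.constr_apply, Finsupp.sum]
  simp only [smul_smul]
  rfl

/-- The kernel of `Psi` consists of the relations between traces in `SL₂(ℂ)`. -/
theorem Psi_eq_zero_iff (q : MvPolynomial (W n) ℂ) :
    Psi n q = 0 ↔ ∀ Y : Fin n → SL, MvPolynomial.aeval (loopTrace Y) q = 0 := by
  have h : ∀ Y : Fin n → SL, MvPolynomial.aeval (loopTrace Y) q = ∑ s ∈ q.support, (q.coeff s *
      (-1 : ℂ) ^ Multiset.card (Finsupp.toMultiset s)) * (linkOf s).eval Y := by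
    intro Y
    rw [MvPolynomial.aeval_def, MvPolynomial.eval₂_eq]
    refine Finset.sum_congr rfl fun s _ => ?_
    rw [mul_assoc, eval_linkOf]
    rfl
  rw [Psi_apply]
  -- One direction is evaluation on `V n`; the other is the injectivity of the family of all
  -- evaluations.
  refine ⟨fun hq Y => ?_, fun hq => sum_toV_eq_zero _ _ _ fun Y => by rw [← h, hq]⟩
  have := congrArg (evalV Y) hq
  simpa [h Y] using this

/-- The inverses appear because `rho` sends `a_i` to the inverse of `Y i`. -/
theorem aeval_cyclePoly (Y : Fin n → SL) (T : Finset (Fin n))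
    (x : MonoidAlgebra ℂ (Equiv.Perm (Fin n))) :
    MvPolynomial.aeval (loopTrace Y) (cyclePoly T x) =
      ∑ σ, x.coeff σ * cyclesTrace T σ fun i => (Y i)⁻¹.1 := by
  classical
  rw [cyclePoly, Finsupp.sum_fintype _ _ (by simp), map_sum]
  refine Finset.sum_congr rfl fun σ _ => ?_
  rw [map_smul, smul_eq_mul, cycleMonomial, map_prod, cyclesTrace]
  congr 1
  refine Finset.prod_congr (by congr) fun i _ => ?_
  rw [MvPolynomial.aeval_X, loopTrace_loopClass, cycleTrace, cycleWord, map_list_prod]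
  congr 1
  rw [List.map_map]
  generalize List.range _ = l
  induction l with
  | nil => rfl
  | cons k l ih =>
    rw [List.map_cons, List.prod_cons, Matrix.SpecialLinearGroup.coe_mul, ih, List.map_cons,
      List.prod_cons, Function.comp_apply, rho, FreeGroup.lift_apply_of]

theorem extend_coeff {S : Finset (Fin n)} (p : MonoidAlgebra ℂ (Equiv.Perm {i // i ∈ S}))
    (σ : Equiv.Perm (Fin n)) (h : (extend S p).coeff σ ≠ 0) : ∀ i ∉ S, σ i = i := by
  classical
  intro i hi
  have h1 : σ ∈ (Finsupp.mapDomain Equiv.Perm.ofSubtype p.coeff).support :=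
    Finsupp.mem_support_iff.2 h
  obtain ⟨ρ, -, rfl⟩ := Finset.mem_image.1 (Finsupp.mapDomain_support h1)
  exact Equiv.Perm.ofSubtype_apply_of_not_mem ρ hi

end

end HandlebodySkein

end

/-! ### The theorem -/

theorem proposition2 (n : ℕ) (S : Finset (Fin n))
    (p : MonoidAlgebra ℂ (Equiv.Perm {i // i ∈ S}))
    (hp : HandlebodySkein.Psi n (HandlebodySkein.cyclePoly S (HandlebodySkein.extend S p)) = 0)
    (τ : Equiv.Perm (Fin n)) (T : Finset (Fin n)) (hST : S ⊆ T) (hτ : ∀ i, i ∉ T → τ i = i) :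
    HandlebodySkein.Psi n (HandlebodySkein.cyclePoly T
      (MonoidAlgebra.single τ 1 * HandlebodySkein.extend S p)) = 0 := by
  rw [HandlebodySkein.Psi_eq_zero_iff] at hp ⊢
  intro Y
  -- After the substitution σ ↦ τσ the coefficient of τσ in the product is the coefficient of σ in
  -- the original element.
  rw [HandlebodySkein.aeval_cyclePoly, ← Equiv.sum_comp (Equiv.mulLeft τ)]
  simp only [Equiv.coe_mulLeft, MonoidAlgebra.coeff_single_mul_apply, inv_mul_cancel_left, one_mul]
  refine HandlebodySkein.sum_cyclesTrace_eq_zero hST hτ (HandlebodySkein.extend_coeff p)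
    (fun Y => ?_) _
  -- The hypothesis at the inverse matrices gives the relation at the matrices themselves.
  simpa [HandlebodySkein.aeval_cyclePoly] using hp fun i => (Y i)⁻¹
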